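/- \textbf{Setting.} Let $F\neq 0$ be a constant and let $r,s\ge 1$. The lines $\alpha_1,\dots,\alpha_r,\beta_1,\dots,\beta_s$ carry complex momenta in $D$-dimensional Minkowski space. They are on-shell ($p_a^2=0$), and $P_T^2\neq 0$, where $P_T=\sum_{a\in T}p_a$, for every proper subset $T$ of the lines with an odd number $\geq 3$ of elements. Put $s_{ab}=2p_a\cdot p_b$ and $p_1=-\sum_a p_a$; the line $1$ is off-shell. The color-ordered vertices of the nonlinear sigma model in the Cayley parametrization are $V_{2n+1}=0$ and $V_{2n+2}=(-\tfrac1{2F^2})^n\big(\sum_{i=0}^n p_{2i+1}\big)^2$. The currents are given by $\mathcal J(a)=1$ for a single line and, for two or more lines with total momentum $P$, by the Berends--Giele recursion $$\mathcal J(a_1\cdots a_k)=\frac{i}{P^2}\sum_{m\ge4}\ \sum_{\text{divisions into } m-1 \text{ consecutive blocks } K_1,\dots,K_{m-1}} iV_m(-P,P_{K_1},\dots,P_{K_{m-1}})\prod_{l}\mathcal J(K_l).$$ Let $\mathcal A(1,\sigma)=p_1^2\,\mathcal J(\sigma)$, with the factor $p_1^2$ cancelled against the propagator of line $1$. Let $OP(\alpha\cup\beta)$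 be the set of permutations of all the lines that keep the order of the $\alpha$'s and that of the $\beta$'s, let $\xi_a$ be the position of the line $a$ in $\sigma$, and put $$\mathcal A^{\mathrm{II}}(r,s)=\sum_{\sigma\in OP(\alpha\cup\beta)}\Big(-\sum_{i=1}^r\sum_{\xi_{\beta_j}>\xi_{\alpha_i}}s_{\alpha_i\beta_j}\Big)\mathcal A(1,\sigma).$$ A division consists of a division of $\alpha_1\cdots\alpha_r$ into consecutive blocks $A_1,\dots,A_R$ and of $\beta_1\cdots\beta_s$ into consecutive blocks $B_1,\dots,B_S$. An expansion of $\mathcal A^{\mathrm{II}}(r,s)$ in dimension $D$ is an identity, valid for all momenta as above, $$\mathcal A^{\mathrm{II}}(r,s)=\sum_{\mathrm{div}}\Big(\frac1{2F^2}\Big)^{\lfloor (R+S-1)/2\rfloor}\mathcal{VS}_{\mathrm{div}}\;\mathcal J(A_1)\cdots\mathcal J(A_R)\,\mathcal J(B_1)\cdots\mathcal J(B_S),$$ $$\mathcal{VS}_{\mathrm{div}}=-p_1^2\Big(\sum c_{\mathrm{div}}^{ij}s_{\alpha_i\beta_j}+\sum\bar c_{\mathrm{div}}^{\,ij}s_{\alpha_i\alpha_j}+\sum\bar{\bar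 c}_{\mathrm{div}}^{\,ij}s_{\beta_i\beta_j}\Big),$$ with coefficients independent of the momenta (for $r+s$ odd, only terms with $R+S$ odd are nonzero). The term without sub-currents, with coefficient $\mathcal{VS}_0$ and matrix $\mathbf C=(c^{ij})$, is the one in which all blocks are single lines. \textbf{Proposition.} Let $\mathbf C(r,s)=(c_s^{ij})$ be the $r\times s$ matrix with $c_s^{ij}=1$ for $i<j$ and $0$ otherwise if $r-s=-1$; $c_s^{ij}=1$ for $i\le j$ and $0$ otherwise if $r-s=1$; and $c_s^{ij}=0$ for all $i,j$ otherwise. (1) There is an expansion, with the same coefficients for all $D$, with integers $c^{ij}_{\mathrm{div}}$, with all $\bar c^{\,ij}_{\mathrm{div}}=\bar{\bar c}^{\,ij}_{\mathrm{div}}=0$, and with $\mathcal{VS}_0=-p_1^2\sum_{i,j} c_s^{ij}s_{\alpha_i\beta_j}$. Conversely, if $D\ge r+s$, then every expansion in dimension $D$ with complex coefficients has $\mathbf C=\mathbf C(r,s)$ in its term without sub-currents. (2) For a complex $r\times s$ matrix $\mathbf C=(c^{ij})$ let $d_\alpha^{ij}$ be the sum, over the $r$ ways of inserting $\alpha_1$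 into the ordered lines $\alpha_2,\dots,\alpha_r$, of the entry of $\mathbf C$ in column $j$ and in the row given by the resulting position of $\alpha_i$. Define $d_\beta^{ij}$ likewise with $\beta_1,\dots,\beta_s$ and the columns. Then $d_\alpha^{1j}=\sum_i c^{ij}$ and $d_\alpha^{ij}=(i-1)c^{ij}+(r-i+1)c^{i-1,j}$ for $i\ge2$; $d_\beta^{i1}=\sum_j c^{ij}$ and $d_\beta^{ij}=(j-1)c^{ij}+(s-j+1)c^{i,j-1}$ for $j\ge2$. Consider the linear constraints that these sums take the following values (entries not listed are $0$): - if $r-s=-1$: $d_\alpha^{1j}=j-1$; for $i\ge2$, $d_\alpha^{ij}=r$ for $j>i$ and $d_\alpha^{ii}=r-i+1$; $d_\beta^{i1}=s-i$; for $j\ge2$, $d_\beta^{ij}=s$ for $j>i+1$ and $d_\beta^{i,i+1}=i$; - if $r-s=1$: $d_\alpha^{1j}=j$; for $i\ge2$, $d_\alpha^{ij}=r$ for $j\ge i$ and $d_\alpha^{i,i-1}=r-i+1$; $d_\beta^{i1}=s-i+1$; for $j\ge2$, $d_\beta^{ij}=s$ for $j>i$ and $d_\beta^{jj}=j-1$;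 - otherwise: all $d_\alpha^{ij}=d_\beta^{ij}=0$. If $r,s\ge2$, the solutions of these constraints are exactly the matrices $c^{ij}=n(-1)^{i+j}\binom{r-1}{i-1}\binom{s-1}{j-1}+c_s^{ij}$ with a free parameter $n\in\mathbb C$. For all $r,s\ge1$, $\mathbf C(r,s)$ is the unique solution that also satisfies $c^{r1}=0$. -/

import Mathlib

/-!
Tree-level currents of the `U(N)` nonlinear sigma model in the Cayley parametrization, with one
off-shell line `1`, and the expansion of the part of the revised BCJ sum that is
weighted by the `s_{α_i β_j}`.

External momenta are complex vectors in `D`-dimensional Minkowski space. All labels are `0`-based: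
`α_{i+1}` is `Sum.inl i` and `β_{j+1}` is `Sum.inr j`.
-/

namespace NLSM

noncomputable section

open scoped Classical

/-- The bilinear Minkowski product with metric `diag(1, -1, …, -1)`. -/
def mdot {D : ℕ} (p q : Fin D → ℂ) : ℂ :=
  ∑ μ, (if μ.val = 0 then 1 else -1) * p μ * q μ

/-- `p² = p · p`. -/
def msq {D : ℕ} (p : Fin D → ℂ) : ℂ := mdot p p

/-- The color-ordered `m`-point vertex in the Cayley parametrization, as a function of the momenta
of its legs `p_1, …, p_m` (all incoming). It vanishes for odd `m`, and for `m = 2n + 2` it is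
`(-1/(2F²))ⁿ (p_1 + p_3 + ⋯ + p_{2n+1})²`. -/
def vertex (F : ℂ) {D m : ℕ} (legs : Fin m → Fin D → ℂ) : ℂ :=
  if Even m then
    (-(1 / (2 * F ^ 2))) ^ (m / 2 - 1) *
      msq (∑ k : Fin m, if Even k.val then legs k else 0)
  else 0

/-- The legs of the vertex containing the off-shell line when the ordered lines `p` are cut into
the consecutive blocks of `c`: first `p_1 = -P`, then the total momentum of each block. -/
def vertexLegs {D n : ℕ} (p : Fin n → Fin D → ℂ) (c : Composition n) :
    Fin (c.length + 1) → Fin D → ℂ :=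
  Fin.cons (-∑ k, p k) fun l => ∑ k, p (c.embedding l k)

theorem blocksFun_lt {n : ℕ} (c : {c : Composition n // 3 ≤ c.length})
    (l : Fin c.1.length) : c.1.blocksFun l < n := by
  obtain ⟨c, hc⟩ := c
  have hn : 0 < n := by
    have := c.length_le
    omega
  refine (Composition.ne_single_iff hn).1 ?_ l
  rintro rfl
  rw [Composition.single_length] at hc
  omega

/-- The Berends–Giele current `J(p_1, …, p_n)` of `n` ordered lines:
`J = 1` for one line and otherwise
`J = (i / P²) ∑_{m ≥ 4} ∑_{divisions into m - 1 consecutive blocks} i V_m ∏ J(block)`. -/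
def current (F : ℂ) {D : ℕ} : (n : ℕ) → (Fin n → Fin D → ℂ) → ℂ
  | n, p =>
    if n = 1 then 1
    else
      Complex.I / msq (∑ k, p k) *
        ∑ c : {c : Composition n // 3 ≤ c.length},
          Complex.I * vertex F (vertexLegs p c.1) *
            ∏ l : Fin c.1.length,
              current F (c.1.blocksFun l) (fun k => p (c.1.embedding l k))
termination_by n => n
decreasing_by exact blocksFun_lt c l

/-- The amplitude `A(1, p_1, …, p_n)` with the line `1` off-shell, that is `p_1² J`
with the propagator `1 / p_1²` of the off-shell line cancelled. -/
def amplitude (F : ℂ) {D n : ℕ} (p : Fin n → Fin D → ℂ) : ℂ :=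
  Complex.I *
    ∑ c : {c : Composition n // 3 ≤ c.length},
      Complex.I * vertex F (vertexLegs p c.1) *
        ∏ l : Fin c.1.length,
          current F (c.1.blocksFun l) (fun k => p (c.1.embedding l k))

/-- The ordered permutations `OP(α_r ∪ β_s)`, each given by the position `ξ` of every line. -/
def orderedPerms (r s : ℕ) : Finset ((Fin r ⊕ Fin s) ≃ Fin (r + s)) :=
  Finset.univ.filter fun ξ =>
    StrictMono (fun i => ξ (Sum.inl i)) ∧ StrictMono (fun j => ξ (Sum.inr j))

/-- `s_{ab} = 2 p_a · p_b`. -/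
def mandelstam {D r s : ℕ} (p : Fin r ⊕ Fin s → Fin D → ℂ) (a b : Fin r ⊕ Fin s) : ℂ :=
  2 * mdot (p a) (p b)

/-- `p_1²` for the off-shell line, with `p_1 = -∑ p_a`. -/
def offShellSq {D r s : ℕ} (p : Fin r ⊕ Fin s → Fin D → ℂ) : ℂ := msq (-∑ a, p a)

/-- The part of the revised BCJ sum carrying the coefficients `s_{α_i β_j}`:
`∑_{σ ∈ OP(α ∪ β)} (∑_i ∑_{ξ_{β_j} > ξ_{α_i}} -s_{α_i β_j}) A(1, σ)`. -/
def revisedBCJ (F : ℂ) {D r s : ℕ} (p : Fin r ⊕ Fin s → Fin D → ℂ) : ℂ :=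
  ∑ ξ ∈ orderedPerms r s,
    (∑ i : Fin r, ∑ j : Fin s,
      if ξ (Sum.inl i) < ξ (Sum.inr j) then -mandelstam p (Sum.inl i) (Sum.inr j) else 0) *
      amplitude F (fun k => p (ξ.symm k))

/-- `c^{ij} s_{α_i β_j} + cα^{ij} s_{α_i α_j} + cβ^{ij} s_{β_i β_j}`, the general form
of a coefficient that is linear in the `s_{ab}`. -/
def linearForm {D r s : ℕ} (p : Fin r ⊕ Fin s → Fin D → ℂ) (c : Matrix (Fin r) (Fin s) ℂ)
    (cα : Matrix (Fin r) (Fin r) ℂ) (cβ : Matrix (Fin s) (Fin s) ℂ) : ℂ :=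
  (∑ i, ∑ j, c i j * mandelstam p (Sum.inl i) (Sum.inr j)) +
    (∑ i, ∑ j, cα i j * mandelstam p (Sum.inl i) (Sum.inl j)) +
    ∑ i, ∑ j, cβ i j * mandelstam p (Sum.inr i) (Sum.inr j)

/-- A sum over all divisions of `α_1 … α_r` into consecutive blocks `A_1, …, A_R` and of
`β_1 … β_s` into consecutive blocks `B_1, …, B_S`:
`∑ (1/(2F²))^((R+S-1)/2) VS(A, B) J(A_1) ⋯ J(A_R) J(B_1) ⋯ J(B_S)`.
A term with `r + s` odd and `R + S` even has a block of even size, whose current is zero. -/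
def divisionSum (F : ℂ) {D r s : ℕ} (p : Fin r ⊕ Fin s → Fin D → ℂ)
    (VS : Composition r → Composition s → ℂ) : ℂ :=
  ∑ A : Composition r, ∑ B : Composition s,
    (1 / (2 * F ^ 2)) ^ ((A.length + B.length - 1) / 2) * VS A B *
      (∏ I : Fin A.length, current F (A.blocksFun I) fun k => p (Sum.inl (A.embedding I k))) *
      ∏ J : Fin B.length, current F (B.blocksFun J) fun k => p (Sum.inr (B.embedding J k))

/-- All lines `α_i`, `β_j` are on-shell, and no propagator inside a current vanishes. The line `1`
is not restricted. -/
def Admissible {D r s : ℕ} (p : Fin r ⊕ Fin s → Fin D → ℂ) : Prop :=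
  (∀ a, msq (p a) = 0) ∧
    ∀ T : Finset (Fin r ⊕ Fin s), T ≠ Finset.univ → 3 ≤ T.card → Odd T.card →
      msq (∑ a ∈ T, p a) ≠ 0

/-- The coefficients `C`, `Cα`, `Cβ`, which do not depend on the momenta, expand the sum
`revisedBCJ` over divisions, the division `(A, B)` having the coefficient
`VS(A, B) = -p_1² (c^{ij} s_{α_i β_j} + cα^{ij} s_{α_i α_j} + cβ^{ij} s_{β_i β_j})`. -/
def IsExpansion (F : ℂ) (D : ℕ) {r s : ℕ}
    (C : Composition r → Composition s → Matrix (Fin r) (Fin s) ℂ)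
    (Cα : Composition r → Composition s → Matrix (Fin r) (Fin r) ℂ)
    (Cβ : Composition r → Composition s → Matrix (Fin s) (Fin s) ℂ) : Prop :=
  ∀ p : Fin r ⊕ Fin s → Fin D → ℂ, Admissible p →
    revisedBCJ F p =
      divisionSum F p fun A B => -(offShellSq p * linearForm p (C A B) (Cα A B) (Cβ A B))

end

/-- The matrix `C(r, s)`. -/
def coeffMatrix (r s : ℕ) : Matrix (Fin r) (Fin s) ℤ :=
  Matrix.of fun i j =>
    if (r : ℤ) - s = -1 then (if i.val < j.val then 1 else 0)
    else if (r : ℤ) - s = 1 then (if i.val ≤ j.val then 1 else 0)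
    else 0

/-- The sum of the coefficient matrices over the `r` ways of inserting `α_1` into the
ordered lines `α_2, …, α_r`. When `α_1` gets position `k`, the line `α_i` has position
`(Fin.cycleRange k).symm i`. -/
def insertAlphaSum {r s : ℕ} (C : Matrix (Fin r) (Fin s) ℂ) : Matrix (Fin r) (Fin s) ℂ :=
  Matrix.of fun i j => ∑ k : Fin r, C ((Fin.cycleRange k).symm i) j

/-- The same for inserting `β_1` into `β_2, …, β_s`. -/
def insertBetaSum {r s : ℕ} (C : Matrix (Fin r) (Fin s) ℂ) : Matrix (Fin r) (Fin s) ℂ :=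
  Matrix.of fun i j => ∑ k : Fin s, C i ((Fin.cycleRange k).symm j)

/-- The transformation matrix of an insertion into a row of `n` lines, acting from the left:
first row `1 ⋯ 1`, and in row `i ≥ 2` (counted from `1`) the entries `n - i + 1` and `i - 1` in
columns `i - 1` and `i`. -/
def insertMatrix (n : ℕ) : Matrix (Fin n) (Fin n) ℤ :=
  Matrix.of fun i k =>
    if i.val = 0 then 1
    else if k.val = i.val then (i.val : ℤ)
    else if k.val + 1 = i.val then (n : ℤ) - i.val
    else 0

/-- The right-hand side `D_α(r, s)` of the constraints from inserting `α_1`. -/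
def dAlpha (r s : ℕ) : Matrix (Fin r) (Fin s) ℤ :=
  Matrix.of fun i j =>
    if (r : ℤ) - s = -1 then
      if i.val = 0 then (j.val : ℤ)
      else if i.val < j.val then (r : ℤ)
      else if i.val = j.val then (r : ℤ) - i.val
      else 0
    else if (r : ℤ) - s = 1 then
      if i.val = 0 then (j.val : ℤ) + 1
      else if i.val ≤ j.val then (r : ℤ)
      else if i.val = j.val + 1 then (r : ℤ) - i.val
      else 0
    else 0

/-- The right-hand side `D_β(r, s)` of the constraints from inserting `β_1`. -/
def dBeta (r s : ℕ) : Matrix (Fin r) (Fin s) ℤ :=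
  Matrix.of fun i j =>
    if (r : ℤ) - s = -1 then
      if j.val = 0 then (s : ℤ) - 1 - i.val
      else if i.val + 1 < j.val then (s : ℤ)
      else if i.val + 1 = j.val then (j.val : ℤ)
      else 0
    else if (r : ℤ) - s = 1 then
      if j.val = 0 then (s : ℤ) - i.val
      else if i.val < j.val then (s : ℤ)
      else if i.val = j.val then (j.val : ℤ)
      else 0
    else 0

/-- A matrix with integer entries, read over `ℂ`. -/
def toC {m n : ℕ} (M : Matrix (Fin m) (Fin n) ℤ) : Matrix (Fin m) (Fin n) ℂ :=
  M.map fun x => (x : ℂ)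

/-- The linear constraints on the coefficient matrix obtained by permuting `α_1` and `β_1`. -/
def InsertionConstraints {r s : ℕ} (C : Matrix (Fin r) (Fin s) ℂ) : Prop :=
  insertAlphaSum C = toC (dAlpha r s) ∧ insertBetaSum C = toC (dBeta r s)

end NLSM

/-! The Berends–Giele recursion is the perturbative solution of a noncommutative field equation.
Give every line a matrix, and let `Y` be the sum over words of λ J(word) times the product of the
matrices of its letters, where λ² = -1/(2F²). Let ∂ be the commutator with a diagonal matrix of
momenta, so that ∂ multiplies a word by a component of its total momentum. Summed over all
divisions, the Cayley vertices turn into □Y + ∂Y((1-Y)⁻¹ - (1+Y)⁻¹)∂Y, up to invertible factors,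
with the source P²J - A (`wordSum_chainSum`, `fieldEq_wordSum`). By admissibility the source
vanishes on all repetition-free words of fewer than r+s lines. Without source, the equation says
that u⁻¹∂u is conserved for u = (1+Y)/(1-Y) (`divCurrent_cayley`).

For the expansion, the lines act on the lattice of pairs (number of α's used, number of β's used),
over the dual numbers ε² = 0. The β-steps are twisted so that a shuffle gets the weight 1 +
ε∑s_{αβ}, summed over the pairs with α before β. Hence the revised BCJ sum is, up to sign and λ, the
ε-part of the sum of the amplitudes of all shuffles. The same twist makes α-matrices and β-matrices
commute up to 2ε∂·∂. Let a and b be the generating matrices of the α's alone and of the β's alone;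
both solve the field equation. The products of their Cayley transforms in the two orders violate
conservation by opposite terms of order ε, and therefore the mean W of the two Cayley parameters is
an exact solution. It is W = a - aba + ababa - ⋯ + b - bab + ⋯ (`fieldEq_alternating`).

W and Y have the same linear part, and P² ≠ 0 at every proper odd degree from three on, so they
agree below the top degree; at the top, the equation reads "amplitude sum = P² W"
(`apply_eq_of_fieldEq`, `wordSum_amplitude_top`). An alternating word has numbers of α-blocks and
β-blocks that differ by one, and the I-th α-block precedes the J-th β-block iff I < J or I ≤ J,
according to the first letter. This is the matrix C(R,S) (`chainWeight_altWord`,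
`snd_alternatingWords`).

For the converse, any symmetric real Gram matrix is realized by complex momenta once D ≥ r+s
(`exists_gram`). In a limit where, within each kind, only products of neighboring lines survive, all
proper currents tend to zero (`tendsto_current`), so only the term without sub-currents remains, and
its coefficients are read off by varying the products p_α·p_β.

The constraints are a two-term recursion in each index. C(r,s) is a particular solution, a
homogeneous solution must be a multiple of the product of alternating binomials, and at the entry
(r,1) that product is ±1. -/

namespace NLSM

/-! ### Inner derivations and the Cayley transform in a noncommutative ring. -/

section Algebra

variable {ι A : Type*} [Fintype ι] [Ring A]

/-- The inner derivation `f ↦ [f, q]`. -/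
def innerDer (q f : A) : A := f * q - q * f

theorem innerDer_add (q f g : A) : innerDer q (f + g) = innerDer q f + innerDer q g := by
  unfold innerDer; noncomm_ring

theorem innerDer_sub (q f g : A) : innerDer q (f - g) = innerDer q f - innerDer q g := by
  unfold innerDer; noncomm_ring

theorem innerDer_mul (q f g : A) :
    innerDer q (f * g) = innerDer q f * g + f * innerDer q g := by
  unfold innerDer; noncomm_ring

theorem innerDer_one (q : A) : innerDer q 1 = 0 := by
  simp [innerDer]

theorem innerDer_sum {κ : Type*} (t : Finset κ) (q : A) (f : κ → A) :
    innerDer q (∑ k ∈ t, f k) = ∑ k ∈ t, innerDer q (f k) := by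
  simp [innerDer, Finset.sum_mul, Finset.mul_sum]

theorem innerDer_comm {q q' : A} (h : q * q' = q' * q) (f : A) :
    innerDer q (innerDer q' f) = innerDer q' (innerDer q f) := by
  have : innerDer q (innerDer q' f) - innerDer q' (innerDer q f)
      = f * (q' * q - q * q') + (q * q' - q' * q) * f := by
    unfold innerDer; noncomm_ring
  rw [← sub_eq_zero, this, h]; simp

theorem innerDer_inverse (q : A) {x y : A} (h : x * y = 1) (h' : y * x = 1) :
    innerDer q y = -(y * innerDer q x * y) := by
  have h1 : innerDer q x * y + x * innerDer q y = 0 := by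
    rw [← innerDer_mul, h, innerDer_one]
  have h2 : x * innerDer q y = -(innerDer q x * y) := by
    rw [eq_neg_iff_add_eq_zero, add_comm, h1]
  calc innerDer q y = y * (x * innerDer q y) := by rw [← mul_assoc, h', one_mul]
    _ = _ := by rw [h2]; noncomm_ring

/-- The field equation `□X + ∂X · K ∂X`; for `K = (1 - X)⁻¹ - (1 + X)⁻¹` it is the field
equation of the sigma model in the Cayley parametrization. -/
def fieldEq (η : ι → ℤ) (q : ι → A) (X K : A) : A :=
  ∑ μ, η μ • (innerDer (q μ) (innerDer (q μ) X) + innerDer (q μ) X * K * innerDer (q μ) X)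

/-- The divergence of the current `v ∂u`, where `v` is the inverse of `u`. -/
def divCurrent (η : ι → ℤ) (q : ι → A) (u v : A) : A :=
  ∑ μ, η μ • innerDer (q μ) (v * innerDer (q μ) u)

/-- All functions of `X` commute, and `(1 + X) * m = 2 m - 1`, so only the derivative `m ∂X m` of
the resolvent is needed. -/
theorem cayley_current (q : A) {X m p : A} (hm : (1 - X) * m = 1) (hm' : m * (1 - X) = 1)
    (hp : (1 + X) * p = 1) (hp' : p * (1 + X) = 1) :
    (1 - X) * p * innerDer q ((1 + X) * m) = p * innerDer q X * m + p * innerDer q X * m := by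
  have hu : (1 + X) * m = m + m - 1 := by
    have : (1 + X) * m = m + m - (1 - X) * m := by noncomm_ring
    rw [this, hm]
  have hd : innerDer q m = m * innerDer q X * m := by
    rw [innerDer_inverse q hm hm', innerDer_sub, innerDer_one]; noncomm_ring
  have hc : (1 - X) * p * m = p := by
    have h1 : (1 - X) * p = p * (1 - X) := by
      have e1 : (1 - X) * p = (2 - (1 + X)) * p := by rw [← one_add_one_eq_two]; congr 1; abel
      have e2 : p * (1 - X) = p * (2 - (1 + X)) := by rw [← one_add_one_eq_two]; congr 1; abel
      rw [e1, e2, sub_mul, mul_sub, hp, hp', mul_two, two_mul]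
    rw [h1, mul_assoc, hm, mul_one]
  rw [hu, innerDer_sub, innerDer_one, innerDer_add, hd, sub_zero, mul_add]
  have : (1 - X) * p * (m * innerDer q X * m) = p * innerDer q X * m := by
    rw [← mul_assoc, ← mul_assoc, hc]
  rw [this]

/-- Differentiating `p ∂X m` with `∂p = -p ∂X p` and `∂m = m ∂X m` produces the resolvent difference
`m - p` between two factors `∂X`. So, as `p` and `m` are invertible and 2 is cancellable in a
complex algebra, the field equation there is conservation of the current. -/
theorem divCurrent_cayley (η : ι → ℤ) (q : ι → A) {X m p : A} (hm : (1 - X) * m = 1)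
    (hm' : m * (1 - X) = 1) (hp : (1 + X) * p = 1) (hp' : p * (1 + X) = 1) :
    divCurrent η q ((1 + X) * m) ((1 - X) * p) =
      p * fieldEq η q X (m - p) * m + p * fieldEq η q X (m - p) * m := by
  unfold divCurrent fieldEq
  simp only [Finset.mul_sum, Finset.sum_mul]
  rw [← Finset.sum_add_distrib]
  refine Finset.sum_congr rfl fun μ _ => ?_
  rw [cayley_current _ hm hm' hp hp', innerDer_add]
  have hdm : innerDer (q μ) m = m * innerDer (q μ) X * m := by
    rw [innerDer_inverse _ hm hm', innerDer_sub, innerDer_one]; noncomm_ring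
  have hdp : innerDer (q μ) p = -(p * innerDer (q μ) X * p) := by
    rw [innerDer_inverse _ hp hp', innerDer_add, innerDer_one]; noncomm_ring
  rw [innerDer_mul, innerDer_mul, hdm, hdp]
  simp only [mul_smul_comm, smul_mul_assoc, ← smul_add]
  congr 1
  noncomm_ring

/-- Both sides are `v ∂∂'u - v ∂'u v ∂u`. Conjugation thus turns a derivative of the right current
into one of the left current with the two directions exchanged. -/
theorem innerDer_conj_rightCurrent {q q' u v : A} (hq : q * q' = q' * q) (h : u * v = 1)
    (h' : v * u = 1) :
    v * innerDer q (innerDer q' u * v) * u = innerDer q' (v * innerDer q u) := by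
  rw [innerDer_mul, innerDer_mul, innerDer_inverse q h h', innerDer_inverse q' h h',
    innerDer_comm hq]
  calc _ = v * innerDer q' (innerDer q u) * (v * u)
        - v * innerDer q' u * v * innerDer q u * (v * u) := by noncomm_ring
    _ = _ := by rw [h']; noncomm_ring

end Algebra

/-! ### Products of two solutions in subrings that commute to order `ε`. -/

section Bracket

variable {ι A B M : Type*} [Fintype ι] [Ring A] [Ring B] [Ring M]

/-- By the product rule, two conserved currents fail to give a conserved current for the product
only through the commutator of the left current of `U` with the right current of `U'`. -/
theorem divCurrent_mul_aux (η : ι → ℤ) (Q : ι → M) {U V U' V' : M} (hV : V * U = 1)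
    (hU' : U' * V' = 1) (hV' : V' * U' = 1) (h : divCurrent η Q U V = 0)
    (h' : divCurrent η Q U' V' = 0) :
    divCurrent η Q (U * U') (V' * V) =
      V' * (∑ μ, η μ • (V * innerDer (Q μ) U * (innerDer (Q μ) U' * V') -
        innerDer (Q μ) U' * V' * (V * innerDer (Q μ) U))) * U' := by
  have key : ∀ μ, innerDer (Q μ) (V' * V * innerDer (Q μ) (U * U')) =
      V' * innerDer (Q μ) (V * innerDer (Q μ) U) * U' + innerDer (Q μ) (V' * innerDer (Q μ) U') +
      V' * (V * innerDer (Q μ) U * (innerDer (Q μ) U' * V') -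
        innerDer (Q μ) U' * V' * (V * innerDer (Q μ) U)) * U' := by
    intro μ
    have e : V' * V * innerDer (Q μ) (U * U') =
        V' * (V * innerDer (Q μ) U) * U' + V' * innerDer (Q μ) U' := by
      rw [innerDer_mul]
      calc _ = V' * (V * innerDer (Q μ) U) * U' + V' * (V * U) * innerDer (Q μ) U' := by
            noncomm_ring
        _ = _ := by rw [hV, mul_one]
    rw [e, innerDer_add, innerDer_mul (Q μ) (V' * (V * innerDer (Q μ) U)) U',
      innerDer_mul (Q μ) V' (V * innerDer (Q μ) U), innerDer_inverse (Q μ) hU' hV']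
    have e2 : V' * (V * innerDer (Q μ) U * (innerDer (Q μ) U' * V') -
        innerDer (Q μ) U' * V' * (V * innerDer (Q μ) U)) * U' =
        V' * (V * innerDer (Q μ) U) * innerDer (Q μ) U' * (V' * U') -
        V' * innerDer (Q μ) U' * V' * (V * innerDer (Q μ) U) * U' := by noncomm_ring
    rw [e2, hV', mul_one]
    noncomm_ring
  unfold divCurrent at *
  simp only [key, smul_add, Finset.sum_add_distrib, h', add_zero]
  have : ∑ μ, η μ • (V' * innerDer (Q μ) (V * innerDer (Q μ) U) * U') = V' * (∑ μ, η μ •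
      innerDer (Q μ) (V * innerDer (Q μ) U)) * U' := by
    simp only [Finset.mul_sum, Finset.sum_mul, mul_smul_comm, smul_mul_assoc]
  rw [this, h]
  simp only [Finset.mul_sum, Finset.sum_mul, mul_smul_comm, smul_mul_assoc]
  simp

variable (η : ι → ℤ) (q : ι → A) (q' : ι → B) (Q : ι → M) (f : A →+* M) (g : B →+* M) (ε : M)

theorem map_divCurrent (hf : ∀ μ x, innerDer (Q μ) (f x) = f (innerDer (q μ) x)) (u v : A) :
    divCurrent η Q (f u) (f v) = f (divCurrent η q u v) := by
  simp only [divCurrent, hf, ← map_mul, map_sum, map_zsmul]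

/-- The products `u u'` and `u' u` of solutions in two subrings that commute up to
`ε ∂ · ∂` have opposite current divergences. -/
theorem divCurrent_add_swap (hε : ∀ x, ε * x = x * ε) (hε2 : ε * ε = 0)
    (hq : ∀ μ ν, q μ * q ν = q ν * q μ) (hq' : ∀ μ ν, q' μ * q' ν = q' ν * q' μ)
    (hf : ∀ μ x, innerDer (Q μ) (f x) = f (innerDer (q μ) x))
    (hg : ∀ μ x, innerDer (Q μ) (g x) = g (innerDer (q' μ) x))
    (hbr : ∀ x y, f x * g y - g y * f x =
      ε * ∑ ν, η ν • (f (innerDer (q ν) x) * g (innerDer (q' ν) y)))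
    {u v : A} {u' v' : B} (hu : u * v = 1) (hv : v * u = 1) (hu' : u' * v' = 1)
    (hv' : v' * u' = 1) (h : divCurrent η q u v = 0) (h' : divCurrent η q' u' v' = 0) :
    ∃ d, divCurrent η Q (f u * g u') (g v' * f v) = ε * d ∧
      divCurrent η Q (g u' * f u) (f v * g v') = -(ε * d) := by
  -- The bracket is itself of order `ε`, so behind a factor `ε` the two subrings commute.
  have hcomm : ∀ x y, ε * (f x * g y) = ε * (g y * f x) := by
    intro x y
    rw [← sub_eq_zero, ← mul_sub, hbr, ← mul_assoc, hε2, zero_mul]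
  have hF : divCurrent η Q (f u) (f v) = 0 := by
    rw [map_divCurrent η q Q f hf, h, map_zero]
  have hG : divCurrent η Q (g u') (g v') = 0 := by
    rw [map_divCurrent η q' Q g hg, h', map_zero]
  have fu : f u * f v = 1 := by rw [← map_mul, hu, map_one]
  have fv : f v * f u = 1 := by rw [← map_mul, hv, map_one]
  have gu : g u' * g v' = 1 := by rw [← map_mul, hu', map_one]
  have gv : g v' * g u' = 1 := by rw [← map_mul, hv', map_one]
  -- The commutator of the two currents is evaluated with `hbr`; `d` is the result after the right
  -- current of `u'` has been turned into a left current.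
  refine ⟨∑ μ, ∑ ν, (η μ * η ν) • (f (innerDer (q ν) (v * innerDer (q μ) u)) *
    g (innerDer (q' μ) (v' * innerDer (q' ν) u'))), ?_, ?_⟩
  · rw [divCurrent_mul_aux η Q fv gu gv hF hG]
    simp only [hf, hg, ← map_mul, hbr]
    simp only [Finset.mul_sum, Finset.sum_mul, Finset.smul_sum, mul_smul_comm, smul_mul_assoc,
      smul_smul]
    refine Finset.sum_congr rfl fun μ _ => Finset.sum_congr rfl fun ν _ => ?_
    congr 1
    rw [← innerDer_conj_rightCurrent (hq' ν μ) hu' hv']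
    simp only [map_mul]
    calc _ = g v' * (ε * (f (innerDer (q ν) (v * innerDer (q μ) u)) *
          g (innerDer (q' ν) (innerDer (q' μ) u' * v')))) * g u' := by
          rfl
      _ = g v' * ε * g (innerDer (q' ν) (innerDer (q' μ) u' * v')) * (f (innerDer (q ν) (v * innerDer (q μ) u)) * g u') := by
          rw [hcomm]; noncomm_ring
      _ = g v' * g (innerDer (q' ν) (innerDer (q' μ) u' * v')) * (ε * (f (innerDer (q ν) (v * innerDer (q μ) u)) * g u')) := by
          rw [mul_assoc (g v'), hε]; noncomm_ring
      _ = (g v' * g (innerDer (q' ν) (innerDer (q' μ) u' * v'))) * ε * (g u' * f (innerDer (q ν) (v * innerDer (q μ) u))) := by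
          rw [hcomm]; noncomm_ring
      _ = ε * (g (v' * innerDer (q' ν) (innerDer (q' μ) u' * v') * u') * f (innerDer (q ν) (v * innerDer (q μ) u))) := by
          rw [← hε]; simp only [map_mul]; noncomm_ring
      _ = _ := by rw [← hcomm]; simp only [map_mul]
  · rw [divCurrent_mul_aux η Q gv fu fv hG hF]
    have hbr' : ∀ x y, g y * f x - f x * g y =
      -(ε * ∑ ν, η ν • (f (innerDer (q ν) x) * g (innerDer (q' ν) y))) := by
      intro x y; rw [← hbr]; noncomm_ring
    simp only [hf, hg, ← map_mul, hbr']
    simp only [Finset.mul_sum, Finset.sum_mul, Finset.smul_sum, mul_smul_comm, smul_mul_assoc,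
      smul_smul, ← Finset.sum_neg_distrib, mul_neg, neg_mul, smul_neg]
    -- In the opposite order it is the right current of `u` that gets converted, which exchanges `μ`
    -- and `ν` relative to `d`; the sign is that of the reversed commutator.
    rw [Finset.sum_comm]
    refine Finset.sum_congr rfl fun μ _ => Finset.sum_congr rfl fun ν _ => ?_
    rw [mul_comm (η ν)]
    congr 2
    rw [← innerDer_conj_rightCurrent (hq μ ν) hu hv]
    calc _ = f v * ε * (f (innerDer (q μ) (innerDer (q ν) u * v)) *
          (g (innerDer (q' μ) (v' * innerDer (q' ν) u')) * f u)) := by noncomm_ring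
      _ = f v * f (innerDer (q μ) (innerDer (q ν) u * v)) * (ε *
          (g (innerDer (q' μ) (v' * innerDer (q' ν) u')) * f u)) := by
          rw [mul_assoc (f v), ← mul_assoc ε, hε]; noncomm_ring
      _ = f v * f (innerDer (q μ) (innerDer (q ν) u * v)) * ε * (f u *
          g (innerDer (q' μ) (v' * innerDer (q' ν) u'))) := by
          rw [← hcomm]; noncomm_ring
      _ = _ := by
          rw [← hε]; simp only [map_mul]; noncomm_ring

/-- The terms linear in `ε` cancel between the two signs, and the quadratic ones contain `ε² = 0`.
-/
theorem fieldEq_average (hε : ∀ x, ε * x = x * ε) (hε2 : ε * ε = 0) (W K y k : M) :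
    fieldEq η Q (W + ε * y) (K + ε * k) + fieldEq η Q (W - ε * y) (K - ε * k) =
      fieldEq η Q W K + fieldEq η Q W K := by
  have hz : ∀ x z w : M, ε * x * w * (ε * z) = 0 := by
    intro x z w
    rw [mul_assoc ε, hε, ← mul_assoc, mul_assoc (x * w), hε2]; simp
  have hz' : ∀ x z w : M, w * (ε * x) * (ε * z) = 0 := by
    intro x z w
    rw [hε x, mul_assoc, mul_assoc x, ← mul_assoc ε, hε2]; simp
  have hd : ∀ μ x, innerDer (Q μ) (ε * x) = ε * innerDer (Q μ) x := by
    intro μ x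
    unfold innerDer
    rw [mul_sub, ← mul_assoc (Q μ), ← hε (Q μ)]
    noncomm_ring
  unfold fieldEq
  rw [← Finset.sum_add_distrib, ← Finset.sum_add_distrib]
  refine Finset.sum_congr rfl fun μ _ => ?_
  rw [← smul_add, ← smul_add]
  congr 1
  simp only [innerDer_add, innerDer_sub, hd]
  set e := innerDer (Q μ) W
  set e' := innerDer (Q μ) y
  calc _ = (innerDer (Q μ) e + e * K * e + (innerDer (Q μ) e + e * K * e)) +
        ((ε * e' * K * (ε * e') + e * (ε * k) * (ε * e') + ε * e' * (ε * k) * e) +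
        (ε * e' * K * (ε * e') + e * (ε * k) * (ε * e') + ε * e' * (ε * k) * e)) := by noncomm_ring
    _ = _ := by
      have h3 : ε * e' * (ε * k) = 0 := by simpa using hz e' k 1
      rw [hz, hz', h3]; simp

theorem inverse_unique {x y y' : A} (h : x * y = 1) (h' : y' * x = 1) : y = y' := by
  calc y = y' * x * y := by rw [h', one_mul]
    _ = y' := by rw [mul_assoc, h, mul_one]

theorem cayley_inverse {a ma pa : A} (hma' : ma * (1 - a) = 1) (hpa : (1 + a) * pa = 1) :
    (1 + a) * ma * ((1 - a) * pa) = 1 := by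
  calc _ = (1 + a) * (ma * (1 - a)) * pa := by noncomm_ring
    _ = 1 := by rw [hma', mul_one, hpa]

theorem cayley_inverse' {a ma pa : A} (hma : (1 - a) * ma = 1) (hpa' : pa * (1 + a) = 1) :
    (1 - a) * pa * ((1 + a) * ma) = 1 := by
  calc _ = (1 - a) * (pa * (1 + a)) * ma := by noncomm_ring
    _ = 1 := by rw [hpa', mul_one, hma]

/-- The parameter of the product of two Cayley transforms, with its two resolvents. -/
theorem cayley_mul {a b ma pa mb pb G : M} (hma : (1 - a) * ma = 1) (hma' : ma * (1 - a) = 1)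
    (hpa : (1 + a) * pa = 1) (hpa' : pa * (1 + a) = 1)
    (hmb : (1 - b) * mb = 1) (hmb' : mb * (1 - b) = 1)
    (hpb : (1 + b) * pb = 1) (hpb' : pb * (1 + b) = 1)
    (hG : (1 + a * b) * G = 1) (hG' : G * (1 + a * b) = 1) :
    ∃ X m p : M, X = 1 - (1 - b) * G * (1 - a) ∧
      (1 - X) * m = 1 ∧ m * (1 - X) = 1 ∧ (1 + X) * p = 1 ∧ p * (1 + X) = 1 ∧
      (1 + X) * m = (1 + a) * ma * ((1 + b) * mb) ∧
      (1 - X) * p = (1 - b) * pb * ((1 - a) * pa) ∧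
      m + m = (1 + a) * ma * ((1 + b) * mb) + 1 := by
  have ca : (1 + a) * ma = ma * (1 + a) := by
    calc (1 + a) * ma = ma * (1 - a) * (1 + a) * ma := by rw [hma']; noncomm_ring
      _ = ma * (1 + a) * ((1 - a) * ma) := by noncomm_ring
      _ = _ := by rw [hma]; noncomm_ring
  set U := (1 + a) * ma * ((1 + b) * mb) with hU
  set V := (1 - b) * pb * ((1 - a) * pa) with hV
  have hUV : U * V = 1 := by
    calc U * V = (1 + a) * ma * ((1 + b) * (mb * (1 - b)) * pb) * ((1 - a) * pa) := by
          rw [hU, hV]; noncomm_ring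
      _ = (1 + a) * (ma * (1 - a)) * pa := by rw [hmb', mul_one, hpb]; noncomm_ring
      _ = 1 := by rw [hma', mul_one, hpa]
  have hVU : V * U = 1 := by
    calc V * U = (1 - b) * pb * ((1 - a) * (pa * (1 + a)) * ma) * ((1 + b) * mb) := by
          rw [hU, hV]; noncomm_ring
      _ = (1 - b) * (pb * (1 + b)) * mb := by rw [hpa', mul_one, hma]; noncomm_ring
      _ = 1 := by rw [hpb', mul_one, hmb]
  set n := (1 - b) * G * (1 - a) with hn
  -- From `U + 1 = 2 (1 - X)⁻¹` and `(1+a)(1+b) + (1-a)(1-b) = 2(1 + ab)` the resolvent must be this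
  -- `m`, and `n` is its inverse.
  set m := ma * (1 + a * b) * mb with hm
  have hnm : n * m = 1 := by
    calc n * m = (1 - b) * G * ((1 - a) * ma) * (1 + a * b) * mb := by rw [hn, hm]; noncomm_ring
      _ = (1 - b) * (G * (1 + a * b)) * mb := by rw [hma]; noncomm_ring
      _ = 1 := by rw [hG', mul_one, hmb]
  have hmn : m * n = 1 := by
    calc m * n = ma * (1 + a * b) * (mb * (1 - b)) * G * (1 - a) := by rw [hn, hm]; noncomm_ring
      _ = ma * ((1 + a * b) * G) * (1 - a) := by rw [hmb']; noncomm_ring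
      _ = 1 := by rw [hG, mul_one, hma']
  have hmm : m + m = U + 1 := by
    have : (1 : M) = ma * (1 - a) * ((1 - b) * mb) := by rw [hma', hmb, one_mul]
    calc m + m = ma * (1 + a) * ((1 + b) * mb) + ma * (1 - a) * ((1 - b) * mb) := by
          rw [hm]; noncomm_ring
      _ = U + 1 := by rw [← this, ← ca]
  have e1 : 1 - (1 - n) = n := by abel
  have e2 : 1 + (1 - n) = U * n := by
    have : U * n + n = 2 := by
      calc U * n + n = (U + 1) * n := by noncomm_ring
        _ = 2 := by rw [← hmm, add_mul, hmn, one_add_one_eq_two]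
    rw [eq_sub_of_add_eq this, ← one_add_one_eq_two]; abel
  refine ⟨1 - n, m, m * V, rfl, ?_, ?_, ?_, ?_, ?_, ?_, hmm⟩
  · rw [e1, hnm]
  · rw [e1, hmn]
  · rw [e2]
    calc U * n * (m * V) = U * (n * m) * V := by noncomm_ring
      _ = 1 := by rw [hnm, mul_one, hUV]
  · rw [e2]
    calc m * V * (U * n) = m * (V * U) * n := by noncomm_ring
      _ = 1 := by rw [hVU, mul_one, hmn]
  · rw [e2, mul_assoc, hnm, mul_one]
  · rw [e1, ← mul_assoc, hnm, one_mul]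

/-- If `a` and `b` solve the field equation in two subrings that commute up to `ε ∂ · ∂` with
`ε² = 0`, then so does the sum `a - aba + ababa - ⋯ + b - bab + babab - ⋯` of
the alternating words. -/
theorem fieldEq_alternating [Algebra ℂ M] (hε : ∀ x, ε * x = x * ε) (hε2 : ε * ε = 0)
    (hq : ∀ μ ν, q μ * q ν = q ν * q μ) (hq' : ∀ μ ν, q' μ * q' ν = q' ν * q' μ)
    (hf : ∀ μ x, innerDer (Q μ) (f x) = f (innerDer (q μ) x))
    (hg : ∀ μ x, innerDer (Q μ) (g x) = g (innerDer (q' μ) x))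
    (hbr : ∀ x y, f x * g y - g y * f x =
      ε * ∑ ν, η ν • (f (innerDer (q ν) x) * g (innerDer (q' ν) y)))
    {a ma pa : A} {b mb pb : B} (hma : (1 - a) * ma = 1) (hma' : ma * (1 - a) = 1)
    (hpa : (1 + a) * pa = 1) (hpa' : pa * (1 + a) = 1)
    (hmb : (1 - b) * mb = 1) (hmb' : mb * (1 - b) = 1)
    (hpb : (1 + b) * pb = 1) (hpb' : pb * (1 + b) = 1)
    (ha : fieldEq η q a (ma - pa) = 0) (hb : fieldEq η q' b (mb - pb) = 0)
    {G G' m p : M} (hG : (1 + f a * g b) * G = 1) (hG' : G * (1 + f a * g b) = 1)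
    (hH : (1 + g b * f a) * G' = 1) (hH' : G' * (1 + g b * f a) = 1)
    (hm : m * (1 - (f a * G' + g b * G)) = 1) (hp : p * (1 + (f a * G' + g b * G)) = 1) :
    fieldEq η Q (f a * G' + g b * G) (m - p) = 0 := by
  have fm : ∀ {x y : A}, x * y = 1 → f x * f y = 1 := fun h => by rw [← map_mul, h, map_one]
  have gm : ∀ {x y : B}, x * y = 1 → g x * g y = 1 := fun h => by rw [← map_mul, h, map_one]
  have da : divCurrent η q ((1 + a) * ma) ((1 - a) * pa) = 0 := by
    rw [divCurrent_cayley η q hma hma' hpa hpa', ha]; simp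
  have db : divCurrent η q' ((1 + b) * mb) ((1 - b) * pb) = 0 := by
    rw [divCurrent_cayley η q' hmb hmb' hpb hpb', hb]; simp
  have ua := cayley_inverse hma' hpa
  have va := cayley_inverse' hma hpa'
  have ub := cayley_inverse hmb' hpb
  have vb := cayley_inverse' hmb hpb'
  obtain ⟨d, hd1, hd2⟩ := divCurrent_add_swap η q q' Q f g ε hε hε2 hq hq' hf hg hbr ua va ub vb
    da db
  have hma1 := fm hma
  have hma1' := fm hma'
  have hpa1 := fm hpa
  have hpa1' := fm hpa'
  have hmb1 := gm hmb
  have hmb1' := gm hmb'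
  have hpb1 := gm hpb
  have hpb1' := gm hpb'
  have hUc := hbr ((1 + a) * ma) ((1 + b) * mb)
  simp only [map_sub, map_add, map_one, map_mul] at hma1 hma1' hpa1 hpa1' hmb1 hmb1' hpb1 hpb1' hd1 hd2
  generalize (∑ ν, η ν • (f (innerDer (q ν) ((1 + a) * ma)) *
    g (innerDer (q' ν) ((1 + b) * mb)))) = c at hUc
  simp only [map_add, map_one, map_mul] at hUc
  obtain ⟨X, m1, p1, hX, hm1, hm1', hp1, hp1', hU1, hV1, hmm1⟩ :=
    cayley_mul hma1 hma1' hpa1 hpa1' hmb1 hmb1' hpb1 hpb1' hG hG'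
  obtain ⟨Y, m2, p2, hY, hm2, hm2', hp2, hp2', hU2, hV2, hmm2⟩ :=
    cayley_mul hmb1 hmb1' hpb1 hpb1' hma1 hma1' hpa1 hpa1' hH hH'
  rw [← hU1, ← hV1, divCurrent_cayley η Q hm1 hm1' hp1 hp1'] at hd1
  rw [← hU2, ← hV2, divCurrent_cayley η Q hm2 hm2' hp2 hp2'] at hd2
  set W := f a * G' + g b * G with hW
  -- `W` is the mean of the Cayley parameters `X`, `Y` of the two ordered products.
  have hWsum : X + Y = W + W := by
    have e1 : g b * G = G' * g b := by
      calc g b * G = G' * (1 + g b * f a) * g b * G := by rw [hH', one_mul]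
        _ = G' * g b * ((1 + f a * g b) * G) := by noncomm_ring
        _ = _ := by rw [hG, mul_one]
    have e2 : f a * G' = G * f a := by
      calc f a * G' = G * (1 + f a * g b) * f a * G' := by rw [hG', one_mul]
        _ = G * f a * ((1 + g b * f a) * G') := by noncomm_ring
        _ = _ := by rw [hH, mul_one]
    have e3 : g b * G * f a = 1 - G' := by
      rw [e1]
      calc G' * g b * f a = G' * (1 + g b * f a) - G' := by noncomm_ring
        _ = _ := by rw [hH']
    have e4 : f a * G' * g b = 1 - G := by
      rw [e2]
      calc G * f a * g b = G * (1 + f a * g b) - G := by noncomm_ring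
        _ = _ := by rw [hG']
    rw [hX, hY]
    calc _ = 1 + 1 - G - G' + g b * G + G' * g b + f a * G' + G * f a - g b * G * f a
          - f a * G' * g b := by noncomm_ring
      _ = _ := by rw [e3, e4, ← e1, ← e2, hW]; abel
  have half : ∀ x y : M, x + x = y → x = (1 / 2 : ℂ) • y := by
    intro x y h
    rw [← h, smul_add, ← add_smul]; norm_num
  -- The two products differ by the bracket `ε c`, and each resolvent is half of (product + 1).
  have hmdiff : m1 - m2 = ε * ((1 / 2 : ℂ) • c) := by
    rw [mul_smul_comm]
    refine half _ _ ?_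
    rw [← hUc]
    calc m1 - m2 + (m1 - m2) = m1 + m1 - (m2 + m2) := by abel
      _ = _ := by rw [hmm1, hmm2]; abel
  have hXY : X - Y = ε * ((1 - Y) * ((1 / 2 : ℂ) • c) * (1 - X)) := by
    calc X - Y = (1 - Y) * (m1 * (1 - X)) - (1 - Y) * m2 * (1 - X) := by
          rw [hm1', hm2]; noncomm_ring
      _ = (1 - Y) * (m1 - m2) * (1 - X) := by noncomm_ring
      _ = _ := by rw [hmdiff, ← mul_assoc, ← hε]; noncomm_ring
  obtain ⟨z, hz⟩ : ∃ z, X - Y = ε * z := ⟨_, hXY⟩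
  have hpdiff : ∃ w, p1 - p2 = ε * w := by
    refine ⟨-(p1 * z * p2), ?_⟩
    calc p1 - p2 = p1 * ((1 + Y) * p2) - p1 * (1 + X) * p2 := by rw [hp1', hp2]; noncomm_ring
      _ = -(p1 * (X - Y) * p2) := by noncomm_ring
      _ = _ := by rw [hz, ← mul_assoc, ← hε]; noncomm_ring
  obtain ⟨w, hw⟩ := hpdiff
  have zz : ∀ x y t : M, ε * x * t * (ε * y) = 0 := by
    intro x y t
    rw [mul_assoc ε, hε, ← mul_assoc, mul_assoc (x * t), hε2]; simp
  set y := (1 / 2 : ℂ) • z with hy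
  have hyz : ε * y + ε * y = X - Y := by
    rw [hz, hy, mul_smul_comm, ← add_smul]; norm_num
  have hXW : X = W + ε * y := by
    have : X + X = (W + ε * y) + (W + ε * y) := by
      calc X + X = (X + Y) + (X - Y) := by abel
        _ = _ := by rw [hWsum, ← hyz]; abel
    rw [half _ _ this, ← half _ _ rfl]
  have hYW : Y = W - ε * y := by
    calc Y = X + Y - X := by abel
      _ = _ := by rw [hWsum, hXW]; abel
  -- the resolvents of the average are the averages of the resolvents
  have hmav : m = (1 / 2 : ℂ) • (m1 + m2) := by
    refine (inverse_unique ?_ hm).symm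
    rw [mul_smul_comm]
    refine (half _ _ ?_).symm
    have h1 : (1 - W) * m1 = 1 + ε * y * m1 := by
      rw [hXW] at hm1
      calc _ = (1 - (W + ε * y)) * m1 + ε * y * m1 := by noncomm_ring
        _ = _ := by rw [hm1]
    have h2 : (1 - W) * m2 = 1 - ε * y * m2 := by
      rw [hYW] at hm2
      calc _ = (1 - (W - ε * y)) * m2 - ε * y * m2 := by noncomm_ring
        _ = _ := by rw [hm2]
    rw [mul_add, h1, h2]
    have : ε * y * (m1 - m2) = 0 := by
      rw [hmdiff]; simpa using zz y ((1 / 2 : ℂ) • c) 1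
    calc (1 : M) + 1 = 1 + 1 + ε * y * (m1 - m2) := by rw [this, add_zero]
      _ = _ := by noncomm_ring
  have hpav : p = (1 / 2 : ℂ) • (p1 + p2) := by
    refine (inverse_unique ?_ hp).symm
    rw [mul_smul_comm]
    refine (half _ _ ?_).symm
    have h1 : (1 + W) * p1 = 1 - ε * y * p1 := by
      rw [hXW] at hp1
      calc _ = (1 + (W + ε * y)) * p1 - ε * y * p1 := by noncomm_ring
        _ = _ := by rw [hp1]
    have h2 : (1 + W) * p2 = 1 + ε * y * p2 := by
      rw [hYW] at hp2
      calc _ = (1 + (W - ε * y)) * p2 + ε * y * p2 := by noncomm_ring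
        _ = _ := by rw [hp2]
    rw [mul_add, h1, h2]
    have : ε * y * (p1 - p2) = 0 := by
      rw [hw]; simpa using zz y w 1
    calc (1 : M) + 1 = 1 + 1 - ε * y * (p1 - p2) := by rw [this, sub_zero]
      _ = _ := by noncomm_ring
  set k := (1 / 2 : ℂ) • ((1 / 2 : ℂ) • c - w) with hk
  have hkk : ε * k + ε * k = (m1 - p1) - (m2 - p2) := by
    calc ε * k + ε * k = ε * ((1 / 2 : ℂ) • c) - ε * w := by
          rw [hk, mul_smul_comm, ← add_smul, mul_sub]; norm_num
      _ = _ := by rw [← hmdiff, ← hw]; abel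
  have hKsum : (m - p) + (m - p) = (m1 - p1) + (m2 - p2) := by
    rw [hmav, hpav, ← smul_sub, ← add_smul]; norm_num; abel
  have hK1 : m1 - p1 = (m - p) + ε * k := by
    have : (m1 - p1) + (m1 - p1) = ((m - p) + ε * k) + ((m - p) + ε * k) := by
      calc _ = ((m1 - p1) + (m2 - p2)) + ((m1 - p1) - (m2 - p2)) := by abel
        _ = _ := by rw [← hKsum, ← hkk]; abel
    rw [half _ _ this, ← half _ _ rfl]
  have hK2 : m2 - p2 = (m - p) - ε * k := by
    calc m2 - p2 = (m1 - p1) + (m2 - p2) - (m1 - p1) := by abel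
      _ = _ := by rw [← hKsum, hK1]; abel
  have hav := fieldEq_average η Q ε hε hε2 W (m - p) y k
  rw [← hXW, ← hYW, ← hK1, ← hK2] at hav
  have hE1 : fieldEq η Q X (m1 - p1) + fieldEq η Q X (m1 - p1) = (1 + X) * (ε * d) * (1 - X) := by
    rw [← hd1]
    calc _ = (1 + X) * p1 * fieldEq η Q X (m1 - p1) * (m1 * (1 - X)) +
          (1 + X) * p1 * fieldEq η Q X (m1 - p1) * (m1 * (1 - X)) := by
          rw [hp1, hm1']; noncomm_ring
      _ = _ := by noncomm_ring
  have hE2 : fieldEq η Q Y (m2 - p2) + fieldEq η Q Y (m2 - p2) =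
      -((1 + Y) * (ε * d) * (1 - Y)) := by
    calc _ = (1 + Y) * p2 * fieldEq η Q Y (m2 - p2) * (m2 * (1 - Y)) +
          (1 + Y) * p2 * fieldEq η Q Y (m2 - p2) * (m2 * (1 - Y)) := by
          rw [hp2, hm2']; noncomm_ring
      _ = (1 + Y) * (p2 * fieldEq η Q Y (m2 - p2) * m2 + p2 * fieldEq η Q Y (m2 - p2) * m2) *
          (1 - Y) := by noncomm_ring
      _ = _ := by rw [hd2]; noncomm_ring
  -- `X` and `Y` differ by order `ε`, so the factors around `ε d` may be exchanged, and the opposite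
  -- sources of the two equations cancel.
  have hsum : (1 + X) * (ε * d) * (1 - X) = (1 + Y) * (ε * d) * (1 - Y) := by
    have hX' : X = Y + ε * z := by rw [← hz]; abel
    have z1 : ε * z * (ε * d) = 0 := by simpa using zz z d 1
    have z2 : ε * d * (ε * z) = 0 := by simpa using zz d z 1
    rw [hX']
    calc _ = (1 + Y) * (ε * d) * (1 - Y) + ε * z * (ε * d) * (1 - Y - ε * z) -
          (1 + Y) * (ε * d * (ε * z)) := by noncomm_ring
      _ = _ := by rw [z1, z2]; simp
  -- `fieldEq_average` applies because `X`, `Y` and their resolvent differences are `W ± ε y` and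
  -- `(m - p) ± ε k`.
  have h4 : (fieldEq η Q W (m - p) + fieldEq η Q W (m - p)) +
      (fieldEq η Q W (m - p) + fieldEq η Q W (m - p)) = 0 := by
    rw [← hav]
    calc _ = (fieldEq η Q X (m1 - p1) + fieldEq η Q X (m1 - p1)) +
        (fieldEq η Q Y (m2 - p2) + fieldEq η Q Y (m2 - p2)) := by abel
      _ = 0 := by rw [hE1, hE2, hsum]; simp
  rw [half _ _ (half _ _ h4)]; simp

end Bracket

/-! ### Divisions of a word into consecutive blocks. -/

section Compositions

theorem sum_composition_zero {M : Type*} [AddCommMonoid M] (Φ : List ℕ → M) :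
    ∑ c : Composition 0, Φ c.blocks = Φ [] := by
  rw [Fintype.sum_eq_single (Composition.ones 0)]
  · simp
  · intro c hc
    exact absurd (Composition.eq_ones_iff_le_length.2 (Nat.zero_le _)) hc

/-- A sum over compositions, split by the size of the first block. -/
theorem sum_composition {M : Type*} [AddCommMonoid M] {n : ℕ} (hn : n ≠ 0) (Φ : List ℕ → M) :
    ∑ c : Composition n, Φ c.blocks =
      ∑ k ∈ Finset.range n, ∑ c : Composition (n - (k + 1)), Φ ((k + 1) :: c.blocks) := by
  rw [Finset.sum_sigma']
  symm
  refine Finset.sum_bij (fun x hx => ⟨(x.1 + 1) :: x.2.blocks, @fun i hi => ?_, ?_⟩) ?_ ?_ ?_ ?_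
  · rcases List.mem_cons.1 hi with h | h
    · omega
    · exact x.2.blocks_pos h
  · have := Finset.mem_range.1 (Finset.mem_sigma.1 hx).1
    rw [List.sum_cons, x.2.blocks_sum]; omega
  · intros; exact Finset.mem_univ _
  · rintro ⟨k, c⟩ hk ⟨k', c'⟩ hk' h
    simp only [Composition.mk.injEq, List.cons.injEq, Nat.add_right_cancel_iff] at h
    obtain ⟨rfl, h⟩ := h
    congr 1
    exact Composition.ext h
  · rintro c -
    obtain ⟨bs, hpos, hsum⟩ := c
    cases bs with
    | nil => exact absurd hsum.symm (by simpa using hn)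
    | cons b bs =>
      have hb : 0 < b := hpos (by simp)
      rw [List.sum_cons] at hsum
      refine ⟨⟨b - 1, ⟨bs, fun h => hpos (List.mem_cons_of_mem _ h), by omega⟩⟩, ?_, ?_⟩
      · simp only [Finset.mem_sigma, Finset.mem_range, Finset.mem_univ, and_true]; omega
      · simp only [Composition.mk.injEq, List.cons.injEq, and_true]; omega
  · intros; rfl

variable {L : Type*}

/-- The sum of `Φ` over all divisions of a word into consecutive nonempty blocks. -/
def splitSum {M : Type*} [AddCommMonoid M] (Φ : List (List L) → M) (w : List L) : M :=
  ∑ c : Composition w.length, Φ (w.splitWrtComposition c)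

theorem splitSum_nil {M : Type*} [AddCommMonoid M] (Φ : List (List L) → M) :
    splitSum Φ [] = Φ [] :=
  sum_composition_zero fun bs => Φ (List.splitWrtCompositionAux [] bs)

/-- The recursion behind all inductions on divisions: peel off the first block, of size `k + 1`. -/
theorem splitSum_of_ne_nil {M : Type*} [AddCommMonoid M] (Φ : List (List L) → M) {w : List L}
    (hw : w ≠ []) :
    splitSum Φ w = ∑ k ∈ Finset.range w.length,
      splitSum (fun ps => Φ (w.take (k + 1) :: ps)) (w.drop (k + 1)) := by
  unfold splitSum List.splitWrtComposition
  rw [sum_composition (by simpa using hw) fun bs => Φ (w.splitWrtCompositionAux bs)]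
  refine Finset.sum_congr rfl fun k _ => ?_
  have h : w.length - (k + 1) = (w.drop (k + 1)).length := by simp
  rw [h]
  simp [List.splitWrtCompositionAux_cons]

theorem splitSum_mul {R : Type*} [Semiring R] (c : R) (Φ : List (List L) → R) (w : List L) :
    splitSum (fun ps => c * Φ ps) w = c * splitSum Φ w :=
  (Finset.mul_sum _ _ _).symm

/-- The convolution of two functions on words. -/
def conv (f g : List L → ℂ) (w : List L) : ℂ :=
  ∑ k ∈ Finset.range (w.length + 1), f (w.take k) * g (w.drop k)

theorem sum_take_drop {f : List L → ℂ} (hf : f [] = 0) (g : List L → ℂ) (w : List L) :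
    ∑ k ∈ Finset.range w.length, f (w.take (k + 1)) * g (w.drop (k + 1)) = conv f g w := by
  rw [conv, Finset.sum_range_succ']
  simp [hf]

end Compositions

/-! ### Generating elements: truncated sums over words. -/

section WordSums

variable {L : Type*} {M : Type*} [Ring M]

/-- The image of a word under the multiplicative extension of `m`. -/
def wordProd (m : L → M) (w : List L) : M := (w.map m).prod

theorem wordProd_append (m : L → M) (u v : List L) :
    wordProd m (u ++ v) = wordProd m u * wordProd m v := by
  simp [wordProd]

variable [Algebra ℂ M]

theorem innerDer_smul (q : M) (c : ℂ) (f : M) : innerDer q (c • f) = c • innerDer q f := by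
  simp [innerDer, smul_sub]

/-- The sum of the values of `c` on the letters of a word. -/
def letterSum {V : Type*} [AddCommMonoid V] (c : L → V) (w : List L) : V := (w.map c).sum

theorem innerDer_wordProd {q : M} {m : L → M} {c : L → ℂ} (h : ∀ a, innerDer q (m a) = c a • m a)
    (w : List L) : innerDer q (wordProd m w) = letterSum c w • wordProd m w := by
  induction w with
  | nil => simp [wordProd, letterSum, innerDer_one]
  | cons a w ih =>
    have e : wordProd m (a :: w) = m a * wordProd m w := by simp [wordProd]
    rw [e, innerDer_mul, h, ih]
    simp [letterSum, add_smul]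

variable [Fintype L]

/-- The sum of `f w` times the image of `w` over all words of length at most `N`. -/
def wordSum (N : ℕ) (m : L → M) (f : List L → ℂ) : M :=
  ∑ n ∈ Finset.range (N + 1), ∑ w : Fin n → L, f (List.ofFn w) • wordProd m (List.ofFn w)

theorem sum_words_add {E : Type*} [AddCommMonoid E] (k l : ℕ) (h : List L → E) :
    ∑ w : Fin (k + l) → L, h (List.ofFn w) =
      ∑ u : Fin k → L, ∑ v : Fin l → L, h (List.ofFn u ++ List.ofFn v) := by
  rw [← (Fin.appendEquiv k l).sum_comp, Fintype.sum_prod_type]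
  simp [Fin.appendEquiv, List.ofFn_fin_append]

/-- A product of two word sums collects each word with all its cuts into a prefix and a suffix. The
truncation at length `N` does no harm because longer words act as zero. -/
theorem wordSum_conv {N : ℕ} {m : L → M} (hm : ∀ w : List L, N < w.length → wordProd m w = 0)
    (f g : List L → ℂ) : wordSum N m (conv f g) = wordSum N m f * wordSum N m g := by
  have h1 : ∀ n, ∑ w : Fin n → L, conv f g (List.ofFn w) • wordProd m (List.ofFn w) =
      ∑ x ∈ Finset.HasAntidiagonal.antidiagonal n, (∑ u : Fin x.1 → L, f (List.ofFn u) • wordProd m (List.ofFn u)) *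
        ∑ v : Fin x.2 → L, g (List.ofFn v) • wordProd m (List.ofFn v) := by
    intro n
    have h2 : ∀ w : Fin n → L, conv f g (List.ofFn w) • wordProd m (List.ofFn w) =
        ∑ x ∈ Finset.HasAntidiagonal.antidiagonal n, (f ((List.ofFn w).take x.1) * g ((List.ofFn w).drop x.1)) •
          wordProd m (List.ofFn w) := by
      intro w
      rw [Finset.Nat.sum_antidiagonal_eq_sum_range_succ_mk, conv, List.length_ofFn,
        Finset.sum_smul]
    simp only [h2]
    rw [Finset.sum_comm]
    refine Finset.sum_congr rfl fun x hx => ?_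
    obtain ⟨k, l⟩ := x
    obtain rfl : k + l = n := by simpa using hx
    rw [sum_words_add k l fun w => (f (w.take k) * g (w.drop k)) • wordProd m w, Finset.sum_mul_sum]
    refine Finset.sum_congr rfl fun u _ => Finset.sum_congr rfl fun v _ => ?_
    rw [List.take_left' (by simp), List.drop_left' (by simp), wordProd_append, smul_mul_smul_comm]
  unfold wordSum
  simp only [h1]
  rw [Finset.sum_mul_sum, Finset.sum_sigma', ← Finset.sum_product']
  refine Finset.sum_of_injOn (fun x => x.2) ?_ ?_ ?_ ?_
  · rintro ⟨n, x⟩ hx ⟨n', y⟩ hy h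
    simp only [Finset.coe_sigma, Set.mem_sigma_iff, Finset.mem_coe, Finset.HasAntidiagonal.mem_antidiagonal] at *
    obtain rfl := h
    obtain rfl : n = n' := by rw [← hx.2, ← hy.2]
    rfl
  · rintro ⟨n, x⟩ hx
    simp only [Finset.coe_sigma, Set.mem_sigma_iff, Finset.mem_coe, Finset.HasAntidiagonal.mem_antidiagonal,
      Finset.mem_range, Finset.coe_product, Set.mem_prod] at *
    omega
  -- The pairs of lengths with `k + l > N` occur only in the product, and there they contribute
  -- zero.
  · rintro ⟨k, l⟩ hx hx'
    rw [Finset.sum_mul_sum]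
    refine Finset.sum_eq_zero fun u _ => Finset.sum_eq_zero fun v _ => ?_
    rw [smul_mul_smul_comm, ← wordProd_append, hm, smul_zero]
    by_contra hlt
    refine hx' ⟨⟨k + l, (k, l)⟩, ?_, rfl⟩
    simp at hlt ⊢
    omega
  · intros; rfl

theorem wordSum_add (N : ℕ) (m : L → M) (f g : List L → ℂ) :
    wordSum N m (fun w => f w + g w) = wordSum N m f + wordSum N m g := by
  simp [wordSum, add_smul, Finset.sum_add_distrib]

theorem wordSum_mul (N : ℕ) (m : L → M) (c : ℂ) (f : List L → ℂ) :
    wordSum N m (fun w => c * f w) = c • wordSum N m f := by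
  simp [wordSum, mul_smul, Finset.smul_sum]

theorem wordSum_sum {κ : Type*} (t : Finset κ) (N : ℕ) (m : L → M) (f : κ → List L → ℂ) :
    wordSum N m (fun w => ∑ k ∈ t, f k w) = ∑ k ∈ t, wordSum N m (f k) := by
  simp only [wordSum, Finset.sum_smul]
  rw [Finset.sum_comm]
  refine Finset.sum_congr rfl fun n _ => ?_
  rw [Finset.sum_comm]

theorem wordSum_unit (N : ℕ) (m : L → M) :
    wordSum N m (fun w => if w = [] then 1 else 0) = 1 := by
  unfold wordSum
  rw [Finset.sum_eq_single 0]
  · simp [wordProd]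
  · intro n _ hn
    refine Finset.sum_eq_zero fun w _ => ?_
    simp only
    rw [if_neg, zero_smul]
    intro h
    exact hn (by simpa using congrArg List.length h)
  · simp

/-- Each letter is an eigenvector of the derivation, so the derivation acts on coefficients as
multiplication by the total momentum of the word. -/
theorem innerDer_wordSum {q : M} {m : L → M} {c : L → ℂ} (h : ∀ a, innerDer q (m a) = c a • m a)
    (N : ℕ) (f : List L → ℂ) :
    innerDer q (wordSum N m f) = wordSum N m (fun w => letterSum c w * f w) := by
  unfold wordSum
  simp only [innerDer_sum, innerDer_smul, innerDer_wordProd h, smul_smul, mul_comm (f _)]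

end WordSums

/-! ### Chains of blocks with powers of the alternate momentum. -/

section Jets

variable {L : Type*}

/-- The total of `c` over the blocks in odd (`b = true`) or even (`b = false`) positions,
counted from `1`. -/
def alternateSum {V : Type*} [AddCommMonoid V] (c : L → V) : Bool → List (List L) → V
  | _, [] => 0
  | true, u :: ps => letterSum c u + alternateSum c false ps
  | false, _ :: ps => alternateSum c true ps

/-- The sum over all divisions into an odd (`b = true`) or even (`b = false`) number of
blocks of the product of the values of `J` times a power of the alternate sum of `c`. -/
def chainSum (J : List L → ℂ) (c : L → ℂ) (e : ℕ) (b : Bool) (w : List L) : ℂ :=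
  splitSum (fun ps => if (ps.length % 2 = 1 ↔ b = true) then
    alternateSum c b ps ^ e * (ps.map J).prod else 0) w

variable {J : List L → ℂ} (c : L → ℂ)

/-- With an even number of blocks the first block does not enter the alternate sum, so peeling it
off just leaves an odd chain; the empty division gives the extra term. -/
theorem chainSum_even (hJ : J [] = 0) (e : ℕ) (w : List L) :
    chainSum J c e false w = (if w = [] then 0 ^ e else 0) + conv J (chainSum J c e true) w := by
  by_cases hw : w = []
  · subst hw
    simp [chainSum, splitSum_nil, conv, hJ, alternateSum]
  rw [if_neg hw, zero_add, chainSum, splitSum_of_ne_nil _ hw, ← sum_take_drop hJ]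
  refine Finset.sum_congr rfl fun k _ => ?_
  rw [chainSum, ← splitSum_mul]
  congr 1
  funext ps
  simp only [List.length_cons, alternateSum, List.map_cons, List.prod_cons]
  by_cases h : ps.length % 2 = 1
  · rw [if_pos (by simp; omega), if_pos (by simp; omega)]
    ring
  · rw [if_neg (by simp; omega), if_neg (by simp; omega), mul_zero]

/-- Here the first block does enter the alternate sum, and the binomial theorem separates its share
of the power. -/
theorem chainSum_odd (hJ : J [] = 0) (e : ℕ) (w : List L) :
    chainSum J c e true w = ∑ i ∈ Finset.range (e + 1), (e.choose i : ℂ) *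
      conv (fun u => letterSum c u ^ i * J u) (chainSum J c (e - i) false) w := by
  by_cases hw : w = []
  · subst hw
    simp [chainSum, splitSum_nil, conv, hJ]
  have hJ' : ∀ i, (fun u => letterSum c u ^ i * J u) [] = 0 := by simp [hJ]
  have hc : ∀ i, conv (fun u => letterSum c u ^ i * J u) (chainSum J c (e - i) false) w = _ :=
    fun i => (sum_take_drop (f := fun u => letterSum c u ^ i * J u) (hJ' i)
      (chainSum J c (e - i) false) w).symm
  simp only [hc]
  rw [chainSum, splitSum_of_ne_nil _ hw]
  simp only [Finset.mul_sum]
  rw [Finset.sum_comm]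
  refine Finset.sum_congr rfl fun k _ => ?_
  simp only [chainSum, ← splitSum_mul]
  unfold splitSum
  rw [Finset.sum_comm]
  refine Finset.sum_congr rfl fun d _ => ?_
  generalize List.splitWrtComposition _ d = ps
  simp only [List.length_cons, alternateSum, List.map_cons, List.prod_cons]
  by_cases h : ps.length % 2 = 1
  · rw [if_neg (by simp; omega)]
    simp [h]
  · rw [if_pos (by simp; omega), add_pow, Finset.sum_mul]
    refine Finset.sum_congr rfl fun i _ => ?_
    rw [if_pos (by simp; omega)]
    ring

end Jets

/-! ### Resummation of chains into the field equation. -/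

section ChainAlgebra

variable {L : Type*} [Fintype L] {M : Type*} [Ring M] [Algebra ℂ M]

/-- The chain sums with two momentum insertions resum to the field equation. -/
theorem wordSum_chainSum {N : ℕ} {m : L → M} (hm : ∀ w : List L, N < w.length → wordProd m w = 0)
    {J : List L → ℂ} (hJ : J [] = 0) {q : M} {c : L → ℂ}
    (hq : ∀ a, innerDer q (m a) = c a • m a) {Y R S : M} (hY : Y = wordSum N m J)
    (hR : (1 - Y) * R = 1) (hR' : R * (1 - Y) = 1) (hS : (1 + Y) * S = 1) (hS' : S * (1 + Y) = 1) :
    (1 - Y * Y) * wordSum N m (chainSum J c 2 true) * (1 - Y * Y) =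
      innerDer q (innerDer q Y) + innerDer q Y * (R - S) * innerDer q Y := by
  set d := innerDer q Y with hd
  set d2 := innerDer q d with hd2
  have hd' : d = wordSum N m (fun u => letterSum c u ^ 1 * J u) := by
    rw [hd, hY, innerDer_wordSum hq]; simp
  have hd2' : d2 = wordSum N m (fun u => letterSum c u ^ 2 * J u) := by
    rw [hd2, hd', innerDer_wordSum hq]
    congr 1; funext w; ring
  have hY0 : Y = wordSum N m (fun u => letterSum c u ^ 0 * J u) := by rw [hY]; simp
  have even : ∀ e, wordSum N m (chainSum J c e false) =
      (0 ^ e : ℂ) • 1 + Y * wordSum N m (chainSum J c e true) := by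
    intro e
    have : chainSum J c e false =
        fun w => (0 ^ e * if w = [] then 1 else 0) + conv J (chainSum J c e true) w := by
      funext w; rw [chainSum_even c hJ]; congr 1; split_ifs <;> simp
    rw [this, wordSum_add, wordSum_mul, wordSum_unit, wordSum_conv hm, ← hY]
  have odd : ∀ e, wordSum N m (chainSum J c e true) = ∑ i ∈ Finset.range (e + 1),
      (e.choose i : ℂ) • (wordSum N m (fun u => letterSum c u ^ i * J u) *
        wordSum N m (chainSum J c (e - i) false)) := by
    intro e
    rw [funext (chainSum_odd c hJ e), wordSum_sum]
    refine Finset.sum_congr rfl fun i _ => ?_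
    rw [wordSum_mul, wordSum_conv hm]
  -- The even and odd chain sums of orders 0, 1, 2 satisfy a triangular linear system whose only
  -- inverse is that of `1 - Y * Y`, namely `R * S`.
  have e0 := even 0
  have e1 := even 1
  have e2 := even 2
  have o0 := odd 0
  have o1 := odd 1
  have o2 := odd 2
  simp only [Finset.sum_range_succ, Finset.sum_range_zero, ← hY0, ← hd', ← hd2'] at o0 o1 o2
  simp at e0 e1 e2 o0 o1 o2
  set a0 := wordSum N m (chainSum J c 0 true)
  set a1 := wordSum N m (chainSum J c 1 true)
  set a2 := wordSum N m (chainSum J c 2 true)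
  set b0 := wordSum N m (chainSum J c 0 false)
  set b1 := wordSum N m (chainSum J c 1 false)
  set b2 := wordSum N m (chainSum J c 2 false)
  have hG : (1 - Y * Y) * (R * S) = 1 := by
    calc (1 - Y * Y) * (R * S) = (1 + Y) * ((1 - Y) * R) * S := by noncomm_ring
      _ = 1 := by rw [hR, mul_one, hS]
  have hG' : R * S * (1 - Y * Y) = 1 := by
    calc R * S * (1 - Y * Y) = R * (S * (1 + Y)) * (1 - Y) := by noncomm_ring
      _ = 1 := by rw [hS', mul_one, hR']
  have hb0 : (1 - Y * Y) * b0 = 1 := by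
    calc (1 - Y * Y) * b0 = b0 - Y * (Y * b0) := by noncomm_ring
      _ = 1 := by rw [← o0, e0]; simp
  have hb0' : b0 = R * S := inverse_unique hb0 hG'
  have ha1 : (1 - Y * Y) * a1 = d * b0 := by
    calc (1 - Y * Y) * a1 = a1 - Y * (Y * a1) := by noncomm_ring
      _ = _ := by rw [← e1, o1]; noncomm_ring
  have ha1' : a1 = R * S * (d * b0) := by
    rw [← ha1, ← mul_assoc, hG', one_mul]
  have ha2 : (1 - Y * Y) * a2 = (d * b1 + d * b1) + d2 * b0 := by
    calc (1 - Y * Y) * a2 = a2 - Y * (Y * a2) := by noncomm_ring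
      _ = _ := by
        rw [← e2, o2, ofNat_smul_eq_nsmul, two_nsmul]; noncomm_ring
  -- Partial fractions: `(1 - Y)⁻¹ - (1 + Y)⁻¹ = 2 Y (1 - Y²)⁻¹`.
  have hK : R - S = Y * (R * S) + Y * (R * S) := by
    have h1 : (1 - Y * Y) * (R - S) = (1 - Y * Y) * (Y * (R * S) + Y * (R * S)) := by
      calc (1 - Y * Y) * (R - S) = (1 + Y) * ((1 - Y) * R) - (1 - Y) * ((1 + Y) * S) := by
            noncomm_ring
        _ = Y * 1 + Y * 1 := by rw [hR, hS]; noncomm_ring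
        _ = Y * ((1 - Y * Y) * (R * S)) + Y * ((1 - Y * Y) * (R * S)) := by rw [hG]
        _ = _ := by noncomm_ring
    calc R - S = R * S * ((1 - Y * Y) * (R - S)) := by rw [← mul_assoc, hG', one_mul]
      _ = _ := by rw [h1, ← mul_assoc, hG', one_mul]
  rw [ha2, e1, ha1', hK, hb0']
  calc _ = (d * (Y * (R * S)) * d) * (R * S * (1 - Y * Y)) +
        (d * (Y * (R * S)) * d) * (R * S * (1 - Y * Y)) + d2 * (R * S * (1 - Y * Y)) := by
        noncomm_ring
    _ = _ := by rw [hG']; noncomm_ring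

end ChainAlgebra

/-! ### Currents and amplitudes of words, and their field equation. -/

section Words

variable {L : Type*} {D : ℕ}

/-- The signs of the Minkowski metric. -/
def metricSign (D : ℕ) (μ : Fin D) : ℤ := if μ.val = 0 then 1 else -1

theorem msq_eq_sum (v : Fin D → ℂ) : msq v = ∑ μ, (metricSign D μ : ℂ) * v μ ^ 2 := by
  unfold msq mdot metricSign
  refine Finset.sum_congr rfl fun μ _ => ?_
  split_ifs <;> push_cast <;> ring

theorem msq_neg (v : Fin D → ℂ) : msq (-v) = msq v := by
  simp [msq_eq_sum]

theorem mdot_eq_sum (v w : Fin D → ℂ) :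
    mdot v w = ∑ μ, (metricSign D μ : ℂ) * (v μ * w μ) := by
  unfold mdot metricSign
  refine Finset.sum_congr rfl fun μ _ => ?_
  split_ifs <;> push_cast <;> ring

/-- The current of a word of lines with momenta `p`. -/
noncomputable def wordCurrent (F : ℂ) (p : L → Fin D → ℂ) (w : List L) : ℂ :=
  current F w.length fun i => p (w.get i)

/-- The amplitude of a word of lines with momenta `p`. -/
noncomputable def wordAmplitude (F : ℂ) (p : L → Fin D → ℂ) (w : List L) : ℂ :=
  amplitude F fun i => p (w.get i)

theorem current_congr (F : ℂ) {n n' : ℕ} (h : n = n') {f : Fin n → Fin D → ℂ}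
    {f' : Fin n' → Fin D → ℂ} (hf : ∀ i, f i = f' (i.cast h)) : current F n f = current F n' f' := by
  subst h
  congr 1
  funext i
  exact hf i

theorem amplitude_congr (F : ℂ) {n n' : ℕ} (h : n = n') {f : Fin n → Fin D → ℂ}
    {f' : Fin n' → Fin D → ℂ} (hf : ∀ i, f i = f' (i.cast h)) : amplitude F f = amplitude F f' := by
  subst h
  congr 1
  funext i
  exact hf i

theorem wordCurrent_ofFn (F : ℂ) (p : L → Fin D → ℂ) {n : ℕ} (g : Fin n → L) :
    wordCurrent F p (List.ofFn g) = current F n fun i => p (g i) :=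
  current_congr F (by simp) fun i => by simp; rfl

theorem wordAmplitude_ofFn (F : ℂ) (p : L → Fin D → ℂ) {n : ℕ} (g : Fin n → L) :
    wordAmplitude F p (List.ofFn g) = amplitude F fun i => p (g i) :=
  amplitude_congr F (by simp) fun i => by simp; rfl

theorem wordCurrent_nil (F : ℂ) (p : L → Fin D → ℂ) : wordCurrent F p [] = 0 := by
  unfold wordCurrent
  rw [current]
  have : IsEmpty {c : Composition 0 // 3 ≤ c.length} := ⟨fun c => by
    have := c.1.length_le
    have := c.2
    omega⟩
  simp

theorem getElem_splitWrtComposition_eq_ofFn (w : List L) (c : Composition w.length)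
    (l : Fin c.length) :
    (w.splitWrtComposition c)[l.val]'(by simp) =
      List.ofFn fun k => w.get (c.embedding l k) := by
  rw [List.getElem_splitWrtComposition]
  have h1 := c.sizeUpTo_succ' l
  have h2 := c.sizeUpTo_le (l + 1)
  refine List.ext_getElem ?_ fun i hi hi' => ?_
  · simp; omega
  · simp

theorem splitWrtComposition_eq_ofFn (w : List L) (c : Composition w.length) :
    w.splitWrtComposition c =
      List.ofFn fun l : Fin c.length => List.ofFn fun k => w.get (c.embedding l k) := by
  refine List.ext_getElem (by simp) fun i hi hi' => ?_
  rw [List.getElem_ofFn, ← getElem_splitWrtComposition_eq_ofFn]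

theorem prod_splitWrtComposition (w : List L) (c : Composition w.length) (f : List L → ℂ) :
    ((w.splitWrtComposition c).map f).prod =
      ∏ l : Fin c.length, f (List.ofFn fun k => w.get (c.embedding l k)) := by
  rw [splitWrtComposition_eq_ofFn, List.map_ofFn, List.prod_ofFn]
  rfl

/-- The two parities are proved together, since removing the first block exchanges them. -/
theorem alternateSum_ofFn {V : Type*} [AddCommMonoid V] (c : L → V) {n : ℕ} (g : Fin n → List L) :
    alternateSum c true (List.ofFn g) = ∑ l, (if Even l.val then letterSum c (g l) else 0) ∧
      alternateSum c false (List.ofFn g) =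
        ∑ l, (if Even (l.val + 1) then letterSum c (g l) else 0) := by
  induction n with
  | zero => simp [alternateSum]
  | succ n ih =>
    rw [List.ofFn_succ, Fin.sum_univ_succ, Fin.sum_univ_succ]
    obtain ⟨h1, h2⟩ := ih fun i => g i.succ
    constructor
    · rw [alternateSum, h2]; simp
    · rw [alternateSum, h1]
      simp [Nat.even_add_one]

theorem letterSum_ofFn {V : Type*} [AddCommMonoid V] (c : L → V) {n : ℕ} (g : Fin n → L) :
    letterSum c (List.ofFn g) = ∑ i, c (g i) := by
  simp [letterSum, List.map_ofFn, List.sum_ofFn]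

theorem letterSum_eq_sum_get {V : Type*} [AddCommMonoid V] (c : L → V) (w : List L) :
    letterSum c w = ∑ i, c (w.get i) := by
  conv_lhs => rw [← List.ofFn_get w]
  exact letterSum_ofFn c _

/-- The odd-numbered legs are `-P` and the even-numbered blocks. As `P` is the sum of all blocks,
minus the odd-numbered blocks remains. -/
theorem sum_even_vertexLegs (p : L → Fin D → ℂ) (w : List L) (c : Composition w.length) :
    (∑ k : Fin (c.length + 1), if Even k.val then vertexLegs (fun i => p (w.get i)) c k else 0) =
      -alternateSum p true (w.splitWrtComposition c) := by
  have hP : ∑ k, p (w.get k) = ∑ l : Fin c.length, ∑ k, p (w.get (c.embedding l k)) := by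
    rw [← c.blocksFinEquiv.sum_comp, Fintype.sum_sigma]
    rfl
  rw [Fin.sum_univ_succ, splitWrtComposition_eq_ofFn, (alternateSum_ofFn p _).1]
  simp only [vertexLegs, Fin.cons_zero, Fin.cons_succ, letterSum_ofFn, hP]
  simp only [Fin.val_zero, Even.zero, if_true, Fin.val_succ]
  rw [neg_add_eq_iff_eq_add, ← sub_eq_add_neg, eq_sub_iff_add_eq, ← Finset.sum_add_distrib]
  refine Finset.sum_congr rfl fun l _ => ?_
  by_cases h : Even l.val <;> simp [h, Nat.even_add_one]

/-- The full sum over divisions into an odd number of blocks of the Cayley vertices. -/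
theorem splitSum_vertex {F lam : ℂ} (hlam : lam ^ 2 = -(1 / (2 * F ^ 2))) (p : L → Fin D → ℂ)
    (w : List L) :
    splitSum (fun ps => if ps.length % 2 = 1 then msq (alternateSum p true ps) *
      (ps.map fun u => lam * wordCurrent F p u).prod else 0) w =
      lam * (msq (letterSum p w) * wordCurrent F p w - wordAmplitude F p w) := by
  -- An odd number `n` of blocks belongs to a vertex with `n + 1` legs; one factor `lam` is left
  -- over after its coupling.
  have hpow : ∀ n : ℕ, n % 2 = 1 → lam ^ n = lam * (-(1 / (2 * F ^ 2))) ^ ((n + 1) / 2 - 1) := by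
    intro n hn
    rw [← hlam, ← pow_mul, ← pow_succ']
    congr 1; omega
  have hprod : ∀ c : Composition w.length,
      ((w.splitWrtComposition c).map fun u => lam * wordCurrent F p u).prod =
        lam ^ c.length * ∏ l : Fin c.length,
          current F (c.blocksFun l) (fun k => p (w.get (c.embedding l k))) := by
    intro c
    rw [prod_splitWrtComposition, Finset.prod_mul_distrib]
    simp [wordCurrent_ofFn]
  -- The one-block division supplies `P² J`, the divisions into three or more blocks supply the
  -- vertices of the amplitude.
  have hsplit : ∀ c : Composition w.length,
      (if (w.splitWrtComposition c).length % 2 = 1 then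
        msq (alternateSum p true (w.splitWrtComposition c)) *
          ((w.splitWrtComposition c).map fun u => lam * wordCurrent F p u).prod else 0) =
      (if c.length = 1 then msq (letterSum p w) * (lam * wordCurrent F p w) else 0) +
      lam * (if 3 ≤ c.length then vertex F (vertexLegs (fun i => p (w.get i)) c) *
        ∏ l : Fin c.length, current F (c.blocksFun l) (fun k => p (w.get (c.embedding l k)))
        else 0) := by
    intro c
    rw [List.length_splitWrtComposition]
    by_cases h1 : c.length = 1
    · have hw : 0 < w.length := by
        rcases Nat.eq_zero_or_pos w.length with h | h
        · rw [c.length_eq_zero.2 h] at h1; omega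
        · exact h
      obtain rfl := (Composition.eq_single_iff_length hw).2 h1
      have : w.splitWrtComposition (Composition.single w.length hw) = [w] := by
        simp [List.splitWrtComposition, List.splitWrtCompositionAux]
      rw [this, if_pos (by simp), if_pos h1, if_neg (by simp)]
      simp [alternateSum]
    · rw [if_neg h1, zero_add]
      by_cases h2 : c.length % 2 = 1
      · rw [if_pos h2, if_pos (by omega), vertex,
          if_pos (Nat.even_add_one.2 (by rw [Nat.not_even_iff]; exact h2)), sum_even_vertexLegs, msq_neg,
          hprod, hpow _ h2]
        ring
      · have hv : vertex F (vertexLegs (fun i => p (w.get i)) c) = 0 := by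
          rw [vertex, if_neg (by rw [Nat.even_add_one, not_not, Nat.even_iff]; omega)]
        rw [if_neg h2, hv]
        simp
  unfold splitSum
  simp only [hsplit]
  rw [Finset.sum_add_distrib, ← Finset.mul_sum]
  have hA : wordAmplitude F p w = -∑ c : Composition w.length,
      (if 3 ≤ c.length then vertex F (vertexLegs (fun i => p (w.get i)) c) *
        ∏ l : Fin c.length, current F (c.blocksFun l) (fun k => p (w.get (c.embedding l k)))
        else 0) := by
    rw [wordAmplitude, amplitude, ← Finset.sum_filter, ← Finset.sum_neg_distrib, Finset.mul_sum,
      Finset.sum_subtype (p := fun c : Composition w.length => 3 ≤ c.length) _ (by simp)]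
    refine Finset.sum_congr rfl fun c _ => ?_
    linear_combination (vertex F (vertexLegs (fun i => p (w.get i)) c.1) *
        ∏ l : Fin c.1.length, current F (c.1.blocksFun l)
          (fun k => p (w.get (c.1.embedding l k)))) * Complex.I_mul_I
  have hS : ∑ c : Composition w.length,
      (if c.length = 1 then msq (letterSum p w) * (lam * wordCurrent F p w) else 0) =
      msq (letterSum p w) * (lam * wordCurrent F p w) := by
    rcases eq_or_ne w [] with rfl | hw
    · simp [wordCurrent_nil]
    · have hw' : 0 < w.length := List.length_pos_iff.2 hw
      rw [Finset.sum_eq_single (Composition.single w.length hw')]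
      · simp
      · intro c _ hc
        rw [if_neg fun h => hc ((Composition.eq_single_iff_length hw').2 h)]
      · simp
  rw [hS, hA]; ring

theorem alternateSum_apply (p : L → Fin D → ℂ) (μ : Fin D) (b : Bool) (ps : List (List L)) :
    alternateSum p b ps μ = alternateSum (fun a => p a μ) b ps := by
  have hl : ∀ u : List L, letterSum p u μ = letterSum (fun a => p a μ) u := by
    intro u; simp [letterSum_eq_sum_get, Finset.sum_apply]
  induction ps generalizing b with
  | nil => cases b <;> rfl
  | cons u ps ih => cases b <;> simp [alternateSum, ih, hl]

variable [Fintype L] {M : Type*} [Ring M] [Algebra ℂ M]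

/-- The field equation of the generating element of all currents. -/
theorem fieldEq_wordSum {F lam : ℂ} (hlam : lam ^ 2 = -(1 / (2 * F ^ 2))) (p : L → Fin D → ℂ)
    {N : ℕ} {m : L → M} (hm : ∀ w : List L, N < w.length → wordProd m w = 0) {q : Fin D → M}
    (hq : ∀ μ a, innerDer (q μ) (m a) = p a μ • m a) {Y R S : M}
    (hY : Y = wordSum N m fun w => lam * wordCurrent F p w)
    (hR : (1 - Y) * R = 1) (hR' : R * (1 - Y) = 1) (hS : (1 + Y) * S = 1) (hS' : S * (1 + Y) = 1) :
    fieldEq (metricSign D) q Y (R - S) = (1 - Y * Y) * wordSum N m (fun w =>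
      lam * (msq (letterSum p w) * wordCurrent F p w - wordAmplitude F p w)) * (1 - Y * Y) := by
  -- The square of the alternate momentum splits into its components, each of which is a chain sum
  -- with second power.
  have h : (fun w => lam * (msq (letterSum p w) * wordCurrent F p w - wordAmplitude F p w)) =
      fun w => ∑ μ, (metricSign D μ : ℂ) *
        chainSum (fun w => lam * wordCurrent F p w) (fun a => p a μ) 2 true w := by
    funext w
    rw [← splitSum_vertex hlam]
    simp only [chainSum, ← splitSum_mul]
    unfold splitSum
    rw [Finset.sum_comm]
    refine Finset.sum_congr rfl fun c _ => ?_
    generalize w.splitWrtComposition c = ps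
    simp only [iff_true]
    by_cases hps : ps.length % 2 = 1
    · simp only [if_pos hps]
      rw [msq_eq_sum, Finset.sum_mul]
      refine Finset.sum_congr rfl fun μ _ => ?_
      rw [alternateSum_apply]; ring
    · simp [hps]
  rw [h, wordSum_sum, fieldEq, Finset.mul_sum, Finset.sum_mul]
  refine Finset.sum_congr rfl fun μ _ => ?_
  rw [wordSum_mul, mul_smul_comm, smul_mul_assoc,
    wordSum_chainSum hm (by simp [wordCurrent_nil]) (hq μ) hY hR hR' hS hS', Int.cast_smul_eq_zsmul]

end Words

/-! ### Degree-raising matrices and order-by-order uniqueness. -/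

section Graded

variable {I R : Type*} [CommRing R] {deg : I → ℕ}

/-- Matrices whose entries `(v, w)` vanish unless `v ≤ w` and the degree rises by at least `d`. -/
def Raises [Preorder I] (deg : I → ℕ) (d : ℕ) (f : Matrix I I R) : Prop :=
  ∀ v w, ¬(v ≤ w ∧ deg v + d ≤ deg w) → f v w = 0

/-- Matrices whose entries `(v, w)` vanish unless `deg v + deg w + e` is even. -/
def HasParity (deg : I → ℕ) (e : ℕ) (f : Matrix I I R) : Prop :=
  ∀ v w, (deg v + deg w + e) % 2 ≠ 0 → f v w = 0

namespace Raises

theorem add [Preorder I] {d : ℕ} {f g : Matrix I I R} (hf : Raises deg d f) (hg : Raises deg d g) :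
    Raises deg d (f + g) := fun v w h => by simp [hf v w h, hg v w h]

theorem neg [Preorder I] {d : ℕ} {f : Matrix I I R} (hf : Raises deg d f) :
    Raises deg d (-f) := fun v w h => by simp [hf v w h]

theorem sub [Preorder I] {d : ℕ} {f g : Matrix I I R} (hf : Raises deg d f) (hg : Raises deg d g) :
    Raises deg d (f - g) := fun v w h => by simp [hf v w h, hg v w h]

theorem smul [Preorder I] {S : Type*} [SMulZeroClass S R] {d : ℕ} {f : Matrix I I R} (c : S)
    (hf : Raises deg d f) : Raises deg d (c • f) := fun v w h => by simp [hf v w h]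

theorem sum [Preorder I] {κ : Type*} {t : Finset κ} {d : ℕ} {f : κ → Matrix I I R}
    (hf : ∀ k ∈ t, Raises deg d (f k)) : Raises deg d (∑ k ∈ t, f k) := fun v w h => by
  rw [Matrix.sum_apply]
  exact Finset.sum_eq_zero fun k hk => hf k hk v w h

theorem mono [Preorder I] {d e : ℕ} {f : Matrix I I R} (hf : Raises deg d f) (h : e ≤ d) : Raises deg e f :=
  fun v w hvw => hf v w fun h' => hvw ⟨h'.1, by omega⟩

theorem one [DecidableEq I] [Preorder I] : Raises deg 0 (1 : Matrix I I R) := fun v w h => by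
  refine Matrix.one_apply_ne fun h' => h ?_
  subst h'; simp

theorem mul [Fintype I] [Preorder I] {d e : ℕ} {f g : Matrix I I R} (hf : Raises deg d f) (hg : Raises deg e g) :
    Raises deg (d + e) (f * g) := fun v w h => by
  rw [Matrix.mul_apply]
  refine Finset.sum_eq_zero fun u _ => ?_
  by_cases h1 : v ≤ u ∧ deg v + d ≤ deg u
  · rw [hg u w fun h2 => h ⟨h1.1.trans h2.1, by omega⟩, mul_zero]
  · rw [hf v u h1, zero_mul]

theorem pow [Fintype I] [DecidableEq I] [Preorder I] {f : Matrix I I R} (hf : Raises deg 1 f) (n : ℕ) : Raises deg n (f ^ n) := by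
  induction n with
  | zero => simpa using one
  | succ n ih => rw [pow_succ]; exact ih.mul hf

theorem eq_zero [Preorder I] {N d : ℕ} (hN : ∀ v, deg v ≤ N) {f : Matrix I I R} (hf : Raises deg d f)
    (hd : N < d) : f = 0 := by
  ext v w
  exact hf v w fun h => by have := hN w; omega

theorem innerDer_diagonal [Fintype I] [DecidableEq I] [Preorder I] {d : ℕ} {f : Matrix I I R} (hf : Raises deg d f) (q : I → R) :
    Raises deg d (innerDer (Matrix.diagonal q) f) := fun v w h => by
  simp [innerDer, hf v w h]

/-- A degree raising matrix has a resolvent. -/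
theorem exists_resolvent [Fintype I] [DecidableEq I] [Preorder I] {N : ℕ} (hN : ∀ v, deg v ≤ N) {f : Matrix I I R} (hf : Raises deg 1 f) :
    ∃ g, Raises deg 0 g ∧ (1 - f) * g = 1 ∧ g * (1 - f) = 1 := by
  have h0 : f ^ (N + 1) = 0 := (hf.pow (N + 1)).eq_zero hN (by omega)
  refine ⟨∑ k ∈ Finset.range (N + 1), f ^ k, sum fun k _ => (hf.pow k).mono (Nat.zero_le _), ?_, ?_⟩
  · rw [mul_neg_geom_sum, h0, sub_zero]
  · rw [geom_sum_mul_neg, h0, sub_zero]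

theorem exists_resolvent' [Fintype I] [DecidableEq I] [Preorder I] {N : ℕ} (hN : ∀ v, deg v ≤ N) {f : Matrix I I R} (hf : Raises deg 1 f) :
    ∃ g, Raises deg 0 g ∧ (1 + f) * g = 1 ∧ g * (1 + f) = 1 := by
  simpa using hf.neg.exists_resolvent hN

end Raises

namespace HasParity

theorem add {d : ℕ} {f g : Matrix I I R} (hf : HasParity deg d f) (hg : HasParity deg d g) :
    HasParity deg d (f + g) := fun v w h => by simp [hf v w h, hg v w h]

theorem neg {d : ℕ} {f : Matrix I I R} (hf : HasParity deg d f) :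
    HasParity deg d (-f) := fun v w h => by simp [hf v w h]

theorem mul [Fintype I] {d e : ℕ} {f g : Matrix I I R} (hf : HasParity deg d f) (hg : HasParity deg e g) :
    HasParity deg (d + e) (f * g) := fun v w h => by
  rw [Matrix.mul_apply]
  refine Finset.sum_eq_zero fun u _ => ?_
  by_cases h1 : (deg v + deg u + d) % 2 = 0
  · rw [hg u w (by omega), mul_zero]
  · rw [hf v u h1, zero_mul]

theorem one [DecidableEq I] : HasParity deg 0 (1 : Matrix I I R) := fun v w h => by
  refine Matrix.one_apply_ne fun h' => h ?_
  subst h'; omega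

theorem mod {d e : ℕ} {f : Matrix I I R} (hf : HasParity deg d f) (h : d % 2 = e % 2) :
    HasParity deg e f := fun v w hvw => hf v w (by omega)

/-- The inverse of an even matrix is even. -/
theorem inverse [Fintype I] [DecidableEq I] [Preorder I] {N : ℕ} (hN : ∀ v, deg v ≤ N) {f g : Matrix I I R} (hr : Raises deg 1 f)
    (hf : HasParity deg 0 f) (hg : g * (1 + f) = 1) : HasParity deg 0 g := by
  have hr' := hr.neg
  have h0 : (-f) ^ (N + 1) = 0 := (hr'.pow (N + 1)).eq_zero hN (by omega)
  have hgeom : (1 + f) * ∑ k ∈ Finset.range (N + 1), (-f) ^ k = 1 := by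
    have := mul_neg_geom_sum (-f) (N + 1)
    rwa [h0, sub_zero, sub_neg_eq_add] at this
  rw [← inverse_unique hgeom hg]
  intro v w h
  rw [Matrix.sum_apply]
  have hpow : ∀ k, HasParity deg 0 ((-f) ^ k) := by
    intro k
    induction k with
    | zero => simpa using one
    | succ k ih => rw [pow_succ]; exact ih.mul hf.neg
  exact Finset.sum_eq_zero fun k _ => hpow k v w h

end HasParity

theorem innerDer_diagonal_apply [Fintype I] [DecidableEq I] (q : I → R) (f : Matrix I I R) (v w : I) :
    innerDer (Matrix.diagonal q) f v w = f v w * (q w - q v) := by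
  simp [innerDer, mul_sub, mul_comm (q v)]

/-- Two solutions of the field equation whose entries agree wherever the momentum square
vanishes differ only in top degree. -/
theorem apply_eq_of_fieldEq [Fintype I] [DecidableEq I] [Preorder I] {ι : Type*} [Fintype ι] {η : ι → ℤ} {q : ι → I → R}
    {N : ℕ} (hN : ∀ v, deg v ≤ N) {Y W Ry Sy Rw Sw T : Matrix I I R} (hY : Raises deg 1 Y)
    (hW : Raises deg 1 W) (hRy : Raises deg 0 Ry) (hRy1 : Ry * (1 - Y) = 1)
    (hSy : Raises deg 0 Sy) (hSy1 : Sy * (1 + Y) = 1) (hRw : Raises deg 0 Rw)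
    (hRw1 : (1 - W) * Rw = 1) (hSw : Raises deg 0 Sw) (hSw1 : (1 + W) * Sw = 1)
    (hT : Raises deg N T) (hfY : fieldEq η (fun μ => Matrix.diagonal (q μ)) Y (Ry - Sy) = T)
    (hfW : fieldEq η (fun μ => Matrix.diagonal (q μ)) W (Rw - Sw) = 0)
    (hP : ∀ v w, v ≤ w → deg w < deg v + N →
      (∀ z : R, (∑ μ, η μ • (q μ w - q μ v) ^ 2) * z = 0 → z = 0) ∨ Y v w = W v w) (v w : I) :
    T v w = (∑ μ, η μ • (q μ w - q μ v) ^ 2) * (Y v w - W v w) := by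
  have hbox : ∀ v w, ∑ μ, (η μ • innerDer (Matrix.diagonal (q μ))
      (innerDer (Matrix.diagonal (q μ)) (Y - W))) v w =
      (∑ μ, η μ • (q μ w - q μ v) ^ 2) * (Y v w - W v w) := by
    intro v w
    rw [Finset.sum_mul]
    refine Finset.sum_congr rfl fun μ _ => ?_
    rw [Matrix.smul_apply, innerDer_diagonal_apply, innerDer_diagonal_apply, Matrix.sub_apply,
      smul_mul_assoc]
    congr 1; ring
  -- `Z` is the difference of the nonlinear terms; the two field equations give `T = P² (Y - W) +
  -- Z`.
  set Z := ∑ μ, η μ • (innerDer (Matrix.diagonal (q μ)) Y * (Ry - Sy) *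
      innerDer (Matrix.diagonal (q μ)) Y - innerDer (Matrix.diagonal (q μ)) W * (Rw - Sw) *
      innerDer (Matrix.diagonal (q μ)) W) with hZ
  have hdec : ∀ v w, T v w = (∑ μ, η μ • (q μ w - q μ v) ^ 2) * (Y v w - W v w) + Z v w := by
    intro v w
    rw [← hbox, hZ, Matrix.sum_apply, ← Finset.sum_add_distrib, ← hfY,
      ← sub_zero (fieldEq _ _ Y _), ← hfW, fieldEq, fieldEq, ← Finset.sum_sub_distrib,
      Matrix.sum_apply]
    refine Finset.sum_congr rfl fun μ _ => ?_
    rw [← Matrix.add_apply, ← smul_sub, ← smul_add]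
    simp only [innerDer_sub]
    refine congrFun (congrFun (congrArg (η μ • ·) ?_) v) w
    abel
  -- The nonlinear terms are at least cubic, so a difference of degree `d` is fed back only in
  -- degree `d + 2`.
  have hZr : ∀ d, Raises deg d (Y - W) → Raises deg (d + 2) Z := by
    intro d hd
    refine Raises.sum fun μ _ => Raises.smul _ ?_
    have hdY := hY.innerDer_diagonal (q μ)
    have hdW := hW.innerDer_diagonal (q μ)
    have hdd := hd.innerDer_diagonal (q μ)
    rw [innerDer_sub] at hdd
    have hR : Ry - Rw = Ry * (Y - W) * Rw := by
      calc Ry - Rw = Ry * ((1 - W) * Rw) - Ry * (1 - Y) * Rw := by rw [hRw1, hRy1]; noncomm_ring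
        _ = _ := by noncomm_ring
    have hS : Sy - Sw = -(Sy * (Y - W) * Sw) := by
      calc Sy - Sw = Sy * ((1 + W) * Sw) - Sy * (1 + Y) * Sw := by rw [hSw1, hSy1]; noncomm_ring
        _ = _ := by noncomm_ring
    have hK : Raises deg d ((Ry - Sy) - (Rw - Sw)) := by
      have : (Ry - Sy) - (Rw - Sw) = Ry * (Y - W) * Rw + Sy * (Y - W) * Sw := by
        calc _ = (Ry - Rw) - (Sy - Sw) := by abel
          _ = _ := by rw [hR, hS]; abel
      rw [this]
      refine Raises.add ?_ ?_
      · simpa using (hRy.mul hd).mul hRw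
      · simpa using (hSy.mul hd).mul hSw
    set a := innerDer (Matrix.diagonal (q μ)) Y
    set b := innerDer (Matrix.diagonal (q μ)) W
    have : a * (Ry - Sy) * a - b * (Rw - Sw) * b = (a - b) * (Ry - Sy) * a +
        b * ((Ry - Sy) - (Rw - Sw)) * a + b * (Rw - Sw) * (a - b) := by noncomm_ring
    rw [this]
    -- `a` and `b` raise the degree by one only, and `Ry - Sy` by one more
    have hRy0 : Raises deg 1 (Ry - Sy) := by
      have h1 : Ry = 1 + Ry * Y := by
        rw [← sub_eq_iff_eq_add, ← hRy1]; noncomm_ring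
      have h2 : Sy = 1 - Sy * Y := by
        rw [eq_sub_iff_add_eq, ← hSy1]; noncomm_ring
      have h3 : Ry - Sy = Ry * Y + Sy * Y := by
        calc Ry - Sy = (1 + Ry * Y) - (1 - Sy * Y) := by rw [← h1, ← h2]
          _ = _ := by abel
      rw [h3]
      exact Raises.add (by simpa using hRy.mul hY) (by simpa using hSy.mul hY)
    have hRw0 : Raises deg 1 (Rw - Sw) := by
      have h1 : Rw = 1 + W * Rw := by
        rw [← sub_eq_iff_eq_add, ← hRw1]; noncomm_ring
      have h2 : Sw = 1 - W * Sw := by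
        rw [eq_sub_iff_add_eq, ← hSw1]; noncomm_ring
      have h3 : Rw - Sw = W * Rw + W * Sw := by
        calc Rw - Sw = (1 + W * Rw) - (1 - W * Sw) := by rw [← h1, ← h2]
          _ = _ := by abel
      rw [h3]
      exact Raises.add (by simpa using hW.mul hRw) (by simpa using hW.mul hSw)
    refine Raises.add (Raises.add ?_ ?_) ?_
    · exact ((hdd.mul hRy0).mul hdY).mono (by omega)
    · exact ((hdW.mul hK).mul hdY).mono (by omega)
    · exact ((hdW.mul hRw0).mul hdd).mono (by omega)
  -- Order by order: below degree `N` both `T` and the feedback `Z` vanish, hence so does `P² (Y -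
  -- W)`, and `P²` is cancelled unless the entries agree anyway.
  have hind : ∀ d, d ≤ N → Raises deg d (Y - W) := by
    intro d
    induction d with
    | zero => exact fun _ => (hY.sub hW).mono (by omega)
    | succ d ih =>
      intro hdN v w hvw
      have hd := ih (by omega)
      by_cases h1 : v ≤ w ∧ deg v + d ≤ deg w
      · rcases hP v w h1.1 (by by_contra hlt; exact hvw ⟨h1.1, by omega⟩) with h2 | h2
        · refine h2 _ ?_
          have h3 := hdec v w
          rw [hT v w fun h => hvw ⟨h.1, by omega⟩, hZr d hd v w fun h => hvw ⟨h.1, by omega⟩,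
            add_zero] at h3
          exact h3.symm
        · rw [Matrix.sub_apply, h2, sub_self]
      · exact hd v w h1
  rw [hdec, (hZr N (hind N le_rfl)).eq_zero hN (by omega)]
  simp

end Graded

/-! ### Letters as steps in a graded order. -/

section Steps

variable {L I R : Type*} [Fintype I] [DecidableEq I] [Preorder I] [CommRing R]

/-- Every letter raises the degree by one, and moves from outside the upper set
`S a` of the points that lie behind it into this set. -/
structure IsStep (deg : I → ℕ) (S : L → Set I) (m : L → Matrix I I R) : Prop where
  upper : ∀ a, IsUpperSet (S a)
  step : ∀ a v w, m a v w ≠ 0 → v ≤ w ∧ deg w = deg v + 1 ∧ v ∉ S a ∧ w ∈ S a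

variable {deg : I → ℕ} {S : L → Set I} {m : L → Matrix I I R}

/-- A nonzero entry forces a path from `v` to `w`. After the letter `a` the path stays in the upper
set `S a`, while another step `a` would have to start outside it; so no letter repeats. -/
theorem IsStep.wordProd_apply_ne_zero (h : IsStep deg S m) {u : List L} {v w : I}
    (hu : wordProd m u v w ≠ 0) :
    v ≤ w ∧ deg w = deg v + u.length ∧ u.Nodup ∧ ∀ a ∈ u, v ∉ S a := by
  induction u generalizing v with
  | nil =>
    have : v = w := by
      by_contra hvw
      exact hu (by simp [wordProd, hvw])
    subst this; simp
  | cons a u ih =>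
    have e : wordProd m (a :: u) = m a * wordProd m u := by simp [wordProd]
    rw [e, Matrix.mul_apply] at hu
    obtain ⟨x, -, hx⟩ := Finset.exists_ne_zero_of_sum_ne_zero hu
    obtain ⟨h1, h2, h3, h4⟩ := h.step a v x (left_ne_zero_of_mul hx)
    obtain ⟨k1, k2, k3, k4⟩ := ih (right_ne_zero_of_mul hx)
    refine ⟨h1.trans k1, by rw [k2, h2, List.length_cons]; omega, ?_, ?_⟩
    · exact List.nodup_cons.2 ⟨fun ha => k4 a ha h4, k3⟩
    · intro b hb
      rcases List.mem_cons.1 hb with rfl | hb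
      · exact h3
      · exact fun hv => k4 b hb (h.upper b h1 hv)

theorem IsStep.raises_wordProd (h : IsStep deg S m) (u : List L) :
    Raises deg u.length (wordProd m u) := by
  intro v w hvw
  by_contra hne
  obtain ⟨h1, h2, -⟩ := h.wordProd_apply_ne_zero hne
  exact hvw ⟨h1, h2.ge⟩

theorem IsStep.wordProd_eq_zero (h : IsStep deg S m) {N : ℕ} (hN : ∀ v, deg v ≤ N) (u : List L)
    (hu : N < u.length) : wordProd m u = 0 :=
  (h.raises_wordProd u).eq_zero hN hu

variable [Fintype L] [Algebra ℂ R]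

theorem IsStep.wordSum_apply_eq_zero (h : IsStep deg S m) {f : List L → ℂ} {v w : I} (N : ℕ)
    (hf : ∀ u : List L, v ≤ w → deg w = deg v + u.length → u.Nodup → f u = 0) :
    wordSum N m f v w = 0 := by
  unfold wordSum
  rw [Matrix.sum_apply]
  refine Finset.sum_eq_zero fun n _ => ?_
  rw [Matrix.sum_apply]
  refine Finset.sum_eq_zero fun u _ => ?_
  by_cases hu : wordProd m (List.ofFn u) v w = 0
  · simp [hu]
  · obtain ⟨h1, h2, h3, -⟩ := h.wordProd_apply_ne_zero hu
    rw [hf _ h1 h2 h3, zero_smul]; rfl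

theorem IsStep.raises_wordSum (h : IsStep deg S m) {f : List L → ℂ} (hf : f [] = 0) (N : ℕ) :
    Raises deg 1 (wordSum N m f) := by
  intro v w hvw
  refine h.wordSum_apply_eq_zero N fun u h1 h2 h3 => ?_
  rcases eq_or_ne u [] with rfl | hu
  · exact hf
  · exact absurd ⟨h1, by have := List.length_pos_iff.2 hu; omega⟩ hvw

theorem IsStep.hasParity_wordSum (h : IsStep deg S m) {f : List L → ℂ}
    (hf : ∀ u : List L, u.length % 2 = 0 → f u = 0) (N : ℕ) :
    HasParity deg 1 (wordSum N m f) := by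
  intro v w hvw
  exact h.wordSum_apply_eq_zero N fun u h1 h2 h3 => hf u (by omega)

/-- To lowest order a word sum is its one-letter part. -/
theorem IsStep.raises_wordSum_sub (h : IsStep deg S m) {f : List L → ℂ} (hf : f [] = 0) {N : ℕ}
    (hN : 1 ≤ N) : Raises deg 2 (wordSum N m f - ∑ a, f [a] • m a) := by
  obtain ⟨N, rfl⟩ : ∃ k, N = k + 1 := ⟨N - 1, by omega⟩
  unfold wordSum
  rw [Finset.sum_range_succ', Finset.sum_range_succ']
  have h0 : ∑ w : Fin 0 → L, f (List.ofFn w) • wordProd m (List.ofFn w) = 0 := by simp [hf]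
  have h1 : ∑ w : Fin (0 + 1) → L, f (List.ofFn w) • wordProd m (List.ofFn w) =
      ∑ a, f [a] • m a := by
    rw [← (Equiv.funUnique (Fin 1) L).symm.sum_comp]
    refine Finset.sum_congr rfl fun a _ => ?_
    simp [wordProd]
  rw [h0, h1, add_zero, add_sub_cancel_right]
  refine Raises.sum fun n _ => Raises.sum fun u _ => Raises.smul _ ?_
  exact (h.raises_wordProd _).mono (by simp)

end Steps

/-! ### Vanishing currents of even words and cancellation of propagators. -/

section OnShell

variable {D : ℕ}

/-- An odd number of odd blocks has an odd total. Since vertices require an odd number of blocks,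
this makes all currents of even words vanish by induction. -/
theorem exists_even_block {n : ℕ} (hn : Even n) (c : Composition n) (hc : ¬Even c.length) :
    ∃ l, Even (c.blocksFun l) := by
  by_contra! hodd
  have h1 : ∑ l, c.blocksFun l = n := c.sum_blocksFun
  have h2 : Even (∑ l, c.blocksFun l) ↔ Even c.length := by
    rw [Finset.even_sum_iff_even_card_odd, Finset.filter_true_of_mem, Finset.card_univ,
      Fintype.card_fin]
    intro l _
    exact Nat.not_even_iff_odd.1 (hodd l)
  rw [h1] at h2
  exact hc (h2.1 hn)

theorem vertexTerm_eq_zero_of_even (F : ℂ) {n : ℕ} (hn : Even n) (p : Fin n → Fin D → ℂ)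
    (ih : ∀ k < n, Even k → ∀ q : Fin k → Fin D → ℂ, current F k q = 0)
    (c : {c : Composition n // 3 ≤ c.length}) :
    Complex.I * vertex F (vertexLegs p c.1) * ∏ l : Fin c.1.length,
      current F (c.1.blocksFun l) (fun k => p (c.1.embedding l k)) = 0 := by
  by_cases hc : Even c.1.length
  · rw [vertex, if_neg (by simpa [Nat.even_add_one] using hc)]; simp
  · obtain ⟨l, hl⟩ := exists_even_block hn c.1 hc
    rw [Finset.prod_eq_zero (Finset.mem_univ l) (ih _ (blocksFun_lt c l) hl _), mul_zero]

theorem current_eq_zero_of_even (F : ℂ) {n : ℕ} (hn : Even n) (p : Fin n → Fin D → ℂ) :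
    current F n p = 0 := by
  induction n using Nat.strong_induction_on with
  | _ n ih =>
    rw [current, if_neg (by rintro rfl; simp at hn)]
    refine mul_eq_zero_of_right _ (Finset.sum_eq_zero fun c _ => ?_)
    exact vertexTerm_eq_zero_of_even F hn p (fun k hk he q => ih k hk he q) c

theorem amplitude_eq_zero_of_even (F : ℂ) {n : ℕ} (hn : Even n) (p : Fin n → Fin D → ℂ) :
    amplitude F p = 0 := by
  rw [amplitude, Finset.sum_eq_zero, mul_zero]
  exact fun c _ => vertexTerm_eq_zero_of_even F hn p
    (fun k _ he q => current_eq_zero_of_even F he q) c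

variable {L : Type*} {p : L → Fin D → ℂ}

/-- A propagator cancels unless it is singular. -/
theorem msq_mul_wordCurrent {F : ℂ} (w : List L) (h1 : w.length = 1 → msq (letterSum p w) = 0)
    (h3 : 3 ≤ w.length → Odd w.length → msq (letterSum p w) ≠ 0) :
    msq (letterSum p w) * wordCurrent F p w - wordAmplitude F p w = 0 := by
  unfold wordCurrent wordAmplitude
  by_cases he : Even w.length
  · rw [current_eq_zero_of_even F he, amplitude_eq_zero_of_even F he]; simp
  have ho := Nat.not_even_iff_odd.1 he
  by_cases hw : w.length = 1
  · rw [h1 hw, amplitude, Finset.sum_eq_zero]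
    · simp
    · intro c _
      have := c.1.length_le
      have := c.2
      omega
  · have h := h3 (by obtain ⟨k, hk⟩ := ho; omega) ho
    rw [current, if_neg hw, amplitude, ← letterSum_eq_sum_get]
    field_simp
    ring

end OnShell

/-! ### The lattice representation with its dual-number twist. -/

section Lattice

open Matrix

/-- `p_1 + ⋯ + p_i`. -/
def partialSum {V : Type*} [AddCommMonoid V] {n : ℕ} (p : Fin n → V) (i : ℕ) : V :=
  ∑ k : Fin n, if k.val < i then p k else 0

theorem partialSum_succ {V : Type*} [AddCommMonoid V] {n : ℕ} (p : Fin n → V) (i : Fin n) :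
    partialSum p (i + 1) = partialSum p i + p i := by
  unfold partialSum
  have : ∀ k : Fin n, (if k.val < i + 1 then p k else 0) =
      (if k.val < i then p k else 0) + if k = i then p k else 0 := by
    intro k
    rcases lt_trichotomy k.val i.val with h | h | h
    · simp [h, Nat.lt_succ_of_lt h, Fin.ext_iff, h.ne]
    · simp [Fin.ext_iff, h]
    · simp [Fin.ext_iff, h.ne', h.not_gt, Nat.not_lt.2 (Nat.succ_le_of_lt h)]
  rw [Finset.sum_congr rfl fun k _ => this k, Finset.sum_add_distrib]
  simp

theorem partialSum_zero {V : Type*} [AddCommMonoid V] {n : ℕ} (p : Fin n → V) :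
    partialSum p 0 = 0 := by simp [partialSum]

theorem partialSum_last {V : Type*} [AddCommMonoid V] {n : ℕ} (p : Fin n → V) :
    partialSum p n = ∑ k, p k := by simp [partialSum]

/-- The step matrix of the `i`-th of `n` ordered lines. -/
def stepMatrix {n : ℕ} (i : Fin n) : Matrix (Fin (n + 1)) (Fin (n + 1)) ℂ :=
  Matrix.single i.castSucc i.succ 1

theorem isStep_stepMatrix (n : ℕ) :
    IsStep (fun v : Fin (n + 1) => v.val) (fun i : Fin n => {v | i.succ ≤ v}) stepMatrix where
  upper i := fun v w hvw hv => le_trans hv hvw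
  step i v w h := by
    have : i.castSucc = v ∧ i.succ = w := by
      by_contra hne
      exact h (Matrix.single_apply_of_ne _ _ _ _ _ hne)
    obtain ⟨rfl, rfl⟩ := this
    refine ⟨Fin.castSucc_lt_succ.le, by simp, ?_, ?_⟩
    · simp
    · simp

/-- The commutator with a diagonal matrix multiplies an entry by the difference of the diagonal
values at its ends, and the partial sums before and after line `i` differ by `c i`. -/
theorem innerDer_stepMatrix {n : ℕ} (c : Fin n → ℂ) (i : Fin n) :
    innerDer (diagonal fun v : Fin (n + 1) => partialSum c v.val) (stepMatrix i) =
      c i • stepMatrix i := by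
  ext v w
  rw [innerDer_diagonal_apply, Matrix.smul_apply]
  by_cases h : i.castSucc = v ∧ i.succ = w
  · obtain ⟨rfl, rfl⟩ := h
    simp [partialSum_succ, stepMatrix]
  · simp [stepMatrix, Matrix.single_apply_of_ne _ _ _ _ _ h]

/-- `1 + z ε`. -/
def dualExp (z : ℂ) : DualNumber ℂ := 1 + TrivSqZeroExt.inr z

theorem dualExp_add (z w : ℂ) : dualExp (z + w) = dualExp z * dualExp w := by
  rw [dualExp, dualExp, dualExp, mul_add, mul_one, add_mul, one_mul, TrivSqZeroExt.inr_mul_inr,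
    TrivSqZeroExt.inr_add]
  abel

theorem dualExp_zero : dualExp 0 = 1 := by simp [dualExp]

variable {r s : ℕ}

/-- Lattice points: the numbers of lines `α` and `β` already used. -/
abbrev Lat (r s : ℕ) := Fin (r + 1) × Fin (s + 1)

/-- The number of lines already used. -/
def latDeg (v : Lat r s) : ℕ := v.1.val + v.2.val

/-- The action of the matrices of the lines `α` on the lattice. -/
def alphaHom (r s : ℕ) :
    Matrix (Fin (r + 1)) (Fin (r + 1)) ℂ →+* Matrix (Lat r s) (Lat r s) (DualNumber ℂ) where
  toFun f := Matrix.of fun v w => if v.2 = w.2 then algebraMap ℂ (DualNumber ℂ) (f v.1 w.1) else 0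
  map_one' := by
    ext1 v w
    by_cases h : v = w
    · subst h; simp
    · simp only [of_apply, one_apply_ne h]
      split_ifs with h2
      · rw [one_apply_ne fun h1 => h (Prod.ext h1 h2), map_zero]
      · rfl
  map_mul' f g := by
    ext1 v w
    simp only [of_apply, mul_apply, Fintype.sum_prod_type]
    have : ∀ i, ∑ j, (if v.2 = j then algebraMap ℂ (DualNumber ℂ) (f v.1 i) else 0) *
        (if j = w.2 then algebraMap ℂ (DualNumber ℂ) (g i w.1) else 0) =
        algebraMap ℂ (DualNumber ℂ) (f v.1 i) *
          if v.2 = w.2 then algebraMap ℂ (DualNumber ℂ) (g i w.1) else 0 := fun i => by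
      rw [Finset.sum_eq_single v.2 (fun j _ hj => by rw [if_neg hj.symm, zero_mul]) (by simp),
        if_pos rfl]
    rw [Finset.sum_congr rfl fun i _ => this i]
    split_ifs <;> simp [map_sum]
  map_zero' := by ext1 v w; simp
  map_add' f g := by
    ext1 v w
    simp only [of_apply, Matrix.add_apply]
    split_ifs <;> simp

/-- The action of the matrices of the lines `β` on the lattice, twisted by the weight `c`. -/
def betaHom (c : Lat r s → ℂ) :
    Matrix (Fin (s + 1)) (Fin (s + 1)) ℂ →+* Matrix (Lat r s) (Lat r s) (DualNumber ℂ) where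
  toFun f := Matrix.of fun v w =>
    if v.1 = w.1 then algebraMap ℂ (DualNumber ℂ) (f v.2 w.2) * dualExp (c w - c v) else 0
  map_one' := by
    ext1 v w
    by_cases h : v = w
    · subst h; simp [dualExp_zero]
    · simp only [of_apply, one_apply_ne h]
      split_ifs with h2
      · rw [one_apply_ne fun h1 => h (Prod.ext h2 h1), map_zero, zero_mul]
      · rfl
  map_mul' f g := by
    ext1 v w
    simp only [of_apply, mul_apply, Fintype.sum_prod_type_right]
    have : ∀ j, ∑ i, (if v.1 = i then algebraMap ℂ (DualNumber ℂ) (f v.2 j) *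
          dualExp (c (i, j) - c v) else 0) *
        (if i = w.1 then algebraMap ℂ (DualNumber ℂ) (g j w.2) * dualExp (c w - c (i, j)) else 0) =
        if v.1 = w.1 then algebraMap ℂ (DualNumber ℂ) (f v.2 j * g j w.2) * dualExp (c w - c v)
          else 0 := fun j => by
      -- The exponent of the twist is a difference of end-point values, so it telescopes along a
      -- path; this is why the twisted map is still multiplicative.
      have e : c w - c v = (c (v.1, j) - c v) + (c w - c (v.1, j)) := by ring
      rw [Finset.sum_eq_single v.1 (fun j _ hj => by rw [if_neg hj.symm, zero_mul]) (by simp),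
        if_pos rfl, e, dualExp_add, map_mul, mul_ite, mul_zero]
      congr 1; ring
    rw [Finset.sum_congr rfl fun i _ => this i]
    split_ifs <;> simp [map_sum, Finset.sum_mul]
  map_zero' := by ext1 v w; simp
  map_add' f g := by
    ext1 v w
    simp only [of_apply, Matrix.add_apply]
    split_ifs <;> simp [add_mul]

theorem alphaHom_apply (f : Matrix (Fin (r + 1)) (Fin (r + 1)) ℂ) (v w : Lat r s) :
    alphaHom r s f v w = if v.2 = w.2 then algebraMap ℂ (DualNumber ℂ) (f v.1 w.1) else 0 := rfl

theorem betaHom_apply (c : Lat r s → ℂ) (f : Matrix (Fin (s + 1)) (Fin (s + 1)) ℂ)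
    (v w : Lat r s) : betaHom c f v w =
      if v.1 = w.1 then algebraMap ℂ (DualNumber ℂ) (f v.2 w.2) * dualExp (c w - c v) else 0 := rfl

variable {D : ℕ} (p : Fin r ⊕ Fin s → Fin D → ℂ)

/-- The total momentum of the lines used at a lattice point. -/
def latMom (μ : Fin D) (v : Lat r s) : ℂ :=
  partialSum (fun i => p (Sum.inl i) μ) v.1.val + partialSum (fun j => p (Sum.inr j) μ) v.2.val

/-- `2 x_i · y_j` for the lattice point `(i, j)`. -/
noncomputable def latWeight (v : Lat r s) : ℂ :=
  2 * ∑ μ, (metricSign D μ : ℂ) *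
    (partialSum (fun i => p (Sum.inl i) μ) v.1.val * partialSum (fun j => p (Sum.inr j) μ) v.2.val)

theorem innerDer_alphaHom (μ : Fin D) (f : Matrix (Fin (r + 1)) (Fin (r + 1)) ℂ) :
    innerDer (diagonal fun v => algebraMap ℂ (DualNumber ℂ) (latMom p μ v)) (alphaHom r s f) =
      alphaHom r s (innerDer (diagonal fun i => partialSum (fun i => p (Sum.inl i) μ) i.val) f) := by
  ext1 v w
  rw [innerDer_diagonal_apply]
  simp only [alphaHom_apply, innerDer_diagonal_apply]
  split_ifs with h
  · rw [← map_sub, ← map_mul, latMom, latMom, h]; congr 1; ring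
  · simp

theorem innerDer_betaHom (c : Lat r s → ℂ) (μ : Fin D) (f : Matrix (Fin (s + 1)) (Fin (s + 1)) ℂ) :
    innerDer (diagonal fun v => algebraMap ℂ (DualNumber ℂ) (latMom p μ v)) (betaHom c f) =
      betaHom c (innerDer (diagonal fun i => partialSum (fun i => p (Sum.inr i) μ) i.val) f) := by
  ext1 v w
  rw [innerDer_diagonal_apply]
  simp only [betaHom_apply, innerDer_diagonal_apply]
  split_ifs with h
  · rw [mul_right_comm, ← map_sub, ← map_mul, latMom, latMom, h]; congr 2; ring
  · simp

/-- The lines `α` and `β` commute up to `2 ε ∂ · ∂`. -/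
theorem alphaHom_mul_betaHom_sub (f : Matrix (Fin (r + 1)) (Fin (r + 1)) ℂ)
    (g : Matrix (Fin (s + 1)) (Fin (s + 1)) ℂ) :
    alphaHom r s f * betaHom (latWeight p) g - betaHom (latWeight p) g * alphaHom r s f =
      algebraMap (DualNumber ℂ) (Matrix (Lat r s) (Lat r s) (DualNumber ℂ)) (TrivSqZeroExt.inr 2) *
        ∑ ν, metricSign D ν •
          (alphaHom r s (innerDer (diagonal fun i => partialSum (fun i => p (Sum.inl i) ν) i.val) f) *
          betaHom (latWeight p)
            (innerDer (diagonal fun i => partialSum (fun i => p (Sum.inr i) ν) i.val) g)) := by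
  have hab : ∀ (f : Matrix (Fin (r + 1)) (Fin (r + 1)) ℂ) (g : Matrix (Fin (s + 1)) (Fin (s + 1)) ℂ)
      v w, (alphaHom r s f * betaHom (latWeight p) g) v w =
        algebraMap ℂ (DualNumber ℂ) (f v.1 w.1 * g v.2 w.2) *
          dualExp (latWeight p w - latWeight p (w.1, v.2)) := by
    intro f g v w
    rw [mul_apply, Finset.sum_eq_single (w.1, v.2)]
    · rw [alphaHom_apply, if_pos rfl, betaHom_apply, if_pos rfl, map_mul, mul_assoc]
    · rintro ⟨i, j⟩ - hne
      rw [alphaHom_apply, betaHom_apply]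
      by_cases h1 : v.2 = j
      · rw [if_neg fun h2 : i = w.1 => hne (by rw [h1, ← h2]), mul_zero]
      · rw [if_neg h1, zero_mul]
    · simp
  -- The two orders go around the two sides of a rectangle. Their twists differ by the mixed second
  -- difference of `latWeight`, which is twice the product of the α-momentum and the β-momentum
  -- spanned by the rectangle.
  have hba : ∀ v w, (betaHom (latWeight p) g * alphaHom r s f) v w =
        algebraMap ℂ (DualNumber ℂ) (f v.1 w.1 * g v.2 w.2) *
          dualExp (latWeight p (v.1, w.2) - latWeight p v) := by
    intro v w
    rw [mul_apply, Finset.sum_eq_single (v.1, w.2)]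
    · rw [alphaHom_apply, if_pos rfl, betaHom_apply, if_pos rfl, map_mul]
      ring
    · rintro ⟨i, j⟩ - hne
      rw [alphaHom_apply, betaHom_apply]
      by_cases h1 : v.1 = i
      · rw [if_neg fun h2 : j = w.2 => hne (by rw [h1, ← h2]), mul_zero]
      · rw [if_neg h1, zero_mul]
    · simp
  have hx : ∀ z c, (TrivSqZeroExt.inr 2 : DualNumber ℂ) *
      (algebraMap ℂ (DualNumber ℂ) z * dualExp c) = TrivSqZeroExt.inr (2 * z) := by
    intro z c
    rw [dualExp, mul_add, mul_add, mul_one, mul_left_comm, TrivSqZeroExt.inr_mul_inr, mul_zero,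
      add_zero, mul_comm, ← Algebra.smul_def, ← TrivSqZeroExt.inr_smul, smul_eq_mul, mul_comm]
  ext1 v w
  rw [← Algebra.smul_def, Matrix.smul_apply, Matrix.sum_apply, Matrix.sub_apply, hab, hba,
    ← mul_sub, smul_eq_mul, Finset.mul_sum]
  have hsum : ∀ ν, (TrivSqZeroExt.inr 2 : DualNumber ℂ) * (metricSign D ν •
      (alphaHom r s (innerDer (diagonal fun i => partialSum (fun i => p (Sum.inl i) ν) i.val) f) *
          betaHom (latWeight p)
            (innerDer (diagonal fun i => partialSum (fun i => p (Sum.inr i) ν) i.val) g))) v w =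
      TrivSqZeroExt.inr ((metricSign D ν : ℂ) * (2 *
        (f v.1 w.1 * (partialSum (fun i => p (Sum.inl i) ν) w.1.val -
          partialSum (fun i => p (Sum.inl i) ν) v.1.val) *
        (g v.2 w.2 * (partialSum (fun i => p (Sum.inr i) ν) w.2.val -
          partialSum (fun i => p (Sum.inr i) ν) v.2.val))))) := by
    intro ν
    rw [Matrix.smul_apply, hab, mul_smul_comm, hx, innerDer_diagonal_apply, innerDer_diagonal_apply,
      ← Int.cast_smul_eq_zsmul ℂ, ← TrivSqZeroExt.inr_smul, smul_eq_mul]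
  rw [Finset.sum_congr rfl fun ν _ => hsum ν, ← TrivSqZeroExt.inr_sum]
  have hd : ∀ z w, dualExp z - dualExp w = TrivSqZeroExt.inr (z - w) := by
    intro z w
    rw [dualExp, dualExp, TrivSqZeroExt.inr_sub]; abel
  rw [hd, ← Algebra.smul_def, ← TrivSqZeroExt.inr_smul, smul_eq_mul]
  congr 1
  simp only [latWeight, Finset.mul_sum, ← Finset.sum_sub_distrib]
  refine Finset.sum_congr rfl fun ν _ => ?_
  ring

/-- The lattice step of a line. -/
noncomputable def latStep : Fin r ⊕ Fin s → Matrix (Lat r s) (Lat r s) (DualNumber ℂ)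
  | Sum.inl i => alphaHom r s (stepMatrix i)
  | Sum.inr j => betaHom (latWeight p) (stepMatrix j)

theorem isStep_latStep : IsStep latDeg
    (fun a : Fin r ⊕ Fin s => {v : Lat r s | Sum.elim (fun i => i.succ ≤ v.1) (fun j => j.succ ≤ v.2) a})
    (latStep p) where
  upper a := by
    intro v w hvw hv
    cases a with
    | inl i => exact le_trans hv hvw.1
    | inr j => exact le_trans hv hvw.2
  step a v w h := by
    cases a with
    | inl i =>
      simp only [latStep, alphaHom_apply] at h
      split_ifs at h with h2
      · have h3 := (isStep_stepMatrix r).step i v.1 w.1 fun h0 => h (by rw [h0, map_zero])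
        refine ⟨⟨h3.1, h2.le⟩, ?_, h3.2.2⟩
        have := h3.2.1
        simp only [latDeg, h2] at this ⊢
        omega
      · exact absurd rfl h
    | inr j =>
      simp only [latStep, betaHom_apply] at h
      split_ifs at h with h2
      · have h3 := (isStep_stepMatrix s).step j v.2 w.2 fun h0 => h (by rw [h0, map_zero, zero_mul])
        refine ⟨⟨h2.le, h3.1⟩, ?_, h3.2.2⟩
        have := h3.2.1
        simp only [latDeg, h2] at this ⊢
        omega
      · exact absurd rfl h

theorem alphaHom_smul (c : ℂ) (f : Matrix (Fin (r + 1)) (Fin (r + 1)) ℂ) :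
    alphaHom r s (c • f) = c • alphaHom r s f := by
  ext1 v w
  rw [Matrix.smul_apply, alphaHom_apply, alphaHom_apply]
  split_ifs with h
  · rw [Matrix.smul_apply, smul_eq_mul, map_mul, Algebra.smul_def]
  · simp

theorem betaHom_smul (e : Lat r s → ℂ) (c : ℂ) (f : Matrix (Fin (s + 1)) (Fin (s + 1)) ℂ) :
    betaHom e (c • f) = c • betaHom e f := by
  ext1 v w
  rw [Matrix.smul_apply, betaHom_apply, betaHom_apply]
  split_ifs with h
  · rw [Matrix.smul_apply, smul_eq_mul, map_mul, Algebra.smul_def, mul_assoc]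
  · simp

theorem innerDer_latStep (μ : Fin D) (a : Fin r ⊕ Fin s) :
    innerDer (diagonal fun v => algebraMap ℂ (DualNumber ℂ) (latMom p μ v)) (latStep p a) =
      p a μ • latStep p a := by
  cases a with
  | inl i => rw [latStep, innerDer_alphaHom, innerDer_stepMatrix, alphaHom_smul]
  | inr j => rw [latStep, innerDer_betaHom, innerDer_stepMatrix, betaHom_smul]

end Lattice

/-! ### Comparison of the current and the alternating words in top degree. -/

section Top

open Matrix

variable {r s D : ℕ} {p : Fin r ⊕ Fin s → Fin D → ℂ}

theorem Admissible.word (hp : Admissible p) {u : List (Fin r ⊕ Fin s)} (hu : u.Nodup)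
    (hlen : u.length < r + s) : (u.length = 1 → msq (letterSum p u) = 0) ∧
      (3 ≤ u.length → Odd u.length → msq (letterSum p u) ≠ 0) := by
  constructor
  · intro h
    obtain ⟨a, rfl⟩ := List.length_eq_one_iff.1 h
    simpa [letterSum] using hp.1 a
  · intro h3 ho
    have hcard : u.toFinset.card = u.length := List.toFinset_card_of_nodup hu
    have hsum : letterSum p u = ∑ a ∈ u.toFinset, p a := (List.sum_toFinset p hu).symm
    rw [hsum]
    refine hp.2 _ ?_ (by omega) (by rwa [hcard])
    intro huniv
    rw [huniv, Finset.card_univ, Fintype.card_sum, Fintype.card_fin, Fintype.card_fin] at hcard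
    omega

theorem Admissible.word_vanish (hp : Admissible p) (F : ℂ) {L : Type*} (e : L → Fin r ⊕ Fin s)
    (he : Function.Injective e) {u : List L} (hu : u.Nodup) (hlen : u.length < r + s) :
    msq (letterSum (fun a => p (e a)) u) * wordCurrent F (fun a => p (e a)) u -
      wordAmplitude F (fun a => p (e a)) u = 0 := by
  have h := hp.word (hu.map he) (by simpa using hlen)
  have hs : letterSum p (u.map e) = letterSum (fun a => p (e a)) u := by
    simp [letterSum, Function.comp_def]
  rw [hs, List.length_map] at h
  exact msq_mul_wordCurrent u h.1 h.2

/-- The generating matrix of the currents of ordered lines. -/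
noncomputable def lineCurrent (F lam : ℂ) {n : ℕ} (q : Fin n → Fin D → ℂ) :
    Matrix (Fin (n + 1)) (Fin (n + 1)) ℂ :=
  wordSum n stepMatrix fun u => lam * wordCurrent F q u

theorem raises_lineCurrent (F lam : ℂ) {n : ℕ} (q : Fin n → Fin D → ℂ) :
    Raises (fun v : Fin (n + 1) => v.val) 1 (lineCurrent F lam q) :=
  (isStep_stepMatrix n).raises_wordSum (by simp [wordCurrent_nil]) n

theorem hasParity_lineCurrent (F lam : ℂ) {n : ℕ} (q : Fin n → Fin D → ℂ) :
    HasParity (fun v : Fin (n + 1) => v.val) 1 (lineCurrent F lam q) :=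
  (isStep_stepMatrix n).hasParity_wordSum (fun u hu => by
    rw [wordCurrent, current_eq_zero_of_even F (Nat.even_iff.2 hu), mul_zero]) n

/-- As `n < r + s`, every contributing word is a proper subset of the lines, so the source vanishes
even in the highest degree of this matrix. -/
theorem fieldEq_lineCurrent {F lam : ℂ} (hlam : lam ^ 2 = -(1 / (2 * F ^ 2))) (hp : Admissible p)
    {n : ℕ} (hn : n < r + s) {e : Fin n → Fin r ⊕ Fin s} (he : Function.Injective e)
    {R S : Matrix (Fin (n + 1)) (Fin (n + 1)) ℂ}
    (hR : (1 - lineCurrent F lam fun i => p (e i)) * R = 1)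
    (hR' : R * (1 - lineCurrent F lam fun i => p (e i)) = 1)
    (hS : (1 + lineCurrent F lam fun i => p (e i)) * S = 1)
    (hS' : S * (1 + lineCurrent F lam fun i => p (e i)) = 1) :
    fieldEq (metricSign D)
      (fun μ => diagonal fun v : Fin (n + 1) => partialSum (fun i => p (e i) μ) v.val)
      (lineCurrent F lam fun i => p (e i)) (R - S) = 0 := by
  have hN : ∀ v : Fin (n + 1), v.val ≤ n := fun v => by omega
  rw [fieldEq_wordSum hlam (fun i => p (e i)) ((isStep_stepMatrix n).wordProd_eq_zero hN)
    (fun μ a => innerDer_stepMatrix (fun i => p (e i) μ) a)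
    (Y := lineCurrent F lam fun i => p (e i)) rfl hR hR' hS hS']
  have : wordSum n stepMatrix (fun w => lam * (msq (letterSum (fun i => p (e i)) w) *
      wordCurrent F (fun i => p (e i)) w - wordAmplitude F (fun i => p (e i)) w)) = 0 := by
    ext v w
    refine (isStep_stepMatrix n).wordSum_apply_eq_zero n fun u h1 h2 h3 => ?_
    rw [hp.word_vanish F e he h3 (by have := hN w; have h2 : w.val = v.val + u.length := h2; omega), mul_zero]
  rw [this]; simp

theorem Raises.alphaHom {d : ℕ} {f : Matrix (Fin (r + 1)) (Fin (r + 1)) ℂ}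
    (hf : Raises (fun v : Fin (r + 1) => v.val) d f) : Raises latDeg d (alphaHom r s f) := by
  intro v w h
  rw [alphaHom_apply]
  split_ifs with h2
  · rw [hf, map_zero]
    intro h1
    refine h ⟨⟨h1.1, h2.le⟩, ?_⟩
    simp only [latDeg, h2]
    have : v.1.val + d ≤ w.1.val := h1.2
    omega
  · rfl

theorem Raises.betaHom (c : Lat r s → ℂ) {d : ℕ} {f : Matrix (Fin (s + 1)) (Fin (s + 1)) ℂ}
    (hf : Raises (fun v : Fin (s + 1) => v.val) d f) : Raises latDeg d (betaHom c f) := by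
  intro v w h
  rw [betaHom_apply]
  split_ifs with h2
  · rw [hf, map_zero, zero_mul]
    intro h1
    refine h ⟨⟨h2.le, h1.1⟩, ?_⟩
    simp only [latDeg, h2]
    have : v.2.val + d ≤ w.2.val := h1.2
    omega
  · rfl

theorem HasParity.alphaHom {d : ℕ} {f : Matrix (Fin (r + 1)) (Fin (r + 1)) ℂ}
    (hf : HasParity (fun v : Fin (r + 1) => v.val) d f) : HasParity latDeg d (alphaHom r s f) := by
  intro v w h
  rw [alphaHom_apply]
  split_ifs with h2
  · rw [hf, map_zero]
    simp only [latDeg, h2] at h ⊢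
    omega
  · rfl

theorem HasParity.betaHom (c : Lat r s → ℂ) {d : ℕ} {f : Matrix (Fin (s + 1)) (Fin (s + 1)) ℂ}
    (hf : HasParity (fun v : Fin (s + 1) => v.val) d f) : HasParity latDeg d (betaHom c f) := by
  intro v w h
  rw [betaHom_apply]
  split_ifs with h2
  · rw [hf, map_zero, zero_mul]
    simp only [latDeg, h2] at h ⊢
    omega
  · rfl

theorem partialSum_sub_partialSum {n : ℕ} (c : Fin n → ℂ) {k l : ℕ} (hkl : k ≤ l) :
    partialSum c l - partialSum c k =
      ∑ i ∈ Finset.univ.filter (fun i : Fin n => k ≤ i.val ∧ i.val < l), c i := by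
  unfold partialSum
  rw [← Finset.sum_sub_distrib, Finset.sum_filter]
  refine Finset.sum_congr rfl fun i _ => ?_
  by_cases h1 : i.val < k
  · rw [if_pos (by omega), if_pos h1, if_neg (by omega), sub_self]
  · by_cases h2 : i.val < l
    · rw [if_pos h2, if_neg h1, if_pos (by omega), sub_zero]
    · rw [if_neg h2, if_neg h1, if_neg (by omega), sub_zero]

theorem card_filter_le_lt {n k l : ℕ} (hln : l ≤ n) :
    (Finset.univ.filter fun i : Fin n => k ≤ i.val ∧ i.val < l).card = l - k := by
  rw [← Nat.card_Ico, ← Finset.card_map Fin.valEmbedding]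
  congr 1
  ext i
  simp only [Finset.mem_map, Finset.mem_filter, Finset.mem_univ, true_and, Fin.valEmbedding_apply,
    Finset.mem_Ico]
  constructor
  · rintro ⟨a, ha, rfl⟩; exact ha
  · intro hi; exact ⟨⟨i, by omega⟩, hi, rfl⟩

/-- The momentum between two lattice points is that of the lines used in between, a proper subset
with an odd number of at least three elements. -/
theorem Admissible.msq_lat_ne_zero (hp : Admissible p) {v w : Lat r s} (h : v ≤ w)
    (h1 : latDeg w < latDeg v + (r + s)) (h3 : latDeg v + 3 ≤ latDeg w)
    (ho : Odd (latDeg w - latDeg v)) :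
    msq (fun μ => latMom p μ w - latMom p μ v) ≠ 0 := by
  have hvw1 : v.1.val ≤ w.1.val := h.1
  have hvw2 : v.2.val ≤ w.2.val := h.2
  set T : Finset (Fin r ⊕ Fin s) :=
    (Finset.univ.filter fun i : Fin r => v.1.val ≤ i.val ∧ i.val < w.1.val).disjSum
    (Finset.univ.filter fun j : Fin s => v.2.val ≤ j.val ∧ j.val < w.2.val) with hT
  have hsum : (fun μ => latMom p μ w - latMom p μ v) = ∑ a ∈ T, p a := by
    funext μ
    rw [hT, Finset.sum_disjSum, Pi.add_apply, Finset.sum_apply, Finset.sum_apply,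
      ← partialSum_sub_partialSum (fun i => p (Sum.inl i) μ) hvw1,
      ← partialSum_sub_partialSum (fun i => p (Sum.inr i) μ) hvw2, latMom, latMom]
    ring
  have hcard : T.card = latDeg w - latDeg v := by
    rw [hT, Finset.card_disjSum, card_filter_le_lt (by omega), card_filter_le_lt (by omega)]
    simp only [latDeg]; omega
  rw [hsum]
  refine hp.2 T ?_ (by omega) (by rwa [hcard])
  intro hT'
  rw [hT', Finset.card_univ, Fintype.card_sum, Fintype.card_fin, Fintype.card_fin] at hcard
  omega

theorem wordCurrent_singleton {L : Type*} (F : ℂ) (q : L → Fin D → ℂ) (a : L) :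
    wordCurrent F q [a] = 1 := by
  unfold wordCurrent
  rw [current]
  simp

/-- The signed sum `a - aba + ababa - ⋯ + b - bab + babab - ⋯` of alternating words. -/
def alternatingWords {M : Type*} [Ring M] (N : ℕ) (a b : M) : M :=
  a * ∑ k ∈ Finset.range (N + 1), (-(b * a)) ^ k + b * ∑ k ∈ Finset.range (N + 1), (-(a * b)) ^ k

/-- The weighted sum of the amplitudes of all shuffles in terms of alternating words. -/
theorem wordSum_amplitude_top {F lam : ℂ} (hlam : lam ^ 2 = -(1 / (2 * F ^ 2)))
    (hp : Admissible p) (hr : 0 < r) (hs : 0 < s) :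
    wordSum (r + s) (latStep p) (fun u => lam * wordAmplitude F p u) (0, 0) (Fin.last r, Fin.last s) =
      algebraMap ℂ (DualNumber ℂ) (msq (∑ a, p a)) *
        alternatingWords (r + s) (alphaHom r s (lineCurrent F lam fun i => p (Sum.inl i)))
          (betaHom (latWeight p) (lineCurrent F lam fun j => p (Sum.inr j)))
          (0, 0) (Fin.last r, Fin.last s) := by
  have hN : ∀ v : Lat r s, latDeg v ≤ r + s := fun v => by simp only [latDeg]; omega
  set a := lineCurrent F lam fun i => p (Sum.inl i) with ha
  set b := lineCurrent F lam fun j => p (Sum.inr j) with hb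
  set A := alphaHom r s a with hA
  set B := betaHom (latWeight p) b with hB
  have rA : Raises latDeg 1 A := (raises_lineCurrent F lam _).alphaHom
  have rB : Raises latDeg 1 B := (raises_lineCurrent F lam _).betaHom _
  have pA : HasParity latDeg 1 A := (hasParity_lineCurrent F lam _).alphaHom
  have pB : HasParity latDeg 1 B := (hasParity_lineCurrent F lam _).betaHom _
  have geom : ∀ x : Matrix (Lat r s) (Lat r s) (DualNumber ℂ), Raises latDeg 1 x →
      (1 + x) * ∑ k ∈ Finset.range (r + s + 1), (-x) ^ k = 1 ∧
      (∑ k ∈ Finset.range (r + s + 1), (-x) ^ k) * (1 + x) = 1 ∧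
      Raises latDeg 0 (∑ k ∈ Finset.range (r + s + 1), (-x) ^ k) := by
    intro x hx
    have h0 : (-x) ^ (r + s + 1) = 0 := (hx.neg.pow _).eq_zero hN (by omega)
    refine ⟨?_, ?_, Raises.sum fun k _ => (hx.neg.pow k).mono (Nat.zero_le _)⟩
    · have := mul_neg_geom_sum (-x) (r + s + 1)
      rwa [h0, sub_zero, sub_neg_eq_add] at this
    · have := geom_sum_mul_neg (-x) (r + s + 1)
      rwa [h0, sub_zero, sub_neg_eq_add] at this
  have rAB : Raises latDeg 2 (A * B) := rA.mul rB
  have rBA : Raises latDeg 2 (B * A) := rB.mul rA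
  obtain ⟨hG, hG', rG⟩ := geom _ (rAB.mono one_le_two)
  obtain ⟨hH, hH', rH⟩ := geom _ (rBA.mono one_le_two)
  unfold alternatingWords
  set G := ∑ k ∈ Finset.range (r + s + 1), (-(A * B)) ^ k
  set H := ∑ k ∈ Finset.range (r + s + 1), (-(B * A)) ^ k
  set W := A * H + B * G with hW
  have rW : Raises latDeg 1 W := Raises.add (by simpa using rA.mul rH) (by simpa using rB.mul rG)
  have pG : HasParity latDeg 0 G :=
    HasParity.inverse hN (rAB.mono one_le_two) ((pA.mul pB).mod rfl) hG'
  have pH : HasParity latDeg 0 H :=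
    HasParity.inverse hN (rBA.mono one_le_two) ((pB.mul pA).mod rfl) hH'
  have pW : HasParity latDeg 1 W := (pA.mul pH).add (pB.mul pG)
  obtain ⟨ma, -, hma, hma'⟩ :=
    (raises_lineCurrent F lam fun i => p (Sum.inl i)).exists_resolvent (N := r) (fun v => by omega)
  obtain ⟨pa, -, hpa, hpa'⟩ :=
    (raises_lineCurrent F lam fun i => p (Sum.inl i)).exists_resolvent' (N := r) (fun v => by omega)
  obtain ⟨mb, -, hmb, hmb'⟩ :=
    (raises_lineCurrent F lam fun i => p (Sum.inr i)).exists_resolvent (N := s) (fun v => by omega)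
  obtain ⟨pb, -, hpb, hpb'⟩ :=
    (raises_lineCurrent F lam fun i => p (Sum.inr i)).exists_resolvent' (N := s) (fun v => by omega)
  obtain ⟨mW, rmW, hmW, hmW'⟩ := rW.exists_resolvent hN
  obtain ⟨pW', rpW, hpW, hpW'⟩ := rW.exists_resolvent' hN
  set Q : Fin D → Matrix (Lat r s) (Lat r s) (DualNumber ℂ) := fun μ =>
    diagonal fun v => algebraMap ℂ (DualNumber ℂ) (latMom p μ v) with hQ
  have diag_comm : ∀ {n : ℕ} (x y : Fin (n + 1) → ℂ), diagonal x * diagonal y =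
      diagonal y * diagonal x := by
    intro n x y
    rw [diagonal_mul_diagonal, diagonal_mul_diagonal]
    congr 1; funext i; ring
  have fW : fieldEq (metricSign D) Q W (mW - pW') = 0 :=
    fieldEq_alternating (metricSign D)
      (fun μ => diagonal fun v : Fin (r + 1) => partialSum (fun i => p (Sum.inl i) μ) v.val)
      (fun μ => diagonal fun v : Fin (s + 1) => partialSum (fun i => p (Sum.inr i) μ) v.val)
      Q (alphaHom r s) (betaHom (latWeight p))
      (algebraMap (DualNumber ℂ) _ (TrivSqZeroExt.inr 2))
      (fun x => Algebra.commutes _ x) (by rw [← map_mul, TrivSqZeroExt.inr_mul_inr, map_zero])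
      (fun μ ν => diag_comm _ _) (fun μ ν => diag_comm _ _)
      (fun μ x => innerDer_alphaHom p μ x) (fun μ x => innerDer_betaHom p _ μ x)
      (fun x y => alphaHom_mul_betaHom_sub p x y)
      hma hma' hpa hpa' hmb hmb' hpb hpb'
      (fieldEq_lineCurrent hlam hp (by omega) Sum.inl_injective hma hma' hpa hpa')
      (fieldEq_lineCurrent hlam hp (by omega) Sum.inr_injective hmb hmb' hpb hpb')
      hG hG' hH hH' hmW' hpW'
  have st := isStep_latStep p
  set Y := wordSum (r + s) (latStep p) (fun u => lam * wordCurrent F p u) with hY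
  have hJ0 : (fun u => lam * wordCurrent F p u) [] = 0 := by simp [wordCurrent_nil]
  have rY : Raises latDeg 1 Y := st.raises_wordSum hJ0 _
  have pY : HasParity latDeg 1 Y := st.hasParity_wordSum (fun u hu => by
    rw [wordCurrent, current_eq_zero_of_even F (Nat.even_iff.2 hu), mul_zero]) _
  obtain ⟨mY, rmY, hmY, hmY'⟩ := rY.exists_resolvent hN
  obtain ⟨pY', rpY, hpY, hpY'⟩ := rY.exists_resolvent' hN
  have fY := fieldEq_wordSum hlam p (st.wordProd_eq_zero hN) (q := Q)
    (fun μ x => innerDer_latStep p μ x) hY hmY hmY' hpY hpY'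
  set Θ := wordSum (r + s) (latStep p) (fun w =>
      lam * (msq (letterSum p w) * wordCurrent F p w - wordAmplitude F p w)) with hΘ
  have rΘ : Raises latDeg (r + s) Θ := by
    intro v w hvw
    refine st.wordSum_apply_eq_zero _ fun u h1 h2 h3 => ?_
    have := hp.word_vanish F id Function.injective_id h3
      (by by_contra hlt; exact hvw ⟨h1, by omega⟩)
    simp only [id] at this
    rw [this, mul_zero]
  have hT : (1 - Y * Y) * Θ * (1 - Y * Y) = Θ := by
    have z1 : Y * Θ = 0 := (rY.mul rΘ).eq_zero hN (by omega)
    have z2 : Θ * Y = 0 := (rΘ.mul rY).eq_zero hN (by omega)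
    calc _ = Θ - Y * (Y * Θ) - (Θ * Y) * Y + Y * (Y * Θ) * (Y * Y) := by noncomm_ring
      _ = Θ := by rw [z1, z2]; simp
  rw [hT] at fY
  have hmsq : ∀ v w : Lat r s, (∑ μ, metricSign D μ •
      (algebraMap ℂ (DualNumber ℂ) (latMom p μ w) - algebraMap ℂ (DualNumber ℂ) (latMom p μ v)) ^ 2) =
      algebraMap ℂ (DualNumber ℂ) (msq fun μ => latMom p μ w - latMom p μ v) := by
    intro v w
    rw [msq_eq_sum, map_sum]
    refine Finset.sum_congr rfl fun μ _ => ?_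
    rw [map_mul, map_pow, map_sub, map_intCast, zsmul_eq_mul]
  have hone : ∀ v w : Lat r s, latDeg w = latDeg v + 1 → Y v w = W v w := by
    intro v w hvw
    have h2 : ∀ {f g : Matrix (Lat r s) (Lat r s) (DualNumber ℂ)}, Raises latDeg 2 (f - g) →
        f v w = g v w := by
      intro f g h
      rw [← sub_eq_zero]
      exact h v w fun h' => by have := h'.2; omega
    have y1 : Y v w = (∑ a, (lam * wordCurrent F p [a]) • latStep p a) v w :=
      h2 (st.raises_wordSum_sub (f := fun u => lam * wordCurrent F p u) hJ0 (N := r + s) (by omega))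
    have a1 : A v w = (∑ i : Fin r, lam • latStep p (Sum.inl i)) v w := by
      refine h2 ?_
      have := ((isStep_stepMatrix r).raises_wordSum_sub
        (f := fun u => lam * wordCurrent F (fun i => p (Sum.inl i)) u)
        (by simp [wordCurrent_nil]) (N := r) hr).alphaHom (s := s)
      rw [map_sub, map_sum] at this
      simp only [alphaHom_smul, wordCurrent_singleton, mul_one] at this
      exact this
    have b1 : B v w = (∑ j : Fin s, lam • latStep p (Sum.inr j)) v w := by
      refine h2 ?_
      have := ((isStep_stepMatrix s).raises_wordSum_sub
        (f := fun u => lam * wordCurrent F (fun i => p (Sum.inr i)) u)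
        (by simp [wordCurrent_nil]) (N := s) hs).betaHom (latWeight p)
      rw [map_sub, map_sum] at this
      simp only [betaHom_smul, wordCurrent_singleton, mul_one] at this
      exact this
    have w1 : W v w = (A + B) v w := by
      refine h2 ?_
      have : W - (A + B) = -(A * (B * A) * H) - B * (A * B) * G := by
        calc W - (A + B) = A * H - A * ((1 + B * A) * H) + (B * G - B * ((1 + A * B) * G)) := by
              rw [hH, hG, hW]; noncomm_ring
          _ = _ := by noncomm_ring
      rw [this]
      refine Raises.sub (Raises.neg ?_) ?_
      · exact ((rA.mul rBA).mul rH).mono (by omega)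
      · exact ((rB.mul rAB).mul rG).mono (by omega)
    rw [y1, w1, Matrix.add_apply, a1, b1, Fintype.sum_sum_type, Matrix.add_apply]
    simp only [wordCurrent_singleton, mul_one]
  have main := apply_eq_of_fieldEq hN rY rW rmY hmY' rpY hpY' rmW hmW rpW hpW rΘ fY fW (by
    intro v w hvw hlt
    rw [hmsq]
    have hle : latDeg v ≤ latDeg w := by
      have h1 : v.1.val ≤ w.1.val := hvw.1
      have h2 : v.2.val ≤ w.2.val := hvw.2
      simp only [latDeg]; omega
    by_cases hpar : (latDeg v + latDeg w + 1) % 2 = 0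
    · by_cases hd : latDeg w = latDeg v + 1
      · exact Or.inr (hone v w hd)
      · left
        intro z hz
        rw [← Algebra.smul_def, smul_eq_zero] at hz
        refine hz.resolve_left (hp.msq_lat_ne_zero hvw hlt (by omega) ?_)
        rw [Nat.odd_iff]; omega
    · right
      rw [pY v w hpar, pW v w hpar]) (0, 0) (Fin.last r, Fin.last s)
  have hbox : wordSum (r + s) (latStep p) (fun w => lam * (msq (letterSum p w) * wordCurrent F p w))
      (0, 0) (Fin.last r, Fin.last s) = algebraMap ℂ (DualNumber ℂ)
        (msq fun μ => latMom p μ (Fin.last r, Fin.last s) - latMom p μ (0, 0)) *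
        Y (0, 0) (Fin.last r, Fin.last s) := by
    have hfun : (fun w => lam * (msq (letterSum p w) * wordCurrent F p w)) = fun w =>
        ∑ μ, (metricSign D μ : ℂ) * (letterSum (fun a => p a μ) w * (letterSum (fun a => p a μ) w *
          (lam * wordCurrent F p w))) := by
      funext w
      rw [msq_eq_sum, Finset.sum_mul, Finset.mul_sum]
      refine Finset.sum_congr rfl fun μ _ => ?_
      have : letterSum p w μ = letterSum (fun a => p a μ) w := by
        simp [letterSum_eq_sum_get, Finset.sum_apply]
      rw [this]; ring
    rw [hfun, wordSum_sum, Matrix.sum_apply, ← hmsq, Finset.sum_mul]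
    refine Finset.sum_congr rfl fun μ _ => ?_
    rw [wordSum_mul, ← innerDer_wordSum (q := Q μ) (fun x => innerDer_latStep p μ x),
      ← innerDer_wordSum (q := Q μ) (fun x => innerDer_latStep p μ x), Matrix.smul_apply, hQ,
      innerDer_diagonal_apply, innerDer_diagonal_apply, Int.cast_smul_eq_zsmul, smul_mul_assoc]
    congr 1; ring
  have hdec : Θ = wordSum (r + s) (latStep p)
        (fun w => lam * (msq (letterSum p w) * wordCurrent F p w)) +
      (-1 : ℂ) • wordSum (r + s) (latStep p) (fun u => lam * wordAmplitude F p u) := by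
    rw [← wordSum_mul, ← wordSum_add, hΘ]
    congr 1; funext w; ring
  have htop : (fun μ => latMom p μ (Fin.last r, Fin.last s) - latMom p μ (0, 0)) = ∑ a, p a := by
    funext μ
    simp [latMom, partialSum_zero, partialSum_last, Finset.sum_apply]
  rw [hdec, Matrix.add_apply, hbox, hmsq, htop, Matrix.smul_apply, neg_smul, one_smul] at main
  linear_combination -main

end Top

section Shuffles

open Matrix

/-- The letters of a contributing word are ordered compatibly with their upper sets. -/
theorem IsStep.pairwise_of_ne_zero {L I R : Type*} [Fintype I] [DecidableEq I] [Preorder I]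
    [CommRing R] {deg : I → ℕ} {S : L → Set I} {m : L → Matrix I I R} (h : IsStep deg S m)
    {u : List L} {v w : I} (hu : wordProd m u v w ≠ 0) :
    u.Pairwise fun a b => ¬S a ⊆ S b := by
  induction u generalizing v with
  | nil => exact List.Pairwise.nil
  | cons a u ih =>
    have e : wordProd m (a :: u) = m a * wordProd m u := by simp [wordProd]
    rw [e, Matrix.mul_apply] at hu
    obtain ⟨x, -, hx⟩ := Finset.exists_ne_zero_of_sum_ne_zero hu
    have hw := right_ne_zero_of_mul hx
    refine List.pairwise_cons.2 ⟨fun b hb hab => ?_, ih hw⟩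
    exact (h.wordProd_apply_ne_zero hw).2.2.2 b hb
      (hab (h.step a v x (left_ne_zero_of_mul hx)).2.2.2)

/-- A product of matrices along a path that they determine. -/
theorem wordProd_apply_of_path {L I R : Type*} [Fintype I] [DecidableEq I] [CommRing R]
    {m : L → Matrix I I R} {n : ℕ} (u : Fin n → L) (pt : ℕ → I) (c : Fin n → R)
    (h : ∀ (k : Fin n) (x : I), m (u k) (pt k) x = if x = pt (k + 1) then c k else 0) (x : I) :
    wordProd m (List.ofFn u) (pt 0) x = if x = pt n then ∏ k, c k else 0 := by
  induction n generalizing pt with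
  | zero =>
    rw [List.ofFn_zero, wordProd, List.map_nil, List.prod_nil, Fin.prod_univ_zero, Matrix.one_apply]
    exact if_congr eq_comm rfl rfl
  | succ n ih =>
    have e : wordProd m (List.ofFn u) = m (u 0) * wordProd m (List.ofFn fun k : Fin n => u k.succ) := by
      rw [List.ofFn_succ]; simp [wordProd]
    rw [e, Matrix.mul_apply, Finset.sum_eq_single (pt 1)]
    · rw [ih (fun k => u k.succ) (fun k => pt (k + 1)) (fun k => c k.succ)
        (fun k x => by simpa using h k.succ x), Fin.prod_univ_succ]
      have := h 0 (pt 1)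
      simp only [Fin.val_zero, zero_add, if_true] at this
      rw [this, mul_ite, mul_zero]
    · intro y _ hy
      have := h 0 y
      simp only [Fin.val_zero, zero_add] at this
      rw [this, if_neg hy, zero_mul]
    · simp

/-- The number of `i` with `f i < k`. -/
def initCount {n N : ℕ} (f : Fin n → Fin N) (k : ℕ) : Fin (n + 1) :=
  ⟨(Finset.univ.filter fun i => (f i).val < k).card,
    Nat.lt_succ_of_le ((Finset.card_filter_le _ _).trans (by simp))⟩

theorem lt_initCount {n N : ℕ} {f : Fin n → Fin N} (hf : StrictMono f) (i : Fin n) (k : ℕ) :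
    i.val < (initCount f k).val ↔ (f i).val < k := by
  unfold initCount
  constructor
  · intro h
    by_contra hk
    have : (Finset.univ.filter fun i => (f i).val < k) ⊆ Finset.Iio i := by
      intro i' hi'
      rw [Finset.mem_filter] at hi'
      rw [Finset.mem_Iio, ← hf.lt_iff_lt, Fin.lt_def]
      omega
    have := Finset.card_le_card this
    rw [Fin.card_Iio] at this
    simp only at h
    omega
  · intro h
    have : Finset.Iic i ⊆ (Finset.univ.filter fun i => (f i).val < k) := by
      intro i' hi'
      rw [Finset.mem_Iic, ← hf.le_iff_le, Fin.le_def] at hi'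
      rw [Finset.mem_filter]
      exact ⟨Finset.mem_univ _, by omega⟩
    have := Finset.card_le_card this
    rw [Fin.card_Iic] at this
    simp only
    omega

theorem initCount_apply {n N : ℕ} {f : Fin n → Fin N} (hf : StrictMono f) (i : Fin n) :
    initCount f (f i) = i.castSucc := by
  ext
  have h1 := (lt_initCount hf i (f i)).not.2 (lt_irrefl _)
  rcases Nat.eq_zero_or_pos i.val with h0 | h0
  · simp only [Fin.val_castSucc]
    by_contra hne
    omega
  · have h2 := (lt_initCount hf ⟨i.val - 1, by omega⟩ (f i)).2
      (hf (show (⟨i.val - 1, by omega⟩ : Fin n) < i from Fin.lt_def.2 (by simp; omega)))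
    simp only at h2
    simp only [Fin.val_castSucc]
    omega

theorem initCount_apply_succ {n N : ℕ} {f : Fin n → Fin N} (hf : StrictMono f) (i : Fin n) :
    initCount f (f i + 1) = i.succ := by
  ext
  have h1 := (lt_initCount hf i (f i + 1)).2 (Nat.lt_succ_self _)
  by_cases h0 : i.val + 1 < n
  · have h2 := (lt_initCount hf ⟨i.val + 1, h0⟩ (f i + 1)).not.2
      (by
        have := hf (show i < (⟨i.val + 1, h0⟩ : Fin n) from Fin.lt_def.2 (by simp))
        rw [Fin.lt_def] at this; omega)
    simp only at h2
    simp only [Fin.val_succ]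
    omega
  · have := (initCount f (f i + 1)).isLt
    simp only [Fin.val_succ]
    omega

theorem initCount_succ_of_ne {n N : ℕ} {f : Fin n → Fin N} {k : ℕ} (h : ∀ i, (f i).val ≠ k) :
    initCount f (k + 1) = initCount f k := by
  ext
  simp only [initCount]
  congr 1
  refine Finset.filter_congr fun i _ => ?_
  have := h i
  omega

theorem initCount_zero {n N : ℕ} (f : Fin n → Fin N) : initCount f 0 = 0 := by
  ext; simp [initCount]

theorem initCount_top {n N : ℕ} (f : Fin n → Fin N) : initCount f N = Fin.last n := by
  ext; simp [initCount]

variable {r s D : ℕ} (p : Fin r ⊕ Fin s → Fin D → ℂ)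

theorem latStep_inl (i : Fin r) (j : Fin (s + 1)) (x : Lat r s) :
    latStep p (Sum.inl i) (i.castSucc, j) x = if x = (i.succ, j) then 1 else 0 := by
  rw [latStep, alphaHom_apply, stepMatrix]
  obtain ⟨x1, x2⟩ := x
  by_cases h : x1 = i.succ
  · subst h
    by_cases h2 : j = x2
    · subst h2; simp
    · rw [if_neg h2, if_neg fun h => h2 (Prod.ext_iff.1 h).2.symm]
  · rw [Matrix.single_apply_of_ne _ _ _ _ _ fun h' => h h'.2.symm,
      if_neg fun h' => h (Prod.ext_iff.1 h').1]
    simp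

theorem latStep_inr (i : Fin (r + 1)) (j : Fin s) (x : Lat r s) :
    latStep p (Sum.inr j) (i, j.castSucc) x = if x = (i, j.succ) then
      dualExp (latWeight p (i, j.succ) - latWeight p (i, j.castSucc)) else 0 := by
  rw [latStep, betaHom_apply, stepMatrix]
  obtain ⟨x1, x2⟩ := x
  by_cases h : x2 = j.succ
  · subst h
    by_cases h2 : i = x1
    · subst h2; simp
    · rw [if_neg h2, if_neg fun h => h2 (Prod.ext_iff.1 h).1.symm]
  · rw [Matrix.single_apply_of_ne _ _ _ _ _ fun h' => h h'.2.symm,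
      if_neg fun h' => h (Prod.ext_iff.1 h').2]
    simp

theorem latWeight_succ_sub (i : Fin (r + 1)) (j : Fin s) :
    latWeight p (i, j.succ) - latWeight p (i, j.castSucc) =
      ∑ i' : Fin r, if i'.val < i.val then mandelstam p (Sum.inl i') (Sum.inr j) else 0 := by
  simp only [latWeight, Fin.val_succ, Fin.val_castSucc, partialSum_succ, mandelstam, mdot_eq_sum]
  rw [← mul_sub, ← Finset.sum_sub_distrib]
  simp only [partialSum]
  have : ∀ i' : Fin r, (if i'.val < i.val then 2 * ∑ μ, (metricSign D μ : ℂ) *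
      (p (Sum.inl i') μ * p (Sum.inr j) μ) else 0) =
      2 * ∑ μ, (metricSign D μ : ℂ) * ((if i'.val < i.val then p (Sum.inl i') μ else 0) *
        p (Sum.inr j) μ) := by
    intro i'
    split_ifs <;> simp
  rw [Finset.sum_congr rfl fun i' _ => this i', ← Finset.mul_sum, Finset.sum_comm]
  congr 1
  refine Finset.sum_congr rfl fun μ _ => ?_
  rw [← Finset.mul_sum, ← Finset.sum_mul]
  ring

theorem dualExp_sum {κ : Type*} (t : Finset κ) (f : κ → ℂ) :
    dualExp (∑ k ∈ t, f k) = ∏ k ∈ t, dualExp (f k) := by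
  classical
  induction t using Finset.induction_on with
  | empty => simp [dualExp_zero]
  | insert a t ha ih => rw [Finset.sum_insert ha, Finset.prod_insert ha, dualExp_add, ih]

/-- The weight of a shuffle. -/
theorem wordProd_latStep_shuffle {ξ : (Fin r ⊕ Fin s) ≃ Fin (r + s)} (hξ : ξ ∈ orderedPerms r s) :
    wordProd (latStep p) (List.ofFn ξ.symm) (0, 0) (Fin.last r, Fin.last s) =
      dualExp (∑ i, ∑ j, if ξ (Sum.inl i) < ξ (Sum.inr j) then
        mandelstam p (Sum.inl i) (Sum.inr j) else 0) := by
  obtain ⟨h1, h2⟩ := (Finset.mem_filter.1 hξ).2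
  have := wordProd_apply_of_path (m := latStep p) (ξ.symm : Fin (r + s) → Fin r ⊕ Fin s)
    (fun k => (initCount (fun i => ξ (Sum.inl i)) k, initCount (fun j => ξ (Sum.inr j)) k))
    (fun k => Sum.elim (fun _ => 1) (fun j => dualExp (∑ i, if ξ (Sum.inl i) < ξ (Sum.inr j) then
        mandelstam p (Sum.inl i) (Sum.inr j) else 0)) (ξ.symm k)) ?_ (Fin.last r, Fin.last s)
  · simp only [initCount_zero, initCount_top, if_true] at this
    rw [this, ξ.symm.prod_comp fun a => Sum.elim (fun _ => 1) (fun j => dualExp (∑ i,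
      if ξ (Sum.inl i) < ξ (Sum.inr j) then mandelstam p (Sum.inl i) (Sum.inr j) else 0)) a,
      Fintype.prod_sum_type, Finset.sum_comm, dualExp_sum]
    simp
  · intro k x
    obtain ⟨a, rfl⟩ := ξ.surjective k
    rw [Equiv.symm_apply_apply]
    cases a with
    | inl i =>
      rw [initCount_apply h1, initCount_apply_succ h1, latStep_inl, initCount_succ_of_ne]
      · rfl
      · intro j hj
        exact Sum.inr_ne_inl (ξ.injective (Fin.ext hj))
    | inr j =>
      rw [initCount_apply h2, initCount_apply_succ h2, latStep_inr, initCount_succ_of_ne,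
        latWeight_succ_sub]
      · simp only [lt_initCount h1, Sum.elim_inr, ← Fin.lt_def]
      · intro i hi
        exact Sum.inl_ne_inr (ξ.injective (Fin.ext hi))

/-- A word contributing to the top entry is a shuffle. -/
theorem exists_shuffle_of_ne_zero {w : Fin (r + s) → Fin r ⊕ Fin s}
    (hw : wordProd (latStep p) (List.ofFn w) (0, 0) (Fin.last r, Fin.last s) ≠ 0) :
    ∃ ξ ∈ orderedPerms r s, ⇑ξ.symm = w := by
  have st := isStep_latStep p
  obtain ⟨-, -, hnd, -⟩ := st.wordProd_apply_ne_zero hw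
  have hpair := st.pairwise_of_ne_zero hw
  have hinj : Function.Injective w := List.nodup_ofFn.1 hnd
  have hbij : Function.Bijective w :=
    (Fintype.bijective_iff_injective_and_card w).2 ⟨hinj, by simp⟩
  rw [List.pairwise_ofFn] at hpair
  set e := Equiv.ofBijective w hbij with he
  have hle : ∀ a b, (∀ v : Lat r s, Sum.elim (fun i => i.succ ≤ v.1) (fun j => j.succ ≤ v.2) a →
      Sum.elim (fun i => i.succ ≤ v.1) (fun j => j.succ ≤ v.2) b) → e.symm b ≤ e.symm a := by
    intro a b hab
    by_contra hlt
    push Not at hlt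
    refine hpair hlt ?_
    have : ∀ c, w (e.symm c) = c := e.apply_symm_apply
    rw [this, this]
    exact hab
  refine ⟨e.symm, Finset.mem_filter.2 ⟨Finset.mem_univ _, ?_, ?_⟩, rfl⟩
  · refine Monotone.strictMono_of_injective (fun i i' hi => ?_)
      (e.symm.injective.comp Sum.inl_injective)
    exact hle _ _ fun v hv => le_trans (Fin.succ_le_succ_iff.2 hi) hv
  · refine Monotone.strictMono_of_injective (fun i i' hi => ?_)
      (e.symm.injective.comp Sum.inr_injective)
    exact hle _ _ fun v hv => le_trans (Fin.succ_le_succ_iff.2 hi) hv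

/-- The top entry of a word sum is a sum over shuffles. -/
theorem wordSum_latStep_top (f : List (Fin r ⊕ Fin s) → ℂ) :
    wordSum (r + s) (latStep p) f (0, 0) (Fin.last r, Fin.last s) =
      ∑ ξ ∈ orderedPerms r s, f (List.ofFn ξ.symm) •
        dualExp (∑ i, ∑ j, if ξ (Sum.inl i) < ξ (Sum.inr j) then
          mandelstam p (Sum.inl i) (Sum.inr j) else 0) := by
  have st := isStep_latStep p
  unfold wordSum
  rw [Matrix.sum_apply, Finset.sum_eq_single (r + s)]
  · rw [Matrix.sum_apply]
    symm
    refine Finset.sum_of_injOn (fun ξ => ⇑ξ.symm) ?_ ?_ ?_ ?_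
    · intro ξ _ ξ' _ h
      exact Equiv.symm_bijective.injective (DFunLike.coe_injective h)
    · intro ξ _; exact Finset.mem_coe.2 (Finset.mem_univ _)
    · intro w _ hw
      rw [Matrix.smul_apply]
      by_contra hne
      obtain ⟨ξ, hξ, h⟩ := exists_shuffle_of_ne_zero p fun h0 => hne (by rw [h0, smul_zero])
      exact hw ⟨ξ, hξ, h⟩
    · intro ξ hξ
      rw [Matrix.smul_apply, wordProd_latStep_shuffle p hξ]
  · intro n _ hn
    rw [Matrix.sum_apply]
    refine Finset.sum_eq_zero fun w _ => ?_
    by_cases hu : wordProd (latStep p) (List.ofFn w) (0, 0) (Fin.last r, Fin.last s) = 0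
    · rw [Matrix.smul_apply, hu, smul_zero]
    · have := (st.wordProd_apply_ne_zero hu).2.1
      simp only [latDeg, Fin.val_last, Fin.val_zero, List.length_ofFn] at this
      omega
  · simp

theorem snd_smul_dualExp (c z : ℂ) : (c • dualExp z).snd = c * z := by
  simp [dualExp]

theorem lam_mul_revisedBCJ {F lam : ℂ} (hlam : lam ^ 2 = -(1 / (2 * F ^ 2)))
    (hp : Admissible p) (hr : 0 < r) (hs : 0 < s) :
    lam * revisedBCJ F p = -(offShellSq p * (alternatingWords (r + s)
      (alphaHom r s (lineCurrent F lam fun i => p (Sum.inl i)))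
      (betaHom (latWeight p) (lineCurrent F lam fun j => p (Sum.inr j)))
          (0, 0) (Fin.last r, Fin.last s)).snd) := by
  have h := congrArg TrivSqZeroExt.snd (wordSum_amplitude_top hlam hp hr hs)
  rw [wordSum_latStep_top, TrivSqZeroExt.snd_sum, ← Algebra.smul_def, TrivSqZeroExt.snd_smul,
    smul_eq_mul] at h
  simp only [snd_smul_dualExp] at h
  rw [offShellSq, msq_neg, ← h, revisedBCJ, Finset.mul_sum, ← Finset.sum_neg_distrib]
  refine Finset.sum_congr rfl fun ξ _ => ?_
  rw [wordAmplitude_ofFn]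
  have : (∑ i : Fin r, ∑ j : Fin s,
      if ξ (Sum.inl i) < ξ (Sum.inr j) then -mandelstam p (Sum.inl i) (Sum.inr j) else 0) =
      -∑ i : Fin r, ∑ j : Fin s,
        if ξ (Sum.inl i) < ξ (Sum.inr j) then mandelstam p (Sum.inl i) (Sum.inr j) else 0 := by
    simp only [← Finset.sum_neg_distrib]
    refine Finset.sum_congr rfl fun i _ => Finset.sum_congr rfl fun j _ => ?_
    split_ifs <;> simp
  rw [this]
  ring

end Shuffles

section Segments

open Matrix

theorem drop_finRange {n : ℕ} (a : Fin n) :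
    (List.finRange n).drop a = a :: (List.finRange n).drop (a + 1) := by
  rw [List.drop_eq_getElem_cons (by simp)]
  simp

/-- The only word that leads from `v` to `w` is the segment of lines between them. -/
theorem wordProd_stepMatrix {n : ℕ} (u : List (Fin n)) (v w : Fin (n + 1)) :
    wordProd stepMatrix u v w =
      if v ≤ w ∧ u = ((List.finRange n).drop v).take (w - v) then 1 else 0 := by
  induction u generalizing v with
  | nil =>
    rw [wordProd, List.map_nil, List.prod_nil, Matrix.one_apply]
    refine if_congr ⟨fun h => by subst h; simp, fun h => ?_⟩ rfl rfl
    have h2 := congrArg List.length h.2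
    have h1 : v.val ≤ w.val := h.1
    simp only [List.length_nil, List.length_take, List.length_drop, List.length_finRange] at h2
    ext; omega
  | cons a u ih =>
    have e : wordProd stepMatrix (a :: u) = stepMatrix a * wordProd stepMatrix u := by
      simp [wordProd]
    have e2 : (stepMatrix a * wordProd stepMatrix u) v w =
        if v = a.castSucc then wordProd stepMatrix u a.succ w else 0 := by
      rw [Matrix.mul_apply, Finset.sum_eq_single a.succ]
      · split_ifs with h
        · subst h; simp [stepMatrix]
        · rw [stepMatrix, Matrix.single_apply_of_ne _ _ _ _ _ fun h' => h h'.1.symm, zero_mul]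
      · intro x _ hx
        rw [stepMatrix, Matrix.single_apply_of_ne _ _ _ _ _ fun h' => hx h'.2.symm, zero_mul]
      · simp
    rw [e, e2, ih, ← ite_and]
    refine if_congr ⟨?_, ?_⟩ rfl rfl
    · rintro ⟨rfl, h1, h2⟩
      have h1' : a.val + 1 ≤ w.val := h1
      refine ⟨Fin.castSucc_lt_succ.le.trans h1, ?_⟩
      rw [Fin.val_castSucc, drop_finRange, show w.val - a.val = (w.val - (a.val + 1)) + 1 by omega,
        List.take_succ_cons, h2, Fin.val_succ]
    · rintro ⟨h1, h2⟩
      have h1' : v.val ≤ w.val := h1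
      have h3 := congrArg List.length h2
      simp only [List.length_cons, List.length_take, List.length_drop, List.length_finRange] at h3
      have hv : v.val < n := by omega
      rw [show (List.finRange n).drop v.val = _ from drop_finRange ⟨v.val, hv⟩,
        show w.val - v.val = (w.val - (v.val + 1)) + 1 by omega, List.take_succ_cons] at h2
      obtain ⟨rfl, rfl⟩ := List.cons.inj h2
      exact ⟨rfl, Fin.le_def.2 (by simp; omega), rfl⟩

theorem exists_ofFn_eq {L : Type*} (l : List L) {k : ℕ} (h : l.length = k) :
    ∃ w : Fin k → L, List.ofFn w = l := by
  subst h; exact ⟨l.get, List.ofFn_get l⟩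

theorem wordSum_stepMatrix_apply {n : ℕ} (f : List (Fin n) → ℂ) (v w : Fin (n + 1)) :
    wordSum n stepMatrix f v w =
      if v ≤ w then f (((List.finRange n).drop v).take (w - v)) else 0 := by
  unfold wordSum
  rw [Matrix.sum_apply]
  simp only [Matrix.sum_apply, Matrix.smul_apply, wordProd_stepMatrix, smul_eq_mul, mul_ite, mul_one,
    mul_zero]
  by_cases h : v ≤ w
  · have h' : v.val ≤ w.val := h
    obtain ⟨x, hx⟩ := exists_ofFn_eq (((List.finRange n).drop v).take (w - v)) (k := w - v)
      (by simp; omega)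
    rw [Finset.sum_eq_single (w.val - v.val), Finset.sum_eq_single x, hx, if_pos h]
    · simp [h]
    · intro y _ hy
      rw [if_neg]
      rintro ⟨-, h2⟩
      exact hy (List.ofFn_injective (h2.trans hx.symm))
    · simp
    · intro k _ hk
      refine Finset.sum_eq_zero fun y _ => if_neg ?_
      rintro ⟨-, h2⟩
      have := congrArg List.length (h2.trans hx.symm)
      rw [List.length_ofFn, List.length_ofFn] at this
      exact hk this
    · intro h3
      exact absurd (Finset.mem_range.2 (by omega)) h3
  · simp [h]

theorem letterSum_append {L V : Type*} [AddCommMonoid V] (c : L → V) (u v : List L) :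
    letterSum c (u ++ v) = letterSum c u + letterSum c v := by
  simp [letterSum]

theorem letterSum_segment {V : Type*} [AddCommGroup V] {n : ℕ} (c : Fin n → V) {i k : ℕ}
    (h : i + k ≤ n) : letterSum c (((List.finRange n).drop i).take k) =
      partialSum c (i + k) - partialSum c i := by
  induction k with
  | zero => simp [letterSum]
  | succ k ih =>
    rw [List.take_succ_eq_append_getElem (by simp; omega), letterSum_append, ih (by omega)]
    have := partialSum_succ c ⟨i + k, by omega⟩
    simp only at this
    rw [← add_assoc, this]
    simp [letterSum]
    abel

theorem sum_fin_eq_sum_range_of_lt {M : Type*} [AddCommMonoid M] {n : ℕ} (v : Fin (n + 1))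
    (g : Fin (n + 1) → M) (h : ℕ → M) (h0 : ∀ w, w ≤ v → g w = 0)
    (hg : ∀ w, v < w → g w = h (w - v - 1)) :
    ∑ w, g w = ∑ k ∈ Finset.range (n - v), h k := by
  symm
  refine Finset.sum_of_injOn (fun k => Fin.ofNat (n + 1) (v + k + 1)) ?_ ?_ ?_ ?_
  · intro k hk k' hk' hkk
    have hk := Finset.mem_range.1 hk
    have hk' := Finset.mem_range.1 hk'
    have := congrArg Fin.val hkk
    simp only [Fin.ofNat] at this
    rw [Nat.mod_eq_of_lt (by omega), Nat.mod_eq_of_lt (by omega)] at this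
    omega
  · intro k _; exact Finset.mem_coe.2 (Finset.mem_univ _)
  · intro w _ hw
    refine h0 w ?_
    by_contra hlt
    have hlt : v.val < w.val := not_le.1 hlt
    refine hw ⟨w - v - 1, by simp; omega, ?_⟩
    ext
    simp only [Fin.ofNat]
    rw [Nat.mod_eq_of_lt (by omega)]
    omega
  · intro k hk
    have hk := Finset.mem_range.1 hk
    have hv : (Fin.ofNat (n + 1) (v + k + 1)).val = v + k + 1 :=
      Nat.mod_eq_of_lt (by omega)
    rw [hg _ (Fin.lt_def.2 (by rw [hv]; omega)), hv]
    congr 1; omega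

end Segments

section Splits

variable {L : Type*} {M : Type*} [AddCommMonoid M]

theorem splitSum_zero (w : List L) : splitSum (fun _ => (0 : M)) w = 0 := by simp [splitSum]

theorem splitSum_congr {Φ Ψ : List (List L) → M} {w : List L}
    (h : ∀ ps : List (List L), ps.flatten = w → Φ ps = Ψ ps) : splitSum Φ w = splitSum Ψ w :=
  Finset.sum_congr rfl fun c _ => h _ (by simp)

theorem splitSum_sum {κ : Type*} (t : Finset κ) (Φ : κ → List (List L) → M) (w : List L) :
    splitSum (fun ps => ∑ k ∈ t, Φ k ps) w = ∑ k ∈ t, splitSum (Φ k) w :=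
  Finset.sum_comm

theorem splitSum_eq_zero_of_ne_nil {Φ : List (List L) → M} (h : ∀ u ps, Φ (u :: ps) = 0)
    {w : List L} (hw : w ≠ []) : splitSum Φ w = 0 := by
  rw [splitSum_of_ne_nil _ hw]
  exact Finset.sum_eq_zero fun k _ => by simp only [h, splitSum_zero]

theorem splitSum_eq_sum_composition (Φ : List (List L) → M) {n : ℕ} (w : List L) (h : w.length = n) :
    splitSum Φ w = ∑ c : Composition n, Φ (List.ofFn fun l : Fin c.length =>
      List.ofFn fun k => w.get ((c.embedding l k).cast h.symm)) := by
  subst h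
  exact Finset.sum_congr rfl fun c _ => by rw [splitWrtComposition_eq_ofFn]; rfl

theorem splitSum_finRange {n : ℕ} (Φ : List (List (Fin n)) → M) :
    splitSum Φ (List.finRange n) = ∑ c : Composition n, Φ (List.ofFn fun l : Fin c.length =>
      List.ofFn fun k => c.embedding l k) := by
  rw [splitSum_eq_sum_composition Φ _ List.length_finRange]
  refine Finset.sum_congr rfl fun c _ => ?_
  congr 1
  refine List.ofFn_inj.2 (funext fun l => List.ofFn_inj.2 (funext fun k => ?_))
  rw [List.get_finRange]; rfl

end Splits

section Chains

variable {L L' : Type*}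

/-- The weight of a sequence of blocks of two kinds in the order given by `σ`: every block of the
first kind is paired with all later blocks of the second kind. -/
def chainWeight (S : List L → List L' → ℂ) : List Bool → List (List L) → List (List L') → ℂ
  | true :: σ, u :: ps, qs => S u qs.flatten + chainWeight S σ ps qs
  | false :: σ, ps, _ :: qs => chainWeight S σ ps qs
  | _, _, _ => 0

variable {r s D : ℕ} (p : Fin r ⊕ Fin s → Fin D → ℂ)

/-- `2 P_u · P_v` for words `u` of lines `α` and `v` of lines `β`. -/
noncomputable def wordMandelstam (u : List (Fin r)) (v : List (Fin s)) : ℂ :=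
  letterSum (fun i => letterSum (fun j => mandelstam p (Sum.inl i) (Sum.inr j)) v) u

theorem wordMandelstam_eq (u : List (Fin r)) (v : List (Fin s)) :
    wordMandelstam p u v = 2 * ∑ μ, (metricSign D μ : ℂ) *
      (letterSum (fun i => p (Sum.inl i) μ) u * letterSum (fun j => p (Sum.inr j) μ) v) := by
  simp only [wordMandelstam, letterSum_eq_sum_get, mandelstam, mdot_eq_sum]
  simp only [← Finset.mul_sum]
  congr 1
  rw [Finset.sum_congr rfl fun i _ => Finset.sum_comm, Finset.sum_comm]
  refine Finset.sum_congr rfl fun μ _ => ?_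
  rw [Finset.sum_mul_sum, Finset.mul_sum]
  simp only [Finset.mul_sum]

theorem latWeight_segment {i i' : Fin (r + 1)} (hi : i ≤ i') (j : Fin (s + 1)) :
    latWeight p (i', Fin.last s) - latWeight p (i', j) =
      latWeight p (i, Fin.last s) - latWeight p (i, j) +
        wordMandelstam p (((List.finRange r).drop i).take (i' - i)) ((List.finRange s).drop j) := by
  have hi' : i.val ≤ i'.val := hi
  have h1 := fun μ => letterSum_segment (fun i => p (Sum.inl i) μ) (i := i) (k := i' - i) (n := r)
    (by omega)
  have h2 := fun μ => letterSum_segment (fun i => p (Sum.inr i) μ) (i := j) (k := s - j) (n := s)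
    (by omega)
  rw [List.take_of_length_le (by simp)] at h2
  rw [wordMandelstam_eq]
  simp only [h1, h2, latWeight, Fin.val_last, ← mul_sub, ← mul_add, ← Finset.sum_sub_distrib,
    ← Finset.sum_add_distrib]
  rw [show i.val + (i'.val - i.val) = i'.val by omega, show j.val + (s - j.val) = s by omega]
  congr 1
  refine Finset.sum_congr rfl fun μ _ => ?_
  ring

theorem lineCurrent_apply (F lam : ℂ) {n : ℕ} (q : Fin n → Fin D → ℂ) (v w : Fin (n + 1)) :
    lineCurrent F lam q v w = if v ≤ w then
      lam * wordCurrent F q (((List.finRange n).drop v).take (w - v)) else 0 :=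
  wordSum_stepMatrix_apply _ v w

theorem lineCurrent_apply_of_le (F lam : ℂ) {n : ℕ} (q : Fin n → Fin D → ℂ) {v w : Fin (n + 1)}
    (h : w ≤ v) : lineCurrent F lam q v w = 0 := by
  rw [lineCurrent_apply]
  split_ifs with h'
  · rw [le_antisymm h h']; simp [wordCurrent_nil]
  · rfl

/-- The entries of a product of currents of the two kinds of lines, as a sum over divisions. -/
theorem wordProd_chain_top (F lam : ℂ) (σ : List Bool) (i : Fin (r + 1)) (j : Fin (s + 1)) :
    wordProd (fun b : Bool => if b then alphaHom r s (lineCurrent F lam fun i => p (Sum.inl i))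
        else betaHom (latWeight p) (lineCurrent F lam fun j => p (Sum.inr j))) σ
        (i, j) (Fin.last r, Fin.last s) =
      splitSum (fun ps => splitSum (fun qs =>
        if ps.length = σ.count true ∧ qs.length = σ.count false then
          (lam ^ σ.length * (ps.map (wordCurrent F fun i => p (Sum.inl i))).prod *
            (qs.map (wordCurrent F fun j => p (Sum.inr j))).prod) •
          dualExp (latWeight p (i, Fin.last s) - latWeight p (i, j) +
            chainWeight (wordMandelstam p) σ ps qs) else 0)
        ((List.finRange s).drop j)) ((List.finRange r).drop i) := by
  have ne_nil : ∀ {n : ℕ} (v : Fin (n + 1)), v ≠ Fin.last n → (List.finRange n).drop v ≠ [] := by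
    intro n v hv h
    have := congrArg List.length h
    simp only [List.length_drop, List.length_finRange, List.length_nil] at this
    exact hv (Fin.ext (by simp; omega))
  have last_nil : ∀ n : ℕ, (List.finRange n).drop (Fin.last n).val = [] := by intro n; simp
  induction σ generalizing i j with
  | nil =>
    by_cases hi : i = Fin.last r
    · subst hi
      by_cases hj : j = Fin.last s
      · subst hj
        rw [last_nil, last_nil, splitSum_nil, splitSum_nil]
        simp [chainWeight, dualExp_zero, wordProd]
      · rw [last_nil, splitSum_nil, splitSum_eq_zero_of_ne_nil (by simp) (ne_nil j hj)]
        rw [wordProd, List.map_nil, List.prod_nil,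
          Matrix.one_apply_ne fun h => hj (Prod.ext_iff.1 h).2]
    · rw [splitSum_eq_zero_of_ne_nil (by simp [splitSum_zero]) (ne_nil i hi)]
      rw [wordProd, List.map_nil, List.prod_nil,
        Matrix.one_apply_ne fun h => hi (Prod.ext_iff.1 h).1]
  | cons b σ ih =>
    rw [← List.singleton_append, wordProd_append, Matrix.mul_apply]
    cases b with
    | true =>
      have e : ∑ x, wordProd (fun b : Bool => if b then
            alphaHom r s (lineCurrent F lam fun i => p (Sum.inl i))
          else betaHom (latWeight p) (lineCurrent F lam fun j => p (Sum.inr j))) [true] (i, j) x *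
          wordProd (fun b : Bool => if b then alphaHom r s (lineCurrent F lam fun i => p (Sum.inl i))
            else betaHom (latWeight p) (lineCurrent F lam fun j => p (Sum.inr j))) σ x
            (Fin.last r, Fin.last s) =
          ∑ i' : Fin (r + 1), algebraMap ℂ (DualNumber ℂ)
            (lineCurrent F lam (fun i => p (Sum.inl i)) i i') *
            wordProd (fun b : Bool => if b then
              alphaHom r s (lineCurrent F lam fun i => p (Sum.inl i))
              else betaHom (latWeight p) (lineCurrent F lam fun j => p (Sum.inr j))) σ (i', j)
            (Fin.last r, Fin.last s) := by
        rw [Fintype.sum_prod_type]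
        refine Finset.sum_congr rfl fun i' _ => ?_
        rw [Finset.sum_eq_single j]
        · simp [wordProd, alphaHom_apply]
        · intro j' _ hj'
          simp [wordProd, alphaHom_apply, hj'.symm]
        · simp
      rw [e]
      by_cases hi : i = Fin.last r
      · subst hi
        rw [last_nil, splitSum_nil]
        rw [Finset.sum_eq_zero fun i' _ => by
          rw [lineCurrent_apply_of_le _ _ _ (Fin.le_last i'), map_zero, zero_mul]]
        simp [splitSum_zero]
      rw [splitSum_of_ne_nil _ (ne_nil i hi), List.length_drop, List.length_finRange]
      refine sum_fin_eq_sum_range_of_lt i _ _ (fun i' h => by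
        rw [lineCurrent_apply_of_le _ _ _ h, map_zero, zero_mul]) fun i' h => ?_
      have h' : i.val < i'.val := h
      rw [ih, lineCurrent_apply, if_pos h.le, List.drop_drop,
        show i.val + (i'.val - i.val - 1 + 1) = i'.val by omega,
        show i'.val - i.val - 1 + 1 = i'.val - i.val by omega, ← splitSum_mul]
      refine splitSum_congr fun ps _ => ?_
      rw [← splitSum_mul]
      refine splitSum_congr fun qs hqs => ?_
      by_cases hc : ps.length = σ.count true ∧ qs.length = σ.count false
      · rw [if_pos hc, if_pos (by simpa using hc), latWeight_segment p h.le, ← Algebra.smul_def,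
          smul_smul]
        simp only [List.singleton_append, chainWeight, hqs, List.length_cons, List.map_cons,
          List.prod_cons]
        congr 1
        · ring
        · rw [add_assoc]
      · rw [if_neg hc, if_neg (by simpa using hc), mul_zero]
    | false =>
      have e : ∑ x, wordProd (fun b : Bool => if b then
            alphaHom r s (lineCurrent F lam fun i => p (Sum.inl i))
          else betaHom (latWeight p) (lineCurrent F lam fun j => p (Sum.inr j))) [false] (i, j) x *
          wordProd (fun b : Bool => if b then alphaHom r s (lineCurrent F lam fun i => p (Sum.inl i))
            else betaHom (latWeight p) (lineCurrent F lam fun j => p (Sum.inr j))) σ x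
            (Fin.last r, Fin.last s) =
          ∑ j' : Fin (s + 1), algebraMap ℂ (DualNumber ℂ)
            (lineCurrent F lam (fun i => p (Sum.inr i)) j j') *
            dualExp (latWeight p (i, j') - latWeight p (i, j)) *
            wordProd (fun b : Bool => if b then
              alphaHom r s (lineCurrent F lam fun i => p (Sum.inl i))
              else betaHom (latWeight p) (lineCurrent F lam fun j => p (Sum.inr j))) σ (i, j')
            (Fin.last r, Fin.last s) := by
        rw [Fintype.sum_prod_type_right]
        refine Finset.sum_congr rfl fun j' _ => ?_
        rw [Finset.sum_eq_single i]
        · simp [wordProd, betaHom_apply]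
        · intro i' _ hi'
          simp [wordProd, betaHom_apply, hi'.symm]
        · simp
      rw [e]
      by_cases hj : j = Fin.last s
      · subst hj
        rw [last_nil]
        rw [Finset.sum_eq_zero fun j' _ => by
          rw [lineCurrent_apply_of_le _ _ _ (Fin.le_last j'), map_zero, zero_mul, zero_mul]]
        simp [splitSum_nil, splitSum_zero]
      rw [splitSum_congr fun ps _ => splitSum_of_ne_nil _ (ne_nil j hj), splitSum_sum,
        List.length_drop, List.length_finRange]
      refine sum_fin_eq_sum_range_of_lt j _ _ (fun j' h => by
        rw [lineCurrent_apply_of_le _ _ _ h, map_zero, zero_mul, zero_mul]) fun j' h => ?_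
      have h' : j.val < j'.val := h
      rw [ih, lineCurrent_apply, if_pos h.le, List.drop_drop,
        show j.val + (j'.val - j.val - 1 + 1) = j'.val by omega,
        show j'.val - j.val - 1 + 1 = j'.val - j.val by omega, ← splitSum_mul]
      refine splitSum_congr fun ps _ => ?_
      rw [← splitSum_mul]
      refine splitSum_congr fun qs hqs => ?_
      by_cases hc : ps.length = σ.count true ∧ qs.length = σ.count false
      · rw [if_pos hc, if_pos (by simpa using hc), mul_smul_comm,
          mul_assoc (algebraMap _ _ _), ← dualExp_add,
          ← Algebra.smul_def, smul_smul]
        cases ps <;>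
        · simp only [List.singleton_append, chainWeight, List.length_cons, List.map_cons,
            List.prod_cons]
          congr 1
          · ring
          · congr 1; ring
      · rw [if_neg hc, if_neg (by simpa using hc), mul_zero]

end Chains

section Alternating

/-- The alternating sequence of length `n` that starts with `b`. -/
def altWord : Bool → ℕ → List Bool
  | _, 0 => []
  | b, n + 1 => b :: altWord (!b) n

theorem length_altWord (b : Bool) (n : ℕ) : (altWord b n).length = n := by
  induction n generalizing b with
  | zero => rfl
  | succ n ih => rw [altWord, List.length_cons, ih]

theorem count_altWord (b : Bool) (k : ℕ) :
    (altWord b (2 * k + 1)).count b = k + 1 ∧ (altWord b (2 * k + 1)).count (!b) = k := by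
  induction k with
  | zero => simp [altWord]
  | succ k ih =>
    rw [show 2 * (k + 1) + 1 = (2 * k + 1) + 1 + 1 by ring, altWord, altWord, Bool.not_not]
    constructor
    · rw [List.count_cons_self, List.count_cons_of_ne (by cases b <;> simp), ih.1]
    · rw [List.count_cons_of_ne (by cases b <;> simp), List.count_cons_self, ih.2]

theorem wordProd_altWord {M : Type*} [Ring M] (m : Bool → M) (b : Bool) (k : ℕ) :
    wordProd m (altWord b (2 * k + 1)) = m b * (m (!b) * m b) ^ k := by
  induction k with
  | zero => simp [altWord, wordProd]
  | succ k ih =>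
    rw [show 2 * (k + 1) + 1 = (2 * k + 1) + 1 + 1 by ring, altWord, altWord, Bool.not_not]
    have : wordProd m (b :: (!b) :: altWord b (2 * k + 1)) =
        m b * (m (!b) * wordProd m (altWord b (2 * k + 1))) := by simp [wordProd]
    rw [this, ih, pow_succ']
    simp only [mul_assoc]

theorem letterSum_flatten_ofFn {L V : Type*} [AddCommMonoid V] (c : L → V) {n : ℕ}
    (h : Fin n → List L) : letterSum c (List.ofFn h).flatten = ∑ J, letterSum c (h J) := by
  induction n with
  | zero => simp [letterSum]
  | succ n ih => rw [List.ofFn_succ, List.flatten_cons, letterSum_append, ih, Fin.sum_univ_succ]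

theorem chainWeight_altWord {L L' : Type*} (S : List L → List L' → ℂ)
    (hS : ∀ u {n : ℕ} (h : Fin n → List L'), S u (List.ofFn h).flatten = ∑ J, S u (h J)) (n : ℕ)
    {R T : ℕ} (hn : R + T = n) (g : Fin R → List L) (h : Fin T → List L') :
    (R = T ∨ R = T + 1 → chainWeight S (altWord true n) (List.ofFn g) (List.ofFn h) =
      ∑ I, ∑ J, if I.val ≤ J.val then S (g I) (h J) else 0) ∧
    (T = R ∨ T = R + 1 → chainWeight S (altWord false n) (List.ofFn g) (List.ofFn h) =
      ∑ I, ∑ J, if I.val < J.val then S (g I) (h J) else 0) := by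
  induction n generalizing R T with
  | zero =>
    obtain ⟨rfl, rfl⟩ : R = 0 ∧ T = 0 := by omega
    simp [altWord, chainWeight]
  | succ n ih =>
    constructor
    · intro hRT
      obtain ⟨R, rfl⟩ : ∃ R', R = R' + 1 := ⟨R - 1, by omega⟩
      rw [List.ofFn_succ, altWord, chainWeight, Fin.sum_univ_succ, hS, Bool.not_true,
        (ih (by omega) (fun i => g i.succ) h).2 (by omega)]
      simp
    · intro hRT
      obtain ⟨T, rfl⟩ : ∃ T', T = T' + 1 := ⟨T - 1, by omega⟩
      rw [List.ofFn_succ, altWord]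
      have : chainWeight S (false :: altWord (!false) n) (List.ofFn g)
          (h 0 :: List.ofFn fun i => h i.succ) =
          chainWeight S (altWord true n) (List.ofFn g) (List.ofFn fun i => h i.succ) := by
        cases List.ofFn g <;> rfl
      rw [this, (ih (by omega) g fun i => h i.succ).1 (by omega)]
      refine Finset.sum_congr rfl fun I _ => ?_
      rw [Fin.sum_univ_succ]
      simp

end Alternating

section Expansion

variable {r s D : ℕ} (p : Fin r ⊕ Fin s → Fin D → ℂ)

/-- The coefficient matrix of a division: that of the blocks. -/
def divisionCoeff {r s : ℕ} (A : Composition r) (B : Composition s) : Matrix (Fin r) (Fin s) ℤ :=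
  Matrix.of fun i j => coeffMatrix A.length B.length (A.index i) (B.index j)

theorem sum_embedding {M : Type*} [AddCommMonoid M] {n : ℕ} (c : Composition n) (f : Fin n → M) :
    ∑ i, f i = ∑ I : Fin c.length, ∑ k, f (c.embedding I k) := by
  rw [← c.blocksFinEquiv.sum_comp, Fintype.sum_sigma]
  rfl

theorem linearForm_divisionCoeff (A : Composition r) (B : Composition s) :
    linearForm p (toC (divisionCoeff A B)) 0 0 = ∑ I, ∑ J,
      (coeffMatrix A.length B.length I J : ℂ) * wordMandelstam p
        (List.ofFn fun k => A.embedding I k) (List.ofFn fun k => B.embedding J k) := by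
  have : linearForm p (toC (divisionCoeff A B)) 0 0 =
      ∑ i, ∑ j, toC (divisionCoeff A B) i j * mandelstam p (Sum.inl i) (Sum.inr j) := by
    simp [linearForm]
  rw [this, sum_embedding A]
  refine Finset.sum_congr rfl fun I _ => ?_
  simp only [sum_embedding B]
  rw [Finset.sum_comm]
  refine Finset.sum_congr rfl fun J _ => ?_
  simp only [wordMandelstam, letterSum_ofFn, Finset.mul_sum]
  refine Finset.sum_congr rfl fun k _ => Finset.sum_congr rfl fun l _ => ?_
  simp [toC, divisionCoeff]

theorem wordMandelstam_flatten (u : List (Fin r)) {n : ℕ} (h : Fin n → List (Fin s)) :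
    wordMandelstam p u (List.ofFn h).flatten = ∑ J, wordMandelstam p u (h J) := by
  simp only [wordMandelstam, letterSum_flatten_ofFn]
  simp only [letterSum_eq_sum_get]
  exact Finset.sum_comm

theorem snd_wordProd_altWord (F lam : ℂ) (b : Bool) (k : ℕ) :
    (wordProd (fun b : Bool => if b then alphaHom r s (lineCurrent F lam fun i => p (Sum.inl i))
        else betaHom (latWeight p) (lineCurrent F lam fun j => p (Sum.inr j)))
        (altWord b (2 * k + 1)) (0, 0) (Fin.last r, Fin.last s)).snd =
      ∑ A : Composition r, ∑ B : Composition s,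
        if (if b then A.length = k + 1 ∧ B.length = k else A.length = k ∧ B.length = k + 1) then
          lam ^ (2 * k + 1) * linearForm p (toC (divisionCoeff A B)) 0 0 *
          (∏ I : Fin A.length, current F (A.blocksFun I) fun k => p (Sum.inl (A.embedding I k))) *
          ∏ J : Fin B.length, current F (B.blocksFun J) fun k => p (Sum.inr (B.embedding J k))
        else 0 := by
  have hL : ∀ j, latWeight p ((0 : Fin (r + 1)), j) = 0 := by
    intro j; simp [latWeight, partialSum_zero]
  rw [wordProd_chain_top, Fin.val_zero, Fin.val_zero, List.drop_zero, List.drop_zero,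
    splitSum_finRange, TrivSqZeroExt.snd_sum]
  refine Finset.sum_congr rfl fun A _ => ?_
  rw [splitSum_finRange, TrivSqZeroExt.snd_sum]
  refine Finset.sum_congr rfl fun B _ => ?_
  rw [List.length_ofFn, List.length_ofFn, length_altWord, hL, hL, sub_self, zero_add]
  have hc : (A.length = (altWord b (2 * k + 1)).count true ∧
      B.length = (altWord b (2 * k + 1)).count false) ↔
      (if b then A.length = k + 1 ∧ B.length = k else A.length = k ∧ B.length = k + 1) := by
    cases b with
    | true =>
      have := count_altWord true k
      rw [Bool.not_true] at this
      rw [this.1, this.2]; simp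
    | false =>
      have := count_altWord false k
      rw [Bool.not_false] at this
      rw [this.1, this.2]; simp
  rw [apply_ite TrivSqZeroExt.snd, TrivSqZeroExt.snd_zero]
  refine ite_congr (propext hc) (fun h => ?_) fun _ => rfl
  rw [snd_smul_dualExp, List.map_ofFn, List.map_ofFn, List.prod_ofFn, List.prod_ofFn]
  have hform : chainWeight (wordMandelstam p) (altWord b (2 * k + 1))
      (List.ofFn fun I => List.ofFn fun k => A.embedding I k)
      (List.ofFn fun J => List.ofFn fun k => B.embedding J k) =
      linearForm p (toC (divisionCoeff A B)) 0 0 := by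
    rw [linearForm_divisionCoeff]
    have key := fun hn => chainWeight_altWord (wordMandelstam p) (wordMandelstam_flatten p)
      (2 * k + 1) hn (fun I => List.ofFn fun k => A.embedding I k)
      (fun J => List.ofFn fun k => B.embedding J k)
    cases b with
    | true =>
      simp only [if_true] at h
      rw [(key (by omega)).1 (by omega)]
      refine Finset.sum_congr rfl fun I _ => Finset.sum_congr rfl fun J _ => ?_
      have h2 : (A.length : ℤ) - B.length = 1 := by omega
      simp [coeffMatrix, h2]
    | false =>
      simp only [Bool.false_eq_true, if_false] at h
      rw [(key (by omega)).2 (by omega)]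
      refine Finset.sum_congr rfl fun I _ => Finset.sum_congr rfl fun J _ => ?_
      have h1 : (A.length : ℤ) - B.length = -1 := by omega
      simp [coeffMatrix, h1]
  rw [hform]
  simp only [Function.comp_apply, wordCurrent_ofFn]
  ring

/-- The weighted sum of alternating words as a sum over divisions. -/
theorem snd_alternatingWords {F lam : ℂ} (hlam : lam ^ 2 = -(1 / (2 * F ^ 2))) :
    (alternatingWords (r + s) (alphaHom r s (lineCurrent F lam fun i => p (Sum.inl i)))
      (betaHom (latWeight p) (lineCurrent F lam fun j => p (Sum.inr j)))
          (0, 0) (Fin.last r, Fin.last s)).snd =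
      lam * divisionSum F p fun A B => linearForm p (toC (divisionCoeff A B)) 0 0 := by
  set m : Bool → Matrix (Lat r s) (Lat r s) (DualNumber ℂ) := fun b =>
    if b then alphaHom r s (lineCurrent F lam fun i => p (Sum.inl i))
        else betaHom (latWeight p) (lineCurrent F lam fun j => p (Sum.inr j)) with hm
  have hw : ∀ b : Bool, (m b * ∑ k ∈ Finset.range (r + s + 1), (-(m (!b) * m b)) ^ k) =
      ∑ k ∈ Finset.range (r + s + 1), (-1 : ℂ) ^ k • wordProd m (altWord b (2 * k + 1)) := by
    intro b
    rw [Finset.mul_sum]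
    refine Finset.sum_congr rfl fun k _ => ?_
    rw [wordProd_altWord, neg_pow]
    rcases Nat.even_or_odd k with h | h <;> simp [h.neg_one_pow]
  have halt : alternatingWords (r + s) (alphaHom r s (lineCurrent F lam fun i => p (Sum.inl i)))
      (betaHom (latWeight p) (lineCurrent F lam fun j => p (Sum.inr j))) =
      ∑ k ∈ Finset.range (r + s + 1), ((-1 : ℂ) ^ k • wordProd m (altWord true (2 * k + 1)) +
        (-1 : ℂ) ^ k • wordProd m (altWord false (2 * k + 1))) := by
    rw [Finset.sum_add_distrib, ← hw true, ← hw false]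
    rfl
  rw [halt, Matrix.sum_apply, TrivSqZeroExt.snd_sum]
  simp only [Matrix.add_apply, Matrix.smul_apply, TrivSqZeroExt.snd_add, TrivSqZeroExt.snd_smul]
  simp only [hm, snd_wordProd_altWord, smul_eq_mul]
  simp only [Finset.mul_sum, ← Finset.sum_add_distrib, divisionSum]
  rw [Finset.sum_comm]
  refine Finset.sum_congr rfl fun A _ => ?_
  rw [Finset.sum_comm]
  refine Finset.sum_congr rfl fun B _ => ?_
  have hA := A.length_le
  have hB := B.length_le
  have hpow : ∀ k, (-1 : ℂ) ^ k * lam ^ (2 * k + 1) = lam * (1 / (2 * F ^ 2)) ^ k := by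
    intro k
    rw [pow_succ, pow_mul, hlam, neg_pow (1 / (2 * F ^ 2))]
    rcases Nat.even_or_odd k with h | h <;> simp [h.neg_one_pow, mul_comm]
  simp only [if_true, Bool.false_eq_true, if_false]
  by_cases h1 : A.length = B.length + 1
  · rw [Finset.sum_eq_single B.length, if_pos ⟨h1, rfl⟩, if_neg (by omega),
      show (A.length + B.length - 1) / 2 = B.length by omega]
    · linear_combination (linearForm p (toC (divisionCoeff A B)) 0 0 *
          (∏ I : Fin A.length, current F (A.blocksFun I) fun k => p (Sum.inl (A.embedding I k))) *
          ∏ J : Fin B.length, current F (B.blocksFun J) fun k => p (Sum.inr (B.embedding J k))) *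
          hpow B.length
    · intro k _ hk
      rw [if_neg (by omega), if_neg (by omega)]; simp
    · intro h
      exact absurd (Finset.mem_range.2 (by omega)) h
  by_cases h2 : B.length = A.length + 1
  · rw [Finset.sum_eq_single A.length, if_pos (c := A.length = A.length ∧ _) ⟨rfl, h2⟩,
      if_neg (by omega), show (A.length + B.length - 1) / 2 = A.length by omega]
    · linear_combination (linearForm p (toC (divisionCoeff A B)) 0 0 *
          (∏ I : Fin A.length, current F (A.blocksFun I) fun k => p (Sum.inl (A.embedding I k))) *
          ∏ J : Fin B.length, current F (B.blocksFun J) fun k => p (Sum.inr (B.embedding J k))) *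
          hpow A.length
    · intro k _ hk
      rw [if_neg (by omega), if_neg (by omega)]; simp
    · intro h
      exact absurd (Finset.mem_range.2 (by omega)) h
  · have h0 : linearForm p (toC (divisionCoeff A B)) 0 0 = 0 := by
      rw [linearForm_divisionCoeff]
      refine Finset.sum_eq_zero fun I _ => Finset.sum_eq_zero fun J _ => ?_
      rw [coeffMatrix, Matrix.of_apply, if_neg (by omega), if_neg (by omega)]
      simp
    rw [h0, Finset.sum_eq_zero]
    · simp
    · intro k _
      rw [if_neg (by omega), if_neg (by omega)]; simp

theorem isExpansion_divisionCoeff {F : ℂ} (hF : F ≠ 0) (D : ℕ) {r s : ℕ} (hr : 0 < r) (hs : 0 < s) :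
    IsExpansion F D (fun (A : Composition r) (B : Composition s) => toC (divisionCoeff A B)) 0 0 := by
  intro p hp
  obtain ⟨lam, hlam⟩ := IsAlgClosed.exists_pow_nat_eq (-(1 / (2 * F ^ 2))) (n := 2) two_pos
  have h0 : lam ≠ 0 := by
    rintro rfl
    have : -(1 / (2 * F ^ 2)) ≠ 0 := by
      simpa using hF
    exact this (by rw [← hlam]; simp)
  have h := lam_mul_revisedBCJ p hlam hp hr hs
  rw [snd_alternatingWords p hlam] at h
  refine mul_left_cancel₀ h0 (h.trans ?_)
  rw [mul_left_comm, ← mul_neg]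
  congr 1
  simp only [divisionSum, Finset.mul_sum, ← Finset.sum_neg_distrib]
  refine Finset.sum_congr rfl fun A _ => Finset.sum_congr rfl fun B _ => ?_
  simp only [Pi.zero_apply]
  ring

theorem index_ones (n : ℕ) (i : Fin n) : ((Composition.ones n).index i).val = i.val := by
  have h2 := congrArg Fin.val ((Composition.ones n).embedding_comp_inv i)
  have h3 := ((Composition.ones n).index i).isLt
  have h4 := ((Composition.ones n).invEmbedding i).isLt
  rw [Composition.coe_embedding, Composition.ones_sizeUpTo] at h2
  have h5 := Composition.ones_blocksFun n ((Composition.ones n).index i)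
  simp only [Composition.ones_length] at h3
  omega

theorem divisionCoeff_ones (r s : ℕ) :
    divisionCoeff (Composition.ones r) (Composition.ones s) = coeffMatrix r s := by
  ext i j
  simp [divisionCoeff, coeffMatrix, index_ones]

end Expansion

section Gram

theorem msq_sum {D : ℕ} {ι : Type*} (t : Finset ι) (q : ι → Fin D → ℂ) :
    msq (∑ i ∈ t, q i) = ∑ i ∈ t, ∑ j ∈ t, mdot (q i) (q j) := by
  simp only [msq, mdot_eq_sum, Finset.sum_apply]
  simp only [Finset.sum_mul_sum]
  simp only [Finset.mul_sum]
  rw [Finset.sum_comm]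
  exact Finset.sum_congr rfl fun i _ => Finset.sum_comm

/-- Every real symmetric matrix is the Gram matrix of complex momenta in high enough dimension. -/
theorem exists_gram {ι : Type*} [Fintype ι] [DecidableEq ι] {D : ℕ} (hD : Fintype.card ι ≤ D)
    (G : Matrix ι ι ℝ) (hG : G.IsSymm) :
    ∃ p : ι → Fin D → ℂ, ∀ a b, mdot (p a) (p b) = (G a b : ℂ) := by
  have hH : G.IsHermitian := by
    rw [Matrix.IsHermitian, Matrix.conjTranspose_eq_transpose_of_trivial]; exact hG
  set U : Matrix ι ι ℝ := (hH.eigenvectorUnitary : Matrix ι ι ℝ)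
  have hspec : ∀ a b, G a b = ∑ k, hH.eigenvalues k * (U a k * U b k) := by
    intro a b
    conv_lhs => rw [hH.spectral_theorem, Unitary.conjStarAlgAut_apply]
    rw [Matrix.mul_apply]
    refine Finset.sum_congr rfl fun k _ => ?_
    rw [Matrix.mul_diagonal, Matrix.star_apply]
    simp only [Function.comp_apply, RCLike.ofReal_real_eq_id, id, star_trivial]
    ring
  obtain ⟨e⟩ : Nonempty (ι ↪ Fin D) :=
    Function.Embedding.nonempty_of_card_le (by simpa using hD)
  have hz : ∀ k, ∃ z : ℂ, z ^ 2 = (metricSign D (e k) : ℂ) * hH.eigenvalues k := fun k =>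
    IsAlgClosed.exists_pow_nat_eq _ two_pos
  choose z hz using hz
  refine ⟨fun a => Function.extend e (fun k => z k * U a k) 0, fun a b => ?_⟩
  rw [mdot_eq_sum, hspec]
  push_cast
  symm
  refine Finset.sum_of_injOn e e.injective.injOn (by simp) (fun μ _ hμ => ?_) fun k _ => ?_
  · rw [Function.extend_apply' _ _ _ fun ⟨k, hk⟩ => hμ ⟨k, by simp, hk⟩]
    simp
  · rw [e.injective.extend_apply, e.injective.extend_apply]
    have h1 : (metricSign D (e k) : ℂ) * metricSign D (e k) = 1 := by
      unfold metricSign; split_ifs <;> simp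
    linear_combination (-(U a k : ℂ) * U b k * metricSign D (e k)) * hz k -
      (U a k : ℂ) * U b k * hH.eigenvalues k * h1

end Gram

section Limits

open Filter Topology

variable {D : ℕ}

/-- The sum over the legs in odd positions, in terms of the lines. -/
theorem sum_even_legs {n : ℕ} (q : Fin n → Fin D → ℂ) (c : Composition n) :
    (∑ k : Fin (c.length + 1), if Even k.val then vertexLegs q c k else 0) =
      -∑ i ∈ Finset.univ.filter (fun i => Even (c.index i).val), q i := by
  rw [Fin.sum_univ_succ, Finset.sum_filter, sum_embedding c fun i =>
    if Even (c.index i).val then q i else 0]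
  simp only [vertexLegs, Fin.cons_zero, Fin.cons_succ, Composition.index_embedding]
  rw [sum_embedding c q]
  simp only [Fin.val_zero, Even.zero, if_true, Fin.val_succ]
  rw [neg_add_eq_iff_eq_add, ← sub_eq_add_neg, eq_sub_iff_add_eq, ← Finset.sum_add_distrib]
  refine Finset.sum_congr rfl fun l _ => ?_
  by_cases h : Even l.val <;> simp [h, Nat.even_add_one]

theorem prod_ite_blocksFun {n : ℕ} (c : Composition n) :
    (∏ l, if c.blocksFun l = 1 then (1 : ℂ) else 0) = if c = Composition.ones n then 1 else 0 := by
  have h : c = Composition.ones n ↔ ∀ l, c.blocksFun l = 1 := by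
    rw [Composition.eq_ones_iff]
    constructor
    · exact fun h l => h _ (c.blocksFun_mem_blocks l)
    · intro h b hb
      obtain ⟨l, rfl⟩ := List.mem_iff_get.1 hb
      exact h l
  by_cases hc : c = Composition.ones n
  · simp [if_pos hc, h.1 hc]
  · obtain ⟨l, hl⟩ := not_forall.1 fun h' => hc (h.2 h')
    rw [if_neg hc, Finset.prod_eq_zero (Finset.mem_univ l) (if_neg hl)]

/-- The adjacency of natural numbers. -/
def neighbor (i j : ℕ) : ℝ := if i + 1 = j ∨ j + 1 = i then 1 else 0

/-- If only the products of neighboring momenta survive, all proper currents tend to zero. -/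
theorem tendsto_current (F : ℂ) (m : ℕ) (q : ℕ → Fin m → Fin D → ℂ)
    (hq : ∀ i j : Fin m, Tendsto (fun n => mdot (q n i) (q n j)) atTop (𝓝 (neighbor i j : ℂ))) :
    Tendsto (fun n => current F m (q n)) atTop (𝓝 (if m = 1 then 1 else 0)) := by
  induction m using Nat.strong_induction_on with
  | _ m ih =>
    by_cases hm : m = 1
    · subst hm
      simp only [if_true]
      refine tendsto_const_nhds.congr fun n => ?_
      rw [current]; simp
    have hcur : (fun n => current F m (q n)) = fun n => Complex.I / msq (∑ k, q n k) *
        ∑ c : {c : Composition m // 3 ≤ c.length},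
          Complex.I * vertex F (vertexLegs (q n) c.1) *
            ∏ l : Fin c.1.length,
              current F (c.1.blocksFun l) (fun k => q n (c.1.embedding l k)) := by
      funext n; rw [current, if_neg hm]
    rw [hcur, if_neg hm]
    by_cases hm3 : m < 3
    · refine tendsto_const_nhds.congr fun n => ?_
      have : IsEmpty {c : Composition m // 3 ≤ c.length} := ⟨fun c => by
        have := c.1.length_le
        have := c.2
        omega⟩
      rw [Finset.univ_eq_empty (α := {c : Composition m // 3 ≤ c.length}), Finset.sum_empty, mul_zero]
    have hmsq : ∀ t : Finset (Fin m), Tendsto (fun n => msq (∑ k ∈ t, q n k)) atTop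
        (𝓝 (∑ i ∈ t, ∑ j ∈ t, (neighbor i j : ℂ))) := by
      intro t
      simp only [msq_sum]
      exact tendsto_finsetSum _ fun i _ => tendsto_finsetSum _ fun j _ => hq i j
    have hP : ∑ i : Fin m, ∑ j : Fin m, (neighbor i j : ℂ) ≠ 0 := by
      have hnn : ∀ i j : ℕ, 0 ≤ neighbor i j := fun i j => by unfold neighbor; split_ifs <;> norm_num
      have : 0 < ∑ i : Fin m, ∑ j : Fin m, neighbor i j := by
        refine Finset.sum_pos' (fun i _ => Finset.sum_nonneg fun j _ => hnn _ _)
          ⟨⟨0, by omega⟩, Finset.mem_univ _, ?_⟩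
        refine Finset.sum_pos' (fun j _ => hnn _ _) ⟨⟨1, by omega⟩, Finset.mem_univ _, ?_⟩
        simp [neighbor]
      exact_mod_cast this.ne'
    have hsum : Tendsto (fun n => ∑ c : {c : Composition m // 3 ≤ c.length},
          Complex.I * vertex F (vertexLegs (q n) c.1) *
            ∏ l : Fin c.1.length,
              current F (c.1.blocksFun l) (fun k => q n (c.1.embedding l k))) atTop (𝓝 0) := by
      rw [show (0 : ℂ) = ∑ c : {c : Composition m // 3 ≤ c.length}, 0 by simp]
      refine tendsto_finsetSum _ fun c _ => ?_
      have hprod : Tendsto (fun n => ∏ l : Fin c.1.length,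
          current F (c.1.blocksFun l) (fun k => q n (c.1.embedding l k))) atTop
          (𝓝 (if c.1 = Composition.ones m then 1 else 0)) := by
        rw [← prod_ite_blocksFun]
        refine tendsto_finsetProd _ fun l _ => ih _ (blocksFun_lt c l) _ fun i j => ?_
        have := hq (c.1.embedding l i) (c.1.embedding l j)
        have e : neighbor (c.1.embedding l i) (c.1.embedding l j) = neighbor i j := by
          unfold neighbor
          refine if_congr ?_ rfl rfl
          rw [Composition.coe_embedding, Composition.coe_embedding]
          omega
        rwa [e] at this
      have hvert : Tendsto (fun n => vertex F (vertexLegs (q n) c.1)) atTop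
          (𝓝 (if Even (c.1.length + 1) then
            (-(1 / (2 * F ^ 2))) ^ ((c.1.length + 1) / 2 - 1) *
              ∑ i ∈ Finset.univ.filter (fun i => Even (c.1.index i).val),
              ∑ j ∈ Finset.univ.filter (fun i => Even (c.1.index i).val), (neighbor i j : ℂ)
            else 0)) := by
        simp only [vertex, sum_even_legs, msq_neg]
        split_ifs
        · exact (hmsq _).const_mul _
        · exact tendsto_const_nhds
      have := (hvert.const_mul Complex.I).mul hprod
      convert this using 2
      by_cases hc : c.1 = Composition.ones m
      · have h0 : ∑ i ∈ Finset.univ.filter (fun i => Even (c.1.index i).val),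
            ∑ j ∈ Finset.univ.filter (fun i => Even (c.1.index i).val), (neighbor i j : ℂ) = 0 := by
          rw [hc]
          simp only [index_ones]
          refine Finset.sum_eq_zero fun i hi => Finset.sum_eq_zero fun j hj => ?_
          obtain ⟨a, ha⟩ := (Finset.mem_filter.1 hi).2
          obtain ⟨b, hb⟩ := (Finset.mem_filter.1 hj).2
          rw [neighbor, if_neg (by omega), Complex.ofReal_zero]
        rw [h0]; simp
      · rw [if_neg hc, mul_zero]
    have := (tendsto_const_nhds (x := Complex.I)).div (hmsq Finset.univ) hP |>.mul hsum
    rwa [mul_zero] at this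

variable {r s : ℕ}

/-- The Gram matrix with products `w` between the two kinds of lines, `1` between neighbors of the
same kind, and `t` between the other lines of the same kind. -/
def testGram (w : Fin r → Fin s → ℝ) (t : ℝ) : Matrix (Fin r ⊕ Fin s) (Fin r ⊕ Fin s) ℝ
  | Sum.inl i, Sum.inl j => neighbor i j + if i = j then 0 else t
  | Sum.inr i, Sum.inr j => neighbor i j + if i = j then 0 else t
  | Sum.inl i, Sum.inr j => w i j
  | Sum.inr j, Sum.inl i => w i j

theorem neighbor_comm (i j : ℕ) : neighbor i j = neighbor j i := by
  unfold neighbor; exact if_congr or_comm rfl rfl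

theorem testGram_isSymm (w : Fin r → Fin s → ℝ) (t : ℝ) : (testGram w t).IsSymm := by
  ext a b
  rw [Matrix.transpose_apply]
  cases a <;> cases b <;> simp only [testGram, neighbor_comm, eq_comm]

theorem testGram_self (w : Fin r → Fin s → ℝ) (t : ℝ) (a) : testGram w t a a = 0 := by
  cases a <;> simp [testGram, neighbor]

theorem testGram_pos {w : Fin r → Fin s → ℝ} (hw : ∀ i j, 0 < w i j) {t : ℝ} (ht : 0 < t)
    {a b : Fin r ⊕ Fin s} (hab : a ≠ b) : 0 < testGram w t a b := by
  have hn : ∀ i j, 0 ≤ neighbor i j := fun i j => by unfold neighbor; split_ifs <;> norm_num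
  cases a with
  | inl i =>
    cases b with
    | inl j =>
      rw [testGram, if_neg fun h => hab (by rw [h])]
      linarith [hn i j]
    | inr j => exact hw i j
  | inr i =>
    cases b with
    | inl j => exact hw j i
    | inr j =>
      rw [testGram, if_neg fun h => hab (by rw [h])]
      linarith [hn i j]

theorem msq_sum_ne_zero {w : Fin r → Fin s → ℝ} (hw : ∀ i j, 0 < w i j) {t : ℝ} (ht : 0 < t)
    {p : Fin r ⊕ Fin s → Fin D → ℂ} (hp : ∀ a b, mdot (p a) (p b) = (testGram w t a b : ℂ))
    {T : Finset (Fin r ⊕ Fin s)} (hT : 1 < T.card) : msq (∑ a ∈ T, p a) ≠ 0 := by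
  obtain ⟨a, ha, b, hb, hab⟩ := Finset.one_lt_card.1 hT
  have hnn : ∀ a b, 0 ≤ testGram w t a b := by
    intro a b
    rcases eq_or_ne a b with rfl | h
    · rw [testGram_self]
    · exact (testGram_pos hw ht h).le
  have : 0 < ∑ a ∈ T, ∑ b ∈ T, testGram w t a b :=
    Finset.sum_pos' (fun a _ => Finset.sum_nonneg fun b _ => hnn a b)
      ⟨a, ha, Finset.sum_pos' (fun b _ => hnn a b) ⟨b, hb, testGram_pos hw ht hab⟩⟩
  rw [msq_sum]
  simp only [hp]
  exact_mod_cast this.ne'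

theorem Admissible.of_testGram {w : Fin r → Fin s → ℝ} (hw : ∀ i j, 0 < w i j) {t : ℝ} (ht : 0 < t)
    {p : Fin r ⊕ Fin s → Fin D → ℂ} (hp : ∀ a b, mdot (p a) (p b) = (testGram w t a b : ℂ)) :
    Admissible p :=
  ⟨fun a => by rw [msq, hp, testGram_self, Complex.ofReal_zero],
    fun T _ h3 _ => msq_sum_ne_zero hw ht hp (by omega)⟩

theorem divisionSum_neg_mul (F : ℂ) (p : Fin r ⊕ Fin s → Fin D → ℂ) (z : ℂ)
    (VS : Composition r → Composition s → ℂ) :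
    divisionSum F p (fun A B => -(z * VS A B)) = -z * divisionSum F p VS := by
  simp only [divisionSum, Finset.mul_sum]
  refine Finset.sum_congr rfl fun A _ => Finset.sum_congr rfl fun B _ => ?_
  ring

/-- The limit of a coefficient `linearForm`. -/
def limitForm (w : Fin r → Fin s → ℝ) (c : Matrix (Fin r) (Fin s) ℂ)
    (cα : Matrix (Fin r) (Fin r) ℂ) (cβ : Matrix (Fin s) (Fin s) ℂ) : ℂ :=
  (∑ i, ∑ j, c i j * (2 * (w i j : ℂ))) +
    (∑ i, ∑ j, cα i j * (2 * (neighbor i j : ℂ))) + ∑ i, ∑ j, cβ i j * (2 * (neighbor i j : ℂ))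

theorem tendsto_divisionSum (F : ℂ) {w : Fin r → Fin s → ℝ}
    {p : ℕ → Fin r ⊕ Fin s → Fin D → ℂ}
    (hp : ∀ n a b, mdot (p n a) (p n b) = (testGram w (1 / ((n : ℝ) + 1)) a b : ℂ))
    (C : Composition r → Composition s → Matrix (Fin r) (Fin s) ℂ)
    (Cα : Composition r → Composition s → Matrix (Fin r) (Fin r) ℂ)
    (Cβ : Composition r → Composition s → Matrix (Fin s) (Fin s) ℂ) :
    Tendsto (fun n => divisionSum F (p n) fun A B => linearForm (p n) (C A B) (Cα A B) (Cβ A B))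
      atTop (𝓝 ((1 / (2 * F ^ 2)) ^ ((r + s - 1) / 2) *
        limitForm w (C (Composition.ones r) (Composition.ones s))
          (Cα (Composition.ones r) (Composition.ones s))
          (Cβ (Composition.ones r) (Composition.ones s)))) := by
  have hone : Tendsto (fun n : ℕ => ((1 / ((n : ℝ) + 1) : ℝ) : ℂ)) atTop (𝓝 0) := by
    have := (Complex.continuous_ofReal.tendsto 0).comp tendsto_one_div_add_atTop_nhds_zero_nat
    simpa [Function.comp_def] using this
  have hdiag : ∀ {m : ℕ} (i j : Fin m), Tendsto (fun n : ℕ =>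
      ((neighbor i j + if i = j then 0 else 1 / ((n : ℝ) + 1) : ℝ) : ℂ)) atTop
      (𝓝 (neighbor i j : ℂ)) := by
    intro m i j
    split_ifs
    · simp
    · simp only [Complex.ofReal_add]
      have := hone.const_add (neighbor i j : ℂ)
      rwa [add_zero] at this
  have hα : ∀ i j : Fin r, Tendsto (fun n => mdot (p n (Sum.inl i)) (p n (Sum.inl j))) atTop
      (𝓝 (neighbor i j : ℂ)) := by
    intro i j
    simp only [hp, testGram]
    exact hdiag i j
  have hβ : ∀ i j : Fin s, Tendsto (fun n => mdot (p n (Sum.inr i)) (p n (Sum.inr j))) atTop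
      (𝓝 (neighbor i j : ℂ)) := by
    intro i j
    simp only [hp, testGram]
    exact hdiag i j
  have hblocks : ∀ {m : ℕ} (e : Fin m → Fin r ⊕ Fin s), (∀ i j : Fin m, Tendsto (fun n =>
      mdot (p n (e i)) (p n (e j))) atTop (𝓝 (neighbor i j : ℂ))) → ∀ c : Composition m,
      Tendsto (fun n => ∏ l : Fin c.length,
        current F (c.blocksFun l) fun k => p n (e (c.embedding l k))) atTop
        (𝓝 (if c = Composition.ones m then 1 else 0)) := by
    intro m e he c
    rw [← prod_ite_blocksFun]
    refine tendsto_finsetProd _ fun l _ => tendsto_current F _ _ fun i j => ?_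
    have := he (c.embedding l i) (c.embedding l j)
    have e : neighbor (c.embedding l i) (c.embedding l j) = neighbor i j := by
      unfold neighbor
      refine if_congr ?_ rfl rfl
      rw [Composition.coe_embedding, Composition.coe_embedding]
      omega
    rwa [e] at this
  have hlin : ∀ c cα cβ, Tendsto (fun n => linearForm (p n) c cα cβ) atTop
      (𝓝 (limitForm w c cα cβ)) := by
    intro c cα cβ
    unfold linearForm limitForm mandelstam
    refine Tendsto.add (Tendsto.add ?_ ?_) ?_
    · simp only [hp, testGram]; exact tendsto_const_nhds
    · exact tendsto_finsetSum _ fun i _ => tendsto_finsetSum _ fun j _ =>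
        ((hα i j).const_mul 2).const_mul _
    · exact tendsto_finsetSum _ fun i _ => tendsto_finsetSum _ fun j _ =>
        ((hβ i j).const_mul 2).const_mul _
  unfold divisionSum
  have key := tendsto_finsetSum (Finset.univ : Finset (Composition r)) fun A _ =>
    tendsto_finsetSum (Finset.univ : Finset (Composition s)) fun B _ =>
    (((hlin (C A B) (Cα A B) (Cβ A B)).const_mul
      ((1 / (2 * F ^ 2)) ^ ((A.length + B.length - 1) / 2))).mul
        (hblocks Sum.inl hα A)).mul (hblocks Sum.inr hβ B)
  convert key using 2
  rw [Fintype.sum_eq_single (Composition.ones r), Fintype.sum_eq_single (Composition.ones s)]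
  · simp
  · intro B hB; simp [hB]
  · intro A hA; simp [hA]

/-- The coefficients of the term without sub-currents are unique. -/
theorem IsExpansion.ones_eq {F : ℂ} (hF : F ≠ 0) (hr : 0 < r) (hs : 0 < s) (hD : r + s ≤ D)
    {C C' : Composition r → Composition s → Matrix (Fin r) (Fin s) ℂ}
    {Cα Cα' : Composition r → Composition s → Matrix (Fin r) (Fin r) ℂ}
    {Cβ Cβ' : Composition r → Composition s → Matrix (Fin s) (Fin s) ℂ}
    (h : IsExpansion F D C Cα Cβ) (h' : IsExpansion F D C' Cα' Cβ') :
    C (Composition.ones r) (Composition.ones s) = C' (Composition.ones r) (Composition.ones s) := by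
  have hlim : ∀ w : Fin r → Fin s → ℝ, (∀ i j, 0 < w i j) →
      limitForm w (C (Composition.ones r) (Composition.ones s))
          (Cα (Composition.ones r) (Composition.ones s))
          (Cβ (Composition.ones r) (Composition.ones s)) =
      limitForm w (C' (Composition.ones r) (Composition.ones s))
          (Cα' (Composition.ones r) (Composition.ones s))
          (Cβ' (Composition.ones r) (Composition.ones s)) := by
    intro w hw
    choose p hp using fun n : ℕ => exists_gram (D := D) (by simpa using hD)
      (testGram w (1 / ((n : ℝ) + 1))) (testGram_isSymm w _)
    have ht : ∀ n : ℕ, 0 < 1 / ((n : ℝ) + 1) := fun n => by positivity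
    have hκ : (1 / (2 * F ^ 2)) ^ ((r + s - 1) / 2) ≠ 0 := by
      refine pow_ne_zero _ ?_
      simpa using hF
    refine mul_left_cancel₀ hκ (tendsto_nhds_unique (tendsto_divisionSum F hp C Cα Cβ)
      ((tendsto_divisionSum F hp C' Cα' Cβ').congr fun n => ?_))
    have hadm := Admissible.of_testGram hw (ht n) (hp n)
    have e := (h (p n) hadm).symm.trans (h' (p n) hadm)
    rw [divisionSum_neg_mul, divisionSum_neg_mul] at e
    refine (mul_left_cancel₀ (neg_ne_zero.2 ?_) e).symm
    rw [offShellSq, msq_neg]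
    refine msq_sum_ne_zero hw (ht n) (hp n) ?_
    rw [Finset.card_univ, Fintype.card_sum, Fintype.card_fin, Fintype.card_fin]
    omega
  have hsingle : ∀ (c : Matrix (Fin r) (Fin s) ℂ) cα cβ i j,
      limitForm (fun i' j' => if i' = i ∧ j' = j then 2 else 1) c cα cβ -
        limitForm (fun _ _ => 1) c cα cβ = 2 * c i j := by
    intro c cα cβ i j
    unfold limitForm
    rw [add_assoc, add_assoc, add_sub_add_right_eq_sub, ← Finset.sum_sub_distrib,
      Fintype.sum_eq_single i, ← Finset.sum_sub_distrib, Fintype.sum_eq_single j]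
    · simp; ring
    · intro j' hj'; simp [hj']
    · intro i' hi'; simp [hi']
  ext i j
  have h1 := hlim (fun i' j' => if i' = i ∧ j' = j then 2 else 1) fun i' j' => by
    split_ifs <;> norm_num
  have h2 := hlim (fun _ _ => 1) fun _ _ => one_pos
  have h3 := hsingle (C (Composition.ones r) (Composition.ones s))
    (Cα (Composition.ones r) (Composition.ones s)) (Cβ (Composition.ones r) (Composition.ones s)) i j
  rw [h1, h2, hsingle] at h3
  exact (mul_left_cancel₀ two_ne_zero h3).symm

end Limits

section Insertion

/-- The sum over all insertions of the first line, acting on a vector. -/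
def insertSum {n : ℕ} (f : Fin n → ℂ) (i : Fin n) : ℂ := ∑ k, f ((Fin.cycleRange k).symm i)

theorem insertSum_of_val_eq_zero {n : ℕ} (f : Fin n → ℂ) {i : Fin n} (hi : i.val = 0) :
    insertSum f i = ∑ k, f k := by
  obtain ⟨n, rfl⟩ : ∃ m, n = m + 1 := ⟨n - 1, by omega⟩
  obtain rfl : i = 0 := Fin.ext hi
  simp [insertSum, Fin.cycleRange_symm_zero]

theorem insertSum_succ {n : ℕ} (f : Fin (n + 1) → ℂ) (j : Fin n) :
    insertSum f j.succ = ((n : ℂ) - j) * f j.castSucc + (j + 1) * f j.succ := by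
  have h : ∀ k : Fin (n + 1), f ((Fin.cycleRange k).symm j.succ) =
      if k ≤ j.castSucc then f j.succ else f j.castSucc := by
    intro k
    rw [Fin.cycleRange_symm_succ, Fin.succAbove]
    by_cases hk : k ≤ j.castSucc
    · rw [if_pos hk, if_neg (not_lt.2 hk)]
    · rw [if_neg hk, if_pos (not_le.1 hk)]
  have h1 : (Finset.univ.filter fun k : Fin (n + 1) => k ≤ j.castSucc).card = j + 1 := by
    have : (Finset.univ.filter fun k : Fin (n + 1) => k ≤ j.castSucc) = Finset.Iic j.castSucc := by
      ext; simp
    rw [this, Fin.card_Iic]; simp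
  have h2 : (Finset.univ.filter fun k : Fin (n + 1) => ¬k ≤ j.castSucc).card = n - j := by
    have : (Finset.univ.filter fun k : Fin (n + 1) => ¬k ≤ j.castSucc) = Finset.Ioi j.castSucc := by
      ext; simp
    rw [this, Fin.card_Ioi]; simp
  rw [insertSum, Finset.sum_congr rfl fun k _ => h k, Finset.sum_ite, Finset.sum_const,
    Finset.sum_const, h1, h2, nsmul_eq_mul, nsmul_eq_mul, Nat.cast_sub j.isLt.le]
  push_cast
  ring

theorem insertSum_of_val_eq_succ {n : ℕ} (f : Fin n → ℂ) {i i' : Fin n} (hi : i'.val + 1 = i.val) :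
    insertSum f i = ((n : ℂ) - i.val) * f i' + i.val * f i := by
  obtain ⟨n, rfl⟩ : ∃ m, n = m + 1 := ⟨n - 1, by omega⟩
  obtain ⟨j, rfl⟩ : ∃ j : Fin n, i = j.succ := ⟨⟨i' , by omega⟩, Fin.ext (by simp [hi])⟩
  obtain rfl : i' = j.castSucc := Fin.ext (by simpa using hi)
  rw [insertSum_succ, Fin.val_succ]
  push_cast
  ring

theorem insertSum_eq_sum_insertMatrix {n : ℕ} (f : Fin n → ℂ) (i : Fin n) :
    insertSum f i = ∑ k, toC (insertMatrix n) i k * f k := by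
  by_cases hi : i.val = 0
  · rw [insertSum_of_val_eq_zero f hi]
    simp [toC, insertMatrix, hi]
  · have hi' : i.val - 1 + 1 = i.val := by omega
    rw [insertSum_of_val_eq_succ f (i' := ⟨i.val - 1, by omega⟩) hi']
    have : ∀ k : Fin n, toC (insertMatrix n) i k * f k =
        (if k = ⟨i.val - 1, by omega⟩ then ((n : ℂ) - i.val) * f k else 0) +
        if k = i then i.val * f k else 0 := by
      intro k
      simp only [toC, insertMatrix, Matrix.map_apply, Matrix.of_apply, if_neg hi, Fin.ext_iff]
      by_cases h1 : k.val = i.val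
      · rw [if_pos h1, if_neg (by omega), if_pos h1]; simp
      · by_cases h2 : k.val + 1 = i.val
        · rw [if_neg h1, if_pos h2, if_pos (by omega), if_neg h1]; push_cast; ring
        · rw [if_neg h1, if_neg h2, if_neg (by omega), if_neg h1]; simp
    rw [Finset.sum_congr rfl fun k _ => this k, Finset.sum_add_distrib]
    simp

variable {r s : ℕ}

theorem insertAlphaSum_apply (C : Matrix (Fin r) (Fin s) ℂ) (i j) :
    insertAlphaSum C i j = insertSum (fun k => C k j) i := rfl

theorem insertBetaSum_apply (C : Matrix (Fin r) (Fin s) ℂ) (i j) :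
    insertBetaSum C i j = insertSum (C i) j := rfl

theorem insertAlphaSum_eq_mul (C : Matrix (Fin r) (Fin s) ℂ) :
    insertAlphaSum C = toC (insertMatrix r) * C := by
  ext i j
  rw [insertAlphaSum_apply, insertSum_eq_sum_insertMatrix, Matrix.mul_apply]

theorem insertBetaSum_eq_mul (C : Matrix (Fin r) (Fin s) ℂ) :
    insertBetaSum C = C * (toC (insertMatrix s)).transpose := by
  ext i j
  rw [insertBetaSum_apply, insertSum_eq_sum_insertMatrix, Matrix.mul_apply]
  exact Finset.sum_congr rfl fun k _ => mul_comm _ _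

theorem choose_pred_succ_mul {n i : ℕ} (hi : i + 1 ≤ n) :
    ((n - 1).choose (i + 1) : ℂ) * (i + 1) = (n - 1).choose i * ((n : ℂ) - (i + 1)) := by
  have h : ((n - 1 - i : ℕ) : ℂ) = (n : ℂ) - (i + 1) := by
    rw [Nat.sub_sub, Nat.cast_sub (by omega)]; push_cast; ring
  rw [← h]
  exact_mod_cast Nat.choose_succ_right_eq (n - 1) i

theorem eq_of_insertSum_eq_zero {n : ℕ} {f : Fin n → ℂ} (hf : ∀ i, insertSum f i = 0) (i : Fin n)
    (h0 : 0 < n) : f i = (-1) ^ i.val * ((n - 1).choose i.val : ℂ) * f ⟨0, h0⟩ := by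
  obtain ⟨i, hi⟩ := i
  induction i with
  | zero => simp
  | succ i ih =>
    have h := hf ⟨i + 1, hi⟩
    rw [insertSum_of_val_eq_succ f (i' := ⟨i, by omega⟩) rfl, ih (by omega)] at h
    have hc := choose_pred_succ_mul (n := n) (i := i) (by omega)
    have hne : ((i : ℂ) + 1) ≠ 0 := by exact_mod_cast Nat.succ_ne_zero i
    refine mul_left_cancel₀ hne ?_
    simp only at h ⊢
    push_cast at h
    rw [pow_succ]
    linear_combination h - (-1) ^ i * (-1) * f ⟨0, h0⟩ * hc

theorem insertSum_binomial {n : ℕ} (hn : 2 ≤ n) (i : Fin n) :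
    insertSum (fun k => (-1) ^ k.val * ((n - 1).choose k.val : ℂ)) i = 0 := by
  by_cases hi : i.val = 0
  · rw [insertSum_of_val_eq_zero _ hi,
      Fin.sum_univ_eq_sum_range (fun k => (-1 : ℂ) ^ k * ((n - 1).choose k : ℂ))]
    have := Int.alternating_sum_range_choose_of_ne (n := n - 1) (by omega)
    rw [show n - 1 + 1 = n by omega] at this
    exact_mod_cast this
  · obtain ⟨i, hin⟩ := i
    obtain ⟨i, rfl⟩ : ∃ m, i = m + 1 := ⟨i - 1, by simp only at hi; omega⟩
    rw [insertSum_of_val_eq_succ _ (i' := ⟨i, by omega⟩) rfl]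
    have hc := choose_pred_succ_mul (n := n) (i := i) (by omega)
    push_cast
    rw [pow_succ]
    linear_combination -(-1) ^ i * hc

theorem sum_ite_val_lt {n m : ℕ} (hm : m ≤ n) :
    (∑ k : Fin n, if k.val < m then (1 : ℂ) else 0) = m := by
  rw [Finset.sum_boole]
  have := card_filter_le_lt (k := 0) hm
  simp only [Nat.zero_le, true_and, Nat.sub_zero] at this
  rw [this]

theorem sum_ite_le_val {n m : ℕ} (hm : m ≤ n) :
    (∑ k : Fin n, if m ≤ k.val then (1 : ℂ) else 0) = (n : ℂ) - m := by
  rw [Finset.sum_boole]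
  have : (Finset.univ.filter fun k : Fin n => m ≤ k.val) =
      Finset.univ.filter fun k : Fin n => m ≤ k.val ∧ k.val < n := by
    ext k; simp
  rw [this, card_filter_le_lt le_rfl, Nat.cast_sub hm]

theorem insertionConstraints_coeffMatrix (r s : ℕ) :
    InsertionConstraints (toC (coeffMatrix r s)) := by
  have hcase : ((r : ℤ) - s = -1) ∨ ((r : ℤ) - s = 1) ∨
      (¬((r : ℤ) - s = -1) ∧ ¬((r : ℤ) - s = 1)) := by omega
  have pred : ∀ {n : ℕ} (i : Fin n), i.val ≠ 0 → ∃ i' : Fin n, i'.val + 1 = i.val :=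
    fun i hi => ⟨⟨i.val - 1, by omega⟩, by simp only; omega⟩
  rcases hcase with h | h | ⟨h, h'⟩
  · have hc : ∀ i j, toC (coeffMatrix r s) i j = if i.val < j.val then 1 else 0 := by
      intro i j; simp [toC, coeffMatrix, h]
    constructor <;> ext i j
    · rw [insertAlphaSum_apply, show toC (dAlpha r s) i j = (dAlpha r s i j : ℂ) from rfl]
      simp only [dAlpha, Matrix.of_apply, if_pos h]
      by_cases hi : i.val = 0
      · rw [insertSum_of_val_eq_zero _ hi, if_pos hi]
        simp only [hc]
        rw [sum_ite_val_lt (by omega)]; simp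
      · obtain ⟨i', hi'⟩ := pred i hi
        rw [insertSum_of_val_eq_succ _ hi', if_neg hi]
        simp only [hc]
        split_ifs <;> first | omega | (push_cast; ring)
    · rw [insertBetaSum_apply, show toC (dBeta r s) i j = (dBeta r s i j : ℂ) from rfl]
      simp only [dBeta, Matrix.of_apply, if_pos h]
      by_cases hj : j.val = 0
      · rw [insertSum_of_val_eq_zero _ hj, if_pos hj]
        simp only [hc, ← Nat.succ_le_iff]
        rw [sum_ite_le_val (by omega)]; push_cast; ring
      · obtain ⟨j', hj'⟩ := pred j hj
        rw [insertSum_of_val_eq_succ _ hj', if_neg hj]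
        simp only [hc]
        split_ifs <;> first | omega | (push_cast; ring)
  · have h' : ¬((r : ℤ) - s = -1) := by omega
    have hc : ∀ i j, toC (coeffMatrix r s) i j = if i.val ≤ j.val then 1 else 0 := by
      intro i j; simp [toC, coeffMatrix, h]
    constructor <;> ext i j
    · rw [insertAlphaSum_apply, show toC (dAlpha r s) i j = (dAlpha r s i j : ℂ) from rfl]
      simp only [dAlpha, Matrix.of_apply, if_neg h', if_pos h]
      by_cases hi : i.val = 0
      · rw [insertSum_of_val_eq_zero _ hi, if_pos hi]
        simp only [hc, ← Nat.lt_succ_iff]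
        rw [sum_ite_val_lt (by omega)]; push_cast; ring
      · obtain ⟨i', hi'⟩ := pred i hi
        rw [insertSum_of_val_eq_succ _ hi', if_neg hi]
        simp only [hc]
        split_ifs <;> first | omega | (push_cast; ring)
    · rw [insertBetaSum_apply, show toC (dBeta r s) i j = (dBeta r s i j : ℂ) from rfl]
      simp only [dBeta, Matrix.of_apply, if_neg h', if_pos h]
      by_cases hj : j.val = 0
      · rw [insertSum_of_val_eq_zero _ hj, if_pos hj]
        simp only [hc]
        rw [sum_ite_le_val (by omega)]; push_cast; ring
      · obtain ⟨j', hj'⟩ := pred j hj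
        rw [insertSum_of_val_eq_succ _ hj', if_neg hj]
        simp only [hc]
        split_ifs <;> first | omega | (push_cast; ring)
  · constructor <;> ext i j
    · rw [insertAlphaSum_apply]
      simp [insertSum, toC, coeffMatrix, dAlpha, h, h']
    · rw [insertBetaSum_apply]
      simp [insertSum, toC, coeffMatrix, dBeta, h, h']

theorem insertSum_add {n : ℕ} (f g : Fin n → ℂ) (i : Fin n) :
    insertSum (fun k => f k + g k) i = insertSum f i + insertSum g i :=
  Finset.sum_add_distrib

theorem insertSum_mul {n : ℕ} (c : ℂ) (f : Fin n → ℂ) (i : Fin n) :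
    insertSum (fun k => c * f k) i = c * insertSum f i :=
  (Finset.mul_sum _ _ _).symm

/-- A solution of the constraints differs from `C(r, s)` by a multiple of the product of
alternating binomial coefficients. -/
theorem InsertionConstraints.sub_eq {C : Matrix (Fin r) (Fin s) ℂ} (hC : InsertionConstraints C)
    (hr : 0 < r) (hs : 0 < s) (i : Fin r) (j : Fin s) :
    C i j - toC (coeffMatrix r s) i j = (-1) ^ i.val * ((r - 1).choose i.val : ℂ) *
      ((-1) ^ j.val * ((s - 1).choose j.val : ℂ) *
        (C ⟨0, hr⟩ ⟨0, hs⟩ - toC (coeffMatrix r s) ⟨0, hr⟩ ⟨0, hs⟩)) := by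
  have h0 := insertionConstraints_coeffMatrix r s
  have hα : ∀ j i, insertSum (fun k => C k j - toC (coeffMatrix r s) k j) i = 0 := by
    intro j i
    have h1 := congrFun (congrFun (hC.1.trans h0.1.symm) i) j
    rw [insertAlphaSum_apply, insertAlphaSum_apply] at h1
    rw [insertSum, Finset.sum_sub_distrib]
    exact sub_eq_zero.2 h1
  have hβ : ∀ i j, insertSum (fun k => C i k - toC (coeffMatrix r s) i k) j = 0 := by
    intro i j
    have h1 := congrFun (congrFun (hC.2.trans h0.2.symm) i) j
    rw [insertBetaSum_apply, insertBetaSum_apply] at h1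
    rw [insertSum, Finset.sum_sub_distrib]
    exact sub_eq_zero.2 h1
  rw [eq_of_insertSum_eq_zero (hα j) i hr, eq_of_insertSum_eq_zero (hβ ⟨0, hr⟩) j hs]

theorem insertionConstraints_iff (hr : 2 ≤ r) (hs : 2 ≤ s) (C : Matrix (Fin r) (Fin s) ℂ) :
    InsertionConstraints C ↔ ∃ n : ℂ, ∀ i j, C i j =
      n * (-1) ^ (i.val + j.val) * ((r - 1).choose i.val : ℂ) * ((s - 1).choose j.val : ℂ) +
        toC (coeffMatrix r s) i j := by
  constructor
  · intro hC
    refine ⟨C ⟨0, by omega⟩ ⟨0, by omega⟩ - toC (coeffMatrix r s) ⟨0, by omega⟩ ⟨0, by omega⟩,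
      fun i j => ?_⟩
    rw [pow_add]
    linear_combination hC.sub_eq (by omega) (by omega) i j
  · rintro ⟨n, hn⟩
    obtain ⟨h1, h2⟩ := insertionConstraints_coeffMatrix r s
    constructor
    · rw [← h1]
      ext i j
      rw [insertAlphaSum_apply, insertAlphaSum_apply]
      have : (fun k => C k j) = fun k => (n * (-1) ^ j.val * ((s - 1).choose j.val : ℂ)) *
          ((-1) ^ k.val * ((r - 1).choose k.val : ℂ)) + toC (coeffMatrix r s) k j := by
        funext k; rw [hn, pow_add]; ring
      rw [this, insertSum_add, insertSum_mul, insertSum_binomial hr, mul_zero, zero_add]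
    · rw [← h2]
      ext i j
      rw [insertBetaSum_apply, insertBetaSum_apply]
      have : C i = fun k => (n * (-1) ^ i.val * ((r - 1).choose i.val : ℂ)) *
          ((-1) ^ k.val * ((s - 1).choose k.val : ℂ)) + toC (coeffMatrix r s) i k := by
        funext k; rw [hn, pow_add]; ring
      rw [this, insertSum_add, insertSum_mul, insertSum_binomial hs, mul_zero, zero_add]

theorem insertionConstraints_and_corner_iff (hr : 0 < r) (hs : 0 < s)
    (C : Matrix (Fin r) (Fin s) ℂ) :
    (InsertionConstraints C ∧ C ⟨r - 1, Nat.sub_lt hr Nat.one_pos⟩ ⟨0, hs⟩ = 0) ↔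
      C = toC (coeffMatrix r s) := by
  have hcorner : toC (coeffMatrix r s) ⟨r - 1, Nat.sub_lt hr Nat.one_pos⟩ ⟨0, hs⟩ = 0 := by
    simp only [toC, coeffMatrix, Matrix.map_apply, Matrix.of_apply]
    split_ifs <;> first | omega | simp
  constructor
  · rintro ⟨hC, h0⟩
    have h1 := hC.sub_eq hr hs ⟨r - 1, Nat.sub_lt hr Nat.one_pos⟩ ⟨0, hs⟩
    rw [h0, hcorner, sub_self] at h1
    simp only [Nat.choose_self, Nat.choose_zero_right, Nat.cast_one, mul_one, pow_zero, one_mul] at h1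
    have h2 := (mul_eq_zero.1 h1.symm).resolve_left (pow_ne_zero _ (neg_ne_zero.2 one_ne_zero))
    ext i j
    have := hC.sub_eq hr hs i j
    rw [h2, mul_zero, mul_zero] at this
    exact sub_eq_zero.1 this
  · rintro rfl
    exact ⟨insertionConstraints_coeffMatrix r s, hcorner⟩

end Insertion

end NLSM

theorem mainTheorem3 (F : ℂ) (hF : F ≠ 0) (r s : ℕ) (hr : 0 < r) (hs : 0 < s) :
    -- the revised BCJ sum has an expansion with integer coefficients of the `s_{α_i β_j}` only,
    -- valid in every dimension, whose term without sub-currents has the coefficients `C(r, s)`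
    (∃ C : Composition r → Composition s → Matrix (Fin r) (Fin s) ℤ,
      C (Composition.ones r) (Composition.ones s) = NLSM.coeffMatrix r s ∧
      ∀ D : ℕ, NLSM.IsExpansion F D (fun A B => NLSM.toC (C A B)) 0 0) ∧
    -- every expansion has these coefficients in the term without sub-currents
    (∀ D : ℕ, r + s ≤ D →
      ∀ (C : Composition r → Composition s → Matrix (Fin r) (Fin s) ℂ)
        (Cα : Composition r → Composition s → Matrix (Fin r) (Fin r) ℂ)
        (Cβ : Composition r → Composition s → Matrix (Fin s) (Fin s) ℂ),
        NLSM.IsExpansion F D C Cα Cβ →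
          C (Composition.ones r) (Composition.ones s) = NLSM.toC (NLSM.coeffMatrix r s)) ∧
    -- the constraints from permuting `α_1` and `β_1` in matrix form
    (∀ C : Matrix (Fin r) (Fin s) ℂ,
      NLSM.insertAlphaSum C = NLSM.toC (NLSM.insertMatrix r) * C ∧
      NLSM.insertBetaSum C = C * (NLSM.toC (NLSM.insertMatrix s)).transpose) ∧
    -- their solutions form a one-parameter family
    (2 ≤ r → 2 ≤ s → ∀ C : Matrix (Fin r) (Fin s) ℂ,
      NLSM.InsertionConstraints C ↔
        ∃ n : ℂ, ∀ i j, C i j =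
          n * (-1) ^ (i.val + j.val) * ((r - 1).choose i.val : ℂ) * ((s - 1).choose j.val : ℂ) +
            NLSM.toC (NLSM.coeffMatrix r s) i j) ∧
    -- and together with `c^{r1} = 0` they have `C(r, s)` as the unique solution
    (∀ C : Matrix (Fin r) (Fin s) ℂ,
      (NLSM.InsertionConstraints C ∧ C ⟨r - 1, Nat.sub_lt hr Nat.one_pos⟩ ⟨0, hs⟩ = 0) ↔
        C = NLSM.toC (NLSM.coeffMatrix r s)) := by
  refine ⟨⟨NLSM.divisionCoeff, NLSM.divisionCoeff_ones r s,
      fun D => NLSM.isExpansion_divisionCoeff hF D hr hs⟩, fun D hD C Cα Cβ hC => ?_,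
    fun C => ⟨NLSM.insertAlphaSum_eq_mul C, NLSM.insertBetaSum_eq_mul C⟩,
    NLSM.insertionConstraints_iff, NLSM.insertionConstraints_and_corner_iff hr hs⟩
  rw [hC.ones_eq hF hr hs hD (NLSM.isExpansion_divisionCoeff hF D hr hs),
    NLSM.divisionCoeff_ones]
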